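/- Let $M$ be a real $n\times m$ matrix with columns $M_1,\dots,M_m\in\mathbb{R}^n$ and let $s=\mathrm{rank}(M)$; no general-position assumption is made. A hyperplane is given by a nonzero normal vector $h\in\mathbb{R}^n$ (it passes through the origin); it contains $M_i$ if $h\cdot M_i=0$. Its hyperplane partition is the map $i\mapsto 1$ if $h\cdot M_i\ge 0$ and $i\mapsto -1$ otherwise; its hyperplane separation is the map $i\mapsto\mathrm{sign}(h\cdot M_i)\in\{-1,0,1\}$. The partition by $h$ is an extension of the separation by $g$ if the two agree on every column where the separation is nonzero. (1) For every hyperplane $h$ there is a hyperplane $g$ that contains at least $s-1$ linearly independent columns of $M$ (so, together with the origin, $s$ affinely independent points), such that the partition by $h$ is an extension of the separation by $g$; moreover, if $h$ does not contain all columns of $M$, then neither does $g$. (2) For every hyperplane $h$ there are $k\le s$ and strictly nested sets of column indices $\{1,\dots,m\}=S_0\supsetneq S_1\supsetneq\dots\supsetneq S_k$, with $|S_j|\le s$ for $1\le j\le k$, such that there are hyperplanes $g_1,\dots,g_k$ for which $g_j$ contains all columns in $S_j$ but not all columns in $S_{j-1}$ $(1\le j\le k)$, and such that any hyperplanes with this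 property, after replacing some of the $g_j$ by $-g_j$, satisfy: for every $i$, the value of the partition by $h$ at $M_i$ is $\mathrm{sign}(g_j\cdot M_i)$ for the smallest $j$ with $g_j\cdot M_i\ne 0$, and it is $1$ if there is no such $j$. (3) There is an algorithm (one program for a real random access machine with unit-cost real arithmetic $+,-,\times,/$ and comparisons, index arithmetic $+,-$, and indirect addressing) that, given $n$, $m$ and $M$, prints all hyperplane partitions of the columns of $M$ and nothing else (repetitions allowed) in time $O\big((n+1)(m+1)(s+1)+m^s(s+2)^s\big)$, with an absolute constant. Here the first term is for reading $M$ and removing linear dependencies; it is dominated by the second one if $n=s\ge 1$. (4) A $(k,s)$-simplicial partition of the columns of $M$ is given by $k$ families $\mathcal H^j=\{h^j_1,\dots,h^j_s\}$ of $s$ hyperplanes: with $Q_j=\{i: h^j_l\cdot M_i\ge 0 \text{ for all } l\}$, it has the parts $P_j=Q_j\setminus(P_1\cup\dots\cup P_{j-1})$ for $1\le j\le k$ and $P_{k+1}=\{1,\dots,m\}\setminus(P_1\cup\dots\cup P_k)$. There is an algorithm (one program in the same model) that, given $n,m,k,s$ and $M$ with $\mathrm{rank}(M)\le s$, prints a list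 of partitions of the columns of $M$ into $k+1$ labelled parts that contains all $(k,s)$-simplicial partitions, in time $O_{k,s}\big((n+1)(m+1)+m^{ks^2}\big)$, where the constant depends only on $k$ and $s$. -/

import Mathlib

/-! ### Hyperplanes through the origin and the columns of a matrix

A hyperplane of `ℝⁿ` is given by a nonzero normal vector `h`; the sign of `h` (its orientation)
matters for the sides of the hyperplane. -/

namespace HyperplanePartitions

/-- The hyperplane separation of the columns of `M` by `h`: the sign of `h · Mᵢ`. -/
noncomputable def separation {n m : ℕ} (M : Matrix (Fin n) (Fin m) ℝ) (h : Fin n → ℝ) :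
    Fin m → SignType :=
  fun i => SignType.sign (h ⬝ᵥ M.col i)

open Classical in
/-- The hyperplane partition of the columns of `M` by `h`: `1` if `h · Mᵢ ≥ 0`, else `-1`. -/
noncomputable def partition {n m : ℕ} (M : Matrix (Fin n) (Fin m) ℝ) (h : Fin n → ℝ) :
    Fin m → SignType :=
  fun i => if 0 ≤ h ⬝ᵥ M.col i then 1 else -1

/-- `σ` is the partition of the columns of `M` by some hyperplane. -/
def IsHyperplanePartition {n m : ℕ} (M : Matrix (Fin n) (Fin m) ℝ) (σ : Fin m → SignType) : Prop :=
  ∃ h : Fin n → ℝ, h ≠ 0 ∧ σ = partition M h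

/-- The partition by `h` is an extension of the separation by `g`. -/
def IsExtension {n m : ℕ} (M : Matrix (Fin n) (Fin m) ℝ) (h g : Fin n → ℝ) : Prop :=
  ∀ i, separation M g i ≠ 0 → separation M g i = partition M h i

/-- The hyperplane `g` contains the columns of `M` with index in `S`. -/
def ContainsColumns {n m : ℕ} (M : Matrix (Fin n) (Fin m) ℝ) (g : Fin n → ℝ)
    (S : Finset (Fin m)) : Prop :=
  ∀ i ∈ S, g ⬝ᵥ M.col i = 0

/-- The hyperplanes `g₁, …, g_k` fit the nested sets `S₀ ⊃ S₁ ⊃ ⋯ ⊃ S_k`: each `g_j` contains the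
columns in `S_j`, but not all the columns in `S_{j-1}`. -/
def Fits {n m k : ℕ} (M : Matrix (Fin n) (Fin m) ℝ) (S : Fin (k + 1) → Finset (Fin m))
    (g : Fin k → Fin n → ℝ) : Prop :=
  ∀ j : Fin k, ContainsColumns M (g j) (S j.succ) ∧ ¬ ContainsColumns M (g j) (S j.castSucc)

/-- The partition by `h` is read off from `g₁, …, g_k`: the value at a column is the value of the
first separation that does not vanish there, and it is `1` if they all vanish there. -/
def IsFirstNonzero {n m k : ℕ} (M : Matrix (Fin n) (Fin m) ℝ) (h : Fin n → ℝ)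
    (g : Fin k → Fin n → ℝ) : Prop :=
  ∀ i : Fin m,
    (∀ j, separation M (g j) i ≠ 0 → (∀ j' < j, separation M (g j') i = 0) →
      partition M h i = separation M (g j) i) ∧
    ((∀ j, separation M (g j) i = 0) → partition M h i = 1)

/-- The set `Q_j` of the columns on the nonnegative side of every hyperplane of the `j`-th set. -/
def cell {n m k s : ℕ} (M : Matrix (Fin n) (Fin m) ℝ) (H : Fin k → Fin s → Fin n → ℝ) (j : Fin k) :
    Set (Fin m) :=
  {i | ∀ l, 0 ≤ H j l ⬝ᵥ M.col i}

/-- `σ` is a `(k, s)`-simplicial partition of the columns of `M`, given as the map that sends a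
column to the index of its part: `P_j = Q_j - P_1 - ⋯ - P_{j-1}` for `j ≤ k`, and the last part
holds the remaining columns. -/
def IsSimplicialPartition {n m : ℕ} (M : Matrix (Fin n) (Fin m) ℝ) (k s : ℕ)
    (σ : Fin m → Fin (k + 1)) : Prop :=
  ∃ H : Fin k → Fin s → Fin n → ℝ, (∀ j l, H j l ≠ 0) ∧
    ∀ (i : Fin m) (j : Fin k),
      σ i = j.castSucc ↔ i ∈ cell M H j ∧ ∀ j' < j, σ i ≠ j'.castSucc

end HyperplanePartitions

/-! ### The real random access machine

Structured programs over finitely many index registers, an index memory and a memory of real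
numbers (both indirectly addressed), and a write-only output tape of natural numbers. Every basic
instruction and every evaluation of a test takes one step. -/

namespace RealRAM

/-- A configuration: the index registers, the index memory, the real memory, the output tape. -/
structure State where
  reg : ℕ → ℕ
  mem : ℕ → ℕ
  rmem : ℕ → ℝ
  out : List ℕ

/-- The basic instructions. Operands are the names of index registers; for the operations on reals
these registers hold the addresses of the operands in the real memory. -/
inductive Instr where
  | const (d c : ℕ)
  | copy (d a : ℕ)
  | add (d a b : ℕ)
  | sub (d a b : ℕ)
  | load (d a : ℕ)
  | store (d a : ℕ)
  | rconst (d : ℕ) (c : ℤ)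
  | rcopy (d a : ℕ)
  | radd (d a b : ℕ)
  | rsub (d a b : ℕ)
  | rmul (d a b : ℕ)
  | rdiv (d a b : ℕ)
  | emit (a : ℕ)

/-- Write `v` into register `d`. -/
def State.setReg (S : State) (d v : ℕ) : State :=
  { S with reg := Function.update S.reg d v }

/-- Write `x` into the real memory cell whose address is in register `d`. -/
noncomputable def State.setReal (S : State) (d : ℕ) (x : ℝ) : State :=
  { S with rmem := Function.update S.rmem (S.reg d) x }

/-- The content of the real memory cell whose address is in register `a`. -/
def State.real (S : State) (a : ℕ) : ℝ :=
  S.rmem (S.reg a)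

/-- The effect of a basic instruction. Subtraction of indices is truncated at `0`; a division by
`0` returns `0`. -/
noncomputable def Instr.run : Instr → State → State
  | .const d c, S => S.setReg d c
  | .copy d a, S => S.setReg d (S.reg a)
  | .add d a b, S => S.setReg d (S.reg a + S.reg b)
  | .sub d a b, S => S.setReg d (S.reg a - S.reg b)
  | .load d a, S => S.setReg d (S.mem (S.reg a))
  | .store d a, S => { S with mem := Function.update S.mem (S.reg d) (S.reg a) }
  | .rconst d c, S => S.setReal d (c : ℝ)
  | .rcopy d a, S => S.setReal d (S.real a)
  | .radd d a b, S => S.setReal d (S.real a + S.real b)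
  | .rsub d a b, S => S.setReal d (S.real a - S.real b)
  | .rmul d a b, S => S.setReal d (S.real a * S.real b)
  | .rdiv d a b, S => S.setReal d (S.real a / S.real b)
  | .emit a, S => { S with out := S.out ++ [S.reg a] }

/-- The tests: comparison of two index registers, or of two addressed reals. -/
inductive Test where
  | lt (a b : ℕ)
  | rlt (a b : ℕ)

/-- When a test succeeds. -/
def Test.Holds : Test → State → Prop
  | .lt a b, S => S.reg a < S.reg b
  | .rlt a b, S => S.real a < S.real b

/-- Programs. -/
inductive Prog where
  | skip
  | instr (i : Instr)
  | seq (p q : Prog)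
  | ite (c : Test) (p q : Prog)
  | while (c : Test) (p : Prog)

/-- `Exec p S t T`: the program `p`, started in `S`, halts in `T` after exactly `t` steps. -/
inductive Exec : Prog → State → ℕ → State → Prop where
  | skip (S : State) : Exec .skip S 1 S
  | instr (i : Instr) (S : State) : Exec (.instr i) S 1 (i.run S)
  | seq {p q : Prog} {S T U : State} {t u : ℕ} :
      Exec p S t T → Exec q T u U → Exec (.seq p q) S (t + u) U
  | iteTrue {c : Test} {p q : Prog} {S T : State} {t : ℕ} :
      c.Holds S → Exec p S t T → Exec (.ite c p q) S (t + 1) T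
  | iteFalse {c : Test} {p q : Prog} {S T : State} {t : ℕ} :
      ¬ c.Holds S → Exec q S t T → Exec (.ite c p q) S (t + 1) T
  | whileTrue {c : Test} {p : Prog} {S T U : State} {t u : ℕ} :
      c.Holds S → Exec p S t T → Exec (.while c p) T u U → Exec (.while c p) S (t + u + 1) U
  | whileFalse {c : Test} {p : Prog} {S : State} :
      ¬ c.Holds S → Exec (.while c p) S 1 S

/-- The initial configuration: the parameters are in the registers `0, 1, …`, the matrix is in the
real memory, row by row, and everything else is `0`. -/
noncomputable def input {n m : ℕ} (params : List ℕ) (M : Matrix (Fin n) (Fin m) ℝ) : State where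
  reg := fun r => params.getD r 0
  mem := fun _ => 0
  rmem := fun a =>
    if h : a < n * m then
      M (finProdFinEquiv.symm ⟨a, h⟩).1 (finProdFinEquiv.symm ⟨a, h⟩).2
    else 0
  out := []

/-- On the input `params`, `M`, the program halts after exactly `t` steps, and it has printed the
given words (over the positive integers), each followed by the end marker `0`. -/
def Prints {n m : ℕ} (P : Prog) (params : List ℕ) (M : Matrix (Fin n) (Fin m) ℝ)
    (words : List (List ℕ)) (t : ℕ) : Prop :=
  ∃ T : State, Exec P (input params M) t T ∧ T.out = words.flatMap (fun w => w ++ [0])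

end RealRAM

namespace HyperplanePartitions

/-- The letter for a side of a hyperplane. -/
def signCode : SignType → ℕ
  | .neg => 1
  | .pos => 2
  | .zero => 3

/-- The word of length `m` that lists the sides of the columns. -/
def signWord {m : ℕ} (σ : Fin m → SignType) : List ℕ :=
  List.ofFn fun i => signCode (σ i)

/-- The word of length `m` that lists the parts (numbered from `1`) of the columns. -/
def partWord {m k : ℕ} (σ : Fin m → Fin (k + 1)) : List ℕ :=
  List.ofFn fun i => (σ i : ℕ) + 1

end HyperplanePartitions

/-! Everything rests on one fact about a functional `f` and finitely many vectors. If `f` does not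
vanish on all of them, it can be rotated, without carrying a vector strictly to the wrong side,
until the vectors on its hyperplane span a subspace of codimension one in the span of all of them
(`Refines.improve`, `exists_refines`). As long as the codimension is larger, there is a direction
that vanishes on the vectors already reached and on one fixed vector off the hyperplane; moving
along it up to the first hit catches a new vector. This is (1).

Repeating the rotation among the vectors caught gives a flag (`exists_flag`): a basis `v (c 0), …, v
(c (d - 1))` such that the side of each vector is the sign of its last nonzero value `e j * G j`,
and the nonnegative side if there is none. Here `G j` may be any functional that vanishes at `c 0,
…, c (j - 1)` but not at `c j`: on the span of the first `j + 1` basis vectors it is proportional to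
the rotated functional, so only the sign `e j` has to be chosen. The recursion stops at the level
`a` where `f` vanishes on all the vectors left; below it the signs are `0`. Read from the top down,
this is (2).

For the algorithms, suitable `G j` come from elimination. After clearing the columns `c 0, c 1, …`
in turn from `r = rank M` independent rows, the row `j` lies in the row space and vanishes at the
earlier columns, and `diagonal_ne_zero` shows that it does not vanish at `c j`. The last column need
not be known, because no row is left to be cleared. So `r - 1` columns and `r` signs describe a
partition (`exists_digits`). There are at most `3 ^ r * m ^ (r - 1)` such descriptions, each
evaluated in about `r ^ 2 * m` steps, and a mixed radix counter runs through all of them. Conversely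
every description comes from a hyperplane (`exists_hyperplane_of_digits`), since a lexicographic
sign is the sign of one linear combination with rapidly changing weights (`exists_lexSide_coeffs`).
For (4) the same counter describes `k * s` hyperplanes at once.

The programs are verified by total correctness triples with step bounds, `Trip`, against exact
descriptions of the memory; all linear algebra happens on these descriptions. The time bound of (3)
comes down to `three_pow_mul_sq_le`. -/

namespace RealRAM

/-! ### Hoare-style rules with step bounds -/

/-- `p`, started in `S`, halts within `b` steps in a state that satisfies `Q`. -/
def Trip (p : Prog) (S : State) (b : ℕ) (Q : State → Prop) : Prop :=
  ∃ t T, Exec p S t T ∧ t ≤ b ∧ Q T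

infixr:60 " ;; " => Prog.seq

theorem Trip.mono {p : Prog} {S : State} {b c : ℕ} {Q R : State → Prop} (h : Trip p S b Q)
    (hbc : b ≤ c) (hQR : ∀ T, Q T → R T) : Trip p S c R := by
  obtain ⟨t, T, he, ht, hq⟩ := h
  exact ⟨t, T, he, ht.trans hbc, hQR T hq⟩

theorem Trip.le {p : Prog} {S : State} {b c : ℕ} {Q : State → Prop} (h : Trip p S b Q)
    (hbc : b ≤ c) : Trip p S c Q :=
  h.mono hbc fun _ => id

theorem Trip.imp {p : Prog} {S : State} {b : ℕ} {Q R : State → Prop} (h : Trip p S b Q)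
    (hQR : ∀ T, Q T → R T) : Trip p S b R :=
  h.mono le_rfl hQR

theorem Trip.bind {p q : Prog} {S : State} {b c : ℕ} {Q R : State → Prop} (h : Trip p S b Q)
    (hq : ∀ T, Q T → Trip q T c R) : Trip (p ;; q) S (b + c) R := by
  obtain ⟨t, T, he, ht, hQ⟩ := h
  obtain ⟨u, U, he', hu, hR⟩ := hq T hQ
  exact ⟨t + u, U, .seq he he', by omega, hR⟩

theorem Trip.skip {S : State} {Q : State → Prop} (h : Q S) : Trip .skip S 1 Q :=
  ⟨1, S, .skip S, le_rfl, h⟩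

theorem Trip.instr {i : Instr} {S : State} {Q : State → Prop} (h : Q (i.run S)) :
    Trip (.instr i) S 1 Q :=
  ⟨1, _, .instr i S, le_rfl, h⟩

theorem Trip.step {i : Instr} {q : Prog} {S : State} {b : ℕ} {Q : State → Prop}
    (h : Trip q (i.run S) b Q) : Trip (.instr i ;; q) S (b + 1) Q := by
  obtain ⟨t, T, he, ht, hQ⟩ := h
  exact ⟨1 + t, T, .seq (.instr i S) he, by omega, hQ⟩

theorem Trip.ite {c : Test} {p q : Prog} {S : State} {b : ℕ} {Q : State → Prop}
    (h₁ : c.Holds S → Trip p S b Q) (h₂ : ¬ c.Holds S → Trip q S b Q) :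
    Trip (.ite c p q) S (b + 1) Q := by
  by_cases hc : c.Holds S
  · obtain ⟨t, T, he, ht, hQ⟩ := h₁ hc
    exact ⟨t + 1, T, .iteTrue hc he, by omega, hQ⟩
  · obtain ⟨t, T, he, ht, hQ⟩ := h₂ hc
    exact ⟨t + 1, T, .iteFalse hc he, by omega, hQ⟩

/-- For loops with a known number of rounds: the invariant is indexed by the rounds done and alone
decides the test. Each round pays one extra step for its test, and the failing test pays the last
step. -/
theorem Trip.while {c : Test} {p : Prog} {b : ℕ} (I : ℕ → State → Prop) (N : ℕ) {S : State}
    (h0 : I 0 S) (hc : ∀ i < N, ∀ T, I i T → c.Holds T)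
    (hb : ∀ i < N, ∀ T, I i T → Trip p T b (I (i + 1)))
    (hN : ∀ T, I N T → ¬ c.Holds T) : Trip (.while c p) S (N * (b + 1) + 1) (I N) := by
  suffices H : ∀ d i, i + d = N → ∀ T, I i T → Trip (.while c p) T (d * (b + 1) + 1) (I N) from
    H N 0 (by omega) S h0
  intro d
  induction d with
  | zero =>
    intro i hi T hT
    obtain rfl : i = N := by omega
    exact ⟨1, T, .whileFalse (hN T hT), by omega, hT⟩
  | succ d ih =>
    intro i hi T hT
    obtain ⟨t, U, he, ht, hU⟩ := hb i (by omega) T hT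
    obtain ⟨u, W, he', hu, hW⟩ := ih (i + 1) (by omega) U hU
    refine ⟨t + u + 1, W, .whileTrue (hc i (by omega) T hT) he he', ?_, hW⟩
    rw [Nat.succ_mul]
    omega

/-- For loops whose number of rounds depends on the data, such as the rank or the length of a carry:
success of the test must itself force `i < B`. -/
theorem Trip.while_le {c : Test} {p : Prog} {b : ℕ} (I : ℕ → State → Prop) (B : ℕ) {S : State}
    (h0 : I 0 S) (hb : ∀ i T, I i T → c.Holds T → i < B ∧ Trip p T b (I (i + 1))) :
    Trip (.while c p) S (B * (b + 1) + 1) fun T => (∃ i, I i T) ∧ ¬ c.Holds T := by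
  suffices H : ∀ d i, i + d = B → ∀ T, I i T →
      Trip (.while c p) T (d * (b + 1) + 1) fun T => (∃ i, I i T) ∧ ¬ c.Holds T from
    H B 0 (by omega) S h0
  intro d
  induction d with
  | zero =>
    intro i hi T hT
    exact ⟨1, T, .whileFalse fun hc => by have := (hb i T hT hc).1; omega, by omega, ⟨i, hT⟩,
      fun hc => by have := (hb i T hT hc).1; omega⟩
  | succ d ih =>
    intro i hi T hT
    by_cases hc : c.Holds T
    · obtain ⟨t, U, he, ht, hU⟩ := (hb i T hT hc).2
      obtain ⟨u, W, he', hu, hW⟩ := ih (i + 1) (by omega) U hU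
      refine ⟨t + u + 1, W, .whileTrue hc he he', ?_, hW⟩
      rw [Nat.succ_mul]
      omega
    · exact ⟨1, T, .whileFalse hc, by omega, ⟨i, hT⟩, hc⟩

/-! ### Reading off states -/

/-- The registers below `lo` of `T` are given by `f`. -/
def Same (lo : ℕ) (f : ℕ → ℕ) (T : State) : Prop :=
  ∀ r, r < lo → T.reg r = f r

theorem Same.eq {lo : ℕ} {f : ℕ → ℕ} {T : State} (h : Same lo f T) : ∀ r, r < lo → T.reg r = f r :=
  h

theorem Same.mono {lo hi : ℕ} {f : ℕ → ℕ} {T : State} (h : Same hi f T) (hl : lo ≤ hi) :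
    Same lo f T :=
  fun r hr => h r (hr.trans_le hl)

theorem Same.trans {lo hi : ℕ} {f : ℕ → ℕ} {S T : State} (h : Same hi S.reg T) (h' : Same lo f S)
    (hl : lo ≤ hi) : Same lo f T :=
  fun r hr => (h r (hr.trans_le hl)).trans (h' r hr)

@[simp] theorem same_refl (lo : ℕ) (S : State) : Same lo S.reg S := fun _ _ => rfl

@[simp] theorem same_setReg {lo d v : ℕ} {f : ℕ → ℕ} {T : State} (h : lo ≤ d) :
    Same lo f (T.setReg d v) ↔ Same lo f T := by
  refine forall₂_congr fun r hr => ?_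
  simp [State.setReg, Function.update_of_ne (show r ≠ d by omega)]

@[simp] theorem same_setReal {lo d : ℕ} {x : ℝ} {f : ℕ → ℕ} {T : State} :
    Same lo f (T.setReal d x) ↔ Same lo f T := Iff.rfl

/-- Write `v` into the cell `a` of the index memory. -/
def State.setMem (S : State) (a v : ℕ) : State :=
  { S with mem := Function.update S.mem a v }

/-- Print `v`. -/
def State.print (S : State) (v : ℕ) : State :=
  { S with out := S.out ++ [v] }

@[simp] theorem same_setMem {lo a v : ℕ} {f : ℕ → ℕ} {T : State} :
    Same lo f (T.setMem a v) ↔ Same lo f T := Iff.rfl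

@[simp] theorem same_print {lo v : ℕ} {f : ℕ → ℕ} {T : State} :
    Same lo f (T.print v) ↔ Same lo f T := Iff.rfl

@[simp] theorem setReg_reg (S : State) (d v r : ℕ) :
    (S.setReg d v).reg r = if r = d then v else S.reg r := by
  simp [State.setReg, Function.update_apply]

@[simp] theorem setReg_mem (S : State) (d v : ℕ) : (S.setReg d v).mem = S.mem := rfl

@[simp] theorem setReg_rmem (S : State) (d v : ℕ) : (S.setReg d v).rmem = S.rmem := rfl

@[simp] theorem setReg_out (S : State) (d v : ℕ) : (S.setReg d v).out = S.out := rfl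

@[simp] theorem setReal_reg (S : State) (d : ℕ) (x : ℝ) : (S.setReal d x).reg = S.reg := rfl

@[simp] theorem setReal_mem (S : State) (d : ℕ) (x : ℝ) : (S.setReal d x).mem = S.mem := rfl

@[simp] theorem setReal_rmem (S : State) (d : ℕ) (x : ℝ) :
    (S.setReal d x).rmem = Function.update S.rmem (S.reg d) x := rfl

@[simp] theorem setReal_out (S : State) (d : ℕ) (x : ℝ) : (S.setReal d x).out = S.out := rfl

@[simp] theorem setMem_reg (S : State) (a v : ℕ) : (S.setMem a v).reg = S.reg := rfl

@[simp] theorem setMem_rmem (S : State) (a v : ℕ) : (S.setMem a v).rmem = S.rmem := rfl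

@[simp] theorem setMem_out (S : State) (a v : ℕ) : (S.setMem a v).out = S.out := rfl

@[simp] theorem setMem_mem (S : State) (a v : ℕ) :
    (S.setMem a v).mem = Function.update S.mem a v := rfl

@[simp] theorem print_reg (S : State) (v : ℕ) : (S.print v).reg = S.reg := rfl

@[simp] theorem print_mem (S : State) (v : ℕ) : (S.print v).mem = S.mem := rfl

@[simp] theorem print_rmem (S : State) (v : ℕ) : (S.print v).rmem = S.rmem := rfl

@[simp] theorem print_out (S : State) (v : ℕ) : (S.print v).out = S.out ++ [v] := rfl

@[simp] theorem run_const (S : State) (d c : ℕ) :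
    (Instr.const d c).run S = S.setReg d c := rfl

@[simp] theorem run_copy (S : State) (d a : ℕ) :
    (Instr.copy d a).run S = S.setReg d (S.reg a) := rfl

@[simp] theorem run_add (S : State) (d a b : ℕ) :
    (Instr.add d a b).run S = S.setReg d (S.reg a + S.reg b) := rfl

@[simp] theorem run_sub (S : State) (d a b : ℕ) :
    (Instr.sub d a b).run S = S.setReg d (S.reg a - S.reg b) := rfl

@[simp] theorem run_load (S : State) (d a : ℕ) :
    (Instr.load d a).run S = S.setReg d (S.mem (S.reg a)) := rfl

@[simp] theorem run_store (S : State) (d a : ℕ) :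
    (Instr.store d a).run S = S.setMem (S.reg d) (S.reg a) := rfl

@[simp] theorem run_rcopy (S : State) (d a : ℕ) :
    (Instr.rcopy d a).run S = S.setReal d (S.real a) := rfl

@[simp] theorem run_radd (S : State) (d a b : ℕ) :
    (Instr.radd d a b).run S = S.setReal d (S.real a + S.real b) := rfl

@[simp] theorem run_rsub (S : State) (d a b : ℕ) :
    (Instr.rsub d a b).run S = S.setReal d (S.real a - S.real b) := rfl

@[simp] theorem run_rmul (S : State) (d a b : ℕ) :
    (Instr.rmul d a b).run S = S.setReal d (S.real a * S.real b) := rfl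

@[simp] theorem run_rdiv (S : State) (d a b : ℕ) :
    (Instr.rdiv d a b).run S = S.setReal d (S.real a / S.real b) := rfl

@[simp] theorem run_emit (S : State) (a : ℕ) :
    (Instr.emit a).run S = S.print (S.reg a) := rfl

@[simp] theorem run_rconst (S : State) (d : ℕ) (c : ℤ) :
    (Instr.rconst d c).run S = S.setReal d (c : ℝ) := rfl

attribute [simp] State.real Test.Holds

/-! ### Adding a multiple of a row to another row -/

/-- Adds to the row at `reg 50` the multiple of the row at `reg 51` by the real at `reg 7`. -/
def axpy : Prog :=
  .instr (.const 60 0) ;; .instr (.copy 61 50) ;; .instr (.copy 62 51) ;;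
  .while (.lt 60 1)
    (.instr (.rmul 8 7 62) ;; .instr (.radd 61 61 8) ;; .instr (.add 60 60 5) ;;
      .instr (.add 61 61 5) ;; .instr (.add 62 62 5))

/-- Addresses are indirect, so aliasing has to be excluded: the rows are disjoint, the factor and
the scratch cell lie outside the target row, and the scratch cell lies outside the source row.
Registers from 60 on are scratch here, from 50 on in `pass`, and from 40 on in its callers; `Same`
records that the lower ones survive. -/
theorem axpy_spec {S : State} {m D E : ℕ} (h1 : S.reg 1 = m) (h5 : S.reg 5 = 1)
    (hD : S.reg 50 = D) (hE : S.reg 51 = E) (h78 : S.reg 7 ≠ S.reg 8)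
    (hDE : D + m ≤ E ∨ E + m ≤ D)
    (h7 : ∀ a < m, S.reg 7 ≠ D + a) (h8 : ∀ a < m, S.reg 8 ≠ D + a)
    (h8' : ∀ a < m, S.reg 8 ≠ E + a) :
    Trip axpy S (m * 6 + 4) fun T => Same 60 S.reg T ∧ T.mem = S.mem ∧ T.out = S.out ∧
      (∀ a < m, T.rmem (D + a) = S.rmem (D + a) + S.rmem (S.reg 7) * S.rmem (E + a)) ∧
      ∀ a, a ≠ S.reg 8 → (a < D ∨ D + m ≤ a) → T.rmem a = S.rmem a := by
  unfold axpy
  refine Trip.le (Trip.step <| Trip.step <| Trip.step <| Trip.imp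
    (Trip.while (fun t T => Same 60 S.reg T ∧ T.mem = S.mem ∧ T.out = S.out ∧ T.reg 60 = t ∧
      T.reg 61 = D + t ∧ T.reg 62 = E + t ∧
      (∀ a < t, T.rmem (D + a) = S.rmem (D + a) + S.rmem (S.reg 7) * S.rmem (E + a)) ∧
      ∀ a, a ≠ S.reg 8 → (a < D ∨ D + t ≤ a) → T.rmem a = S.rmem a) m (b := 5) ?_ ?_ ?_ ?_) ?_) ?_
  · simp [hD, hE]
  · rintro t ht T ⟨hs, -, -, h60, -⟩
    simp [hs.eq, h60, h1, ht]
  · rintro t ht T ⟨hs, hm, ho, h60, h61, h62, hlt, hge⟩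
    have h7m : T.rmem (S.reg 7) = S.rmem (S.reg 7) := by
      apply hge _ h78
      by_contra! hcon
      exact h7 (S.reg 7 - D) (by omega) (by omega)
    have hEm : T.rmem (E + t) = S.rmem (E + t) := by
      apply hge _ (h8' t ht).symm; omega
    have hDm : T.rmem (D + t) = S.rmem (D + t) := by
      apply hge _ (h8 t ht).symm; omega
    refine Trip.step <| Trip.step <| Trip.step <| Trip.step <| Trip.instr ?_
    simp [hs, hs.eq, hm, ho, h60, h61, h62, h5, h7m, hEm]
    refine ⟨by omega, by omega, fun a ha => ?_, fun a ha ha' => ?_⟩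
    · rcases Nat.lt_or_eq_of_le ha with ha | rfl
      · rw [Function.update_of_ne (by omega), Function.update_of_ne (h8 a (by omega)).symm, hlt a ha]
      · rw [Function.update_self, Function.update_of_ne (h8 a ht).symm, hDm]
    · rw [Function.update_of_ne (by omega), Function.update_of_ne ha]
      exact hge a ha (by omega)
  · rintro T ⟨hs, -, -, h60, -⟩
    simp [hs.eq, h60, h1]
  · rintro T ⟨hs, hm, ho, -, -, -, h⟩
    exact ⟨hs, hm, ho, h⟩
  · omega

end RealRAM

namespace HyperplanePartitions

/-! ### The elimination pass -/

/-- The row operations for the row `i`: afterwards it vanishes in column `c`. If the row `j`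
vanishes in column `c`, then the row `i` is added to it first. -/
noncomputable def elimStep (A : ℕ → ℕ → ℝ) (j i c : ℕ) : ℕ → ℕ → ℝ :=
  let A' := Function.update A j (A j + (if A j c = 0 then 1 else 0 : ℝ) • A i)
  -- If `A' j c = 0`, then `A i c = 0` already, and the quotient by zero is `0`. So no case
  -- distinction and no exchange of rows is needed.
  Function.update A' i (A' i + (0 - A' i c / A' j c) • A' j)

/-- The row operations for the rows `j + 1, …, j + t`. -/
noncomputable def elimPass (A : ℕ → ℕ → ℝ) (j c : ℕ) : ℕ → ℕ → ℕ → ℝ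
  | 0 => A
  | t + 1 => elimStep (elimPass A j c t) j (j + 1 + t) c

end HyperplanePartitions

namespace RealRAM

open HyperplanePartitions

/-- From the address `base` on, the memory `f` holds the first `R` rows of `A`, of length `m`. -/
def MatAt (f : ℕ → ℝ) (base R m : ℕ) (A : ℕ → ℕ → ℝ) : Prop :=
  ∀ i < R, ∀ c < m, f (base + i * m + c) = A i c

theorem row_le {i R m : ℕ} (h : i < R) : i * m + m ≤ R * m := by
  rw [← Nat.succ_mul]; exact Nat.mul_le_mul_right m h

theorem row_disjoint {i j m : ℕ} (h : i ≠ j) : i * m + m ≤ j * m ∨ j * m + m ≤ i * m :=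
  (lt_or_gt_of_ne h).imp row_le row_le

/-- `axpy` adds `q` times the row `j` to the row `i`. -/
theorem axpy_row {S : State} {m base R i j : ℕ} {A : ℕ → ℕ → ℝ} {q : ℝ} (h1 : S.reg 1 = m)
    (h5 : S.reg 5 = 1) (hA : MatAt S.rmem base R m A) (hi : i < R) (hj : j < R) (hij : i ≠ j)
    (hD : S.reg 50 = base + i * m) (hE : S.reg 51 = base + j * m) (h78 : S.reg 7 ≠ S.reg 8)
    (h7 : S.reg 7 < base ∨ base + R * m ≤ S.reg 7) (h8 : S.reg 8 < base ∨ base + R * m ≤ S.reg 8)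
    (hq : S.rmem (S.reg 7) = q) :
    Trip axpy S (m * 6 + 4) fun T => Same 60 S.reg T ∧ T.mem = S.mem ∧ T.out = S.out ∧
      MatAt T.rmem base R m (Function.update A i (A i + q • A j)) ∧
      ∀ a, a ≠ S.reg 8 → (a < base ∨ base + R * m ≤ a) → T.rmem a = S.rmem a := by
  have hi' := row_le (m := m) hi
  have hj' := row_le (m := m) hj
  have hij' := row_disjoint (m := m) hij
  refine (axpy_spec h1 h5 hD hE h78 (by omega) (by omega) (by omega) (by omega)).imp ?_
  rintro T ⟨hs, hm, ho, hrow, hfr⟩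
  refine ⟨hs, hm, ho, fun t ht c hc => ?_, fun a ha ha' => hfr a ha (by omega)⟩
  have ht' := row_le (m := m) ht
  rcases eq_or_ne t i with rfl | hti
  · rw [hrow c hc, hq, hA t ht c hc, hA j hj c hc, Function.update_self]
    simp
  · have := row_disjoint (m := m) hti
    rw [Function.update_of_ne hti, ← hA t ht c hc]
    exact hfr _ (by omega) (by omega)

/-- The elimination pass for the row `reg 42`, whose address is `reg 43`, and the column `reg 44`
of the matrix with `reg 41` rows at `reg 40`. -/
def pass : Prog :=
  .instr (.add 52 42 5) ;; .instr (.add 53 43 1) ;;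
  .while (.lt 52 41)
    (.instr (.add 54 43 44) ;; .instr (.add 55 53 44) ;; .instr (.rconst 7 0) ;;
      .ite (.rlt 6 54) .skip (.ite (.rlt 54 6) .skip (.instr (.rconst 7 1))) ;;
      .instr (.copy 50 43) ;; .instr (.copy 51 53) ;; axpy ;;
      .instr (.rdiv 7 55 54) ;; .instr (.rsub 7 6 7) ;;
      .instr (.copy 50 53) ;; .instr (.copy 51 43) ;; axpy ;;
      .instr (.add 52 52 5) ;; .instr (.add 53 53 1))

/-- The memory is tracked as the abstract matrix `elimPass`. Since `<` is the only comparison of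
reals, a vanishing pivot entry is recognized by two failing comparisons with the stored zero;
exactly then the factor cell receives `1`. -/
theorem pass_spec {S : State} {m base R j c : ℕ} {A : ℕ → ℕ → ℝ} (h1 : S.reg 1 = m)
    (h5 : S.reg 5 = 1) (hA : MatAt S.rmem base R m A) (hj : j < R) (hc : c < m)
    (h41 : S.reg 41 = R) (h42 : S.reg 42 = j)
    (h43 : S.reg 43 = base + j * m) (h44 : S.reg 44 = c) (h78 : S.reg 7 ≠ S.reg 8)
    (h67 : S.reg 6 ≠ S.reg 7) (h68 : S.reg 6 ≠ S.reg 8)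
    (h6 : S.reg 6 < base ∨ base + R * m ≤ S.reg 6) (h7 : S.reg 7 < base ∨ base + R * m ≤ S.reg 7)
    (h8 : S.reg 8 < base ∨ base + R * m ≤ S.reg 8) (h0 : S.rmem (S.reg 6) = 0) :
    Trip pass S ((R - (j + 1)) * (m * 12 + 25) + 3) fun T =>
      Same 50 S.reg T ∧ T.mem = S.mem ∧ T.out = S.out ∧
      MatAt T.rmem base R m (elimPass A j c (R - (j + 1))) ∧
      ∀ a, a ≠ S.reg 7 → a ≠ S.reg 8 → (a < base ∨ base + R * m ≤ a) → T.rmem a = S.rmem a := by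
  have hjR := row_le (m := m) hj
  unfold pass
  refine Trip.le (Trip.step <| Trip.step <| Trip.imp
    (Trip.while (fun t T => Same 50 S.reg T ∧ T.mem = S.mem ∧ T.out = S.out ∧
      T.reg 52 = j + 1 + t ∧ T.reg 53 = base + (j + 1 + t) * m ∧
      MatAt T.rmem base R m (elimPass A j c t) ∧
      ∀ a, a ≠ S.reg 7 → a ≠ S.reg 8 → (a < base ∨ base + R * m ≤ a) → T.rmem a = S.rmem a)
      (R - (j + 1)) (b := m * 12 + 24) ?_ ?_ ?_ ?_) ?_) ?_
  · simp [h42, h43, h5, h1, elimPass, hA]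
    ring
  · rintro t ht T ⟨hs, -, -, h52, -⟩
    simp [hs.eq, h52, h41]
    omega
  · rintro t ht T ⟨hs, hm, ho, h52, h53, hA', hfr⟩
    set i := j + 1 + t with hi
    have hiR : i < R := by omega
    have hiR' := row_le (m := m) hiR
    set B := elimPass A j c t with hB
    have hcj := hA' j hj c hc
    have hci := hA' i hiR c hc
    refine Trip.le (Trip.step <| Trip.step <| Trip.step <| Trip.bind (b := 3) (c := m * 12 + 18) (Q := fun U =>
      Same 50 S.reg U ∧ U.mem = S.mem ∧ U.out = S.out ∧ U.reg 52 = i ∧ U.reg 53 = base + i * m ∧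
      U.reg 54 = base + j * m + c ∧ U.reg 55 = base + i * m + c ∧
      MatAt U.rmem base R m B ∧ U.rmem (S.reg 7) = (if B j c = 0 then 1 else 0) ∧
      ∀ a, a ≠ S.reg 7 → a ≠ S.reg 8 → (a < base ∨ base + R * m ≤ a) → U.rmem a = S.rmem a)
      ?_ ?_) ?_
    · have hA'' : MatAt (Function.update T.rmem (S.reg 7) 0) base R m B := by
        intro i' hi' c' hc'
        have := row_le (m := m) hi'
        rw [Function.update_of_ne (by omega), hA' i' hi' c' hc']
      have hcj' := hA'' j hj c hc
      have h0' : Function.update T.rmem (S.reg 7) 0 (S.reg 6) = 0 := by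
        rw [Function.update_of_ne h67, hfr _ h67 h68 h6, h0]
      have hfr' : ∀ a, a ≠ S.reg 7 → a ≠ S.reg 8 → (a < base ∨ base + R * m ≤ a) →
          Function.update T.rmem (S.reg 7) 0 a = S.rmem a := fun a h h' h'' => by
        rw [Function.update_of_ne h, hfr a h h' h'']
      refine Trip.ite (fun h => ?_) fun h => Trip.ite (fun h' => ?_) fun h' => ?_
      · simp [hs.eq, h43, h44, h0', hcj'] at h
        refine Trip.le (Trip.skip ?_) (c := 2) (by omega)
        simp [hs, hm, ho, hs.eq, h52, h53, h43, h44, hA'', h.ne']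
        exact hfr'
      · simp [hs.eq, h43, h44, h0', hcj'] at h'
        refine Trip.skip ?_
        simp [hs, hm, ho, hs.eq, h52, h53, h43, h44, hA'', h'.ne]
        exact hfr'
      · simp [hs.eq, h43, h44, h0', hcj'] at h h'
        refine Trip.instr ?_
        simp [hs, hm, ho, hs.eq, h52, h53, h43, h44, le_antisymm h h']
        refine ⟨fun i' hi' c' hc' => ?_, fun a h h' h'' => ?_⟩
        · have := row_le (m := m) hi'
          rw [Function.update_of_ne (by omega), hA' i' hi' c' hc']
        · rw [Function.update_of_ne h, hfr a h h' h'']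
    · rintro U ⟨us, um, uo, u52, u53, u54, u55, uA, uq, ufr⟩
      refine Trip.le (Trip.step <| Trip.step <| Trip.bind (c := m * 6 + 10)
        (axpy_row (q := if B j c = 0 then 1 else 0) (A := B) (i := j) (j := i) (base := base)
          (R := R) (m := m) ?_ ?_ ?_ hj hiR (by omega) ?_ ?_ ?_ ?_ ?_ ?_) ?_) (by omega)
      · simp [us.eq, h1]
      · simp [us.eq, h5]
      · simpa using uA
      · simp [us.eq, h43]
      · simp [u53]
      · simpa [us.eq] using h78
      · simpa [us.eq] using h7
      · simpa [us.eq] using h8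
      · simpa [us.eq] using uq
      rintro W ⟨ws, wm, wo, wA, wfr⟩
      simp [us.eq] at wfr
      set B' := Function.update B j (B j + (if B j c = 0 then 1 else 0 : ℝ) • B i) with hB'
      have ws' : Same 50 S.reg W := ws.trans (by simpa using us) (by omega)
      have w52 : W.reg 52 = i := by rw [ws.eq _ (by omega)]; simp [u52]
      have w53 : W.reg 53 = base + i * m := by rw [ws.eq _ (by omega)]; simp [u53]
      have w54 : W.reg 54 = base + j * m + c := by rw [ws.eq _ (by omega)]; simp [u54]
      have w55 : W.reg 55 = base + i * m + c := by rw [ws.eq _ (by omega)]; simp [u55]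
      have wcj := wA j hj c hc
      have wci := wA i hiR c hc
      have w0 : W.rmem (S.reg 6) = 0 := by
        rw [wfr _ h68 h6, ufr _ h67 h68 h6, h0]
      refine Trip.le (Trip.step <| Trip.step <| Trip.step <| Trip.step <| Trip.bind (c := 2)
        (axpy_row (q := 0 - B' i c / B' j c) (A := B') (i := i) (j := j) (base := base)
          (R := R) (m := m) ?_ ?_ ?_ hiR hj (by omega) ?_ ?_ ?_ ?_ ?_ ?_) ?_) (by omega)
      · simp [ws'.eq, h1]
      · simp [ws'.eq, h5]
      · intro i' hi' c' hc'
        have := row_le (m := m) hi'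
        simp only [Instr.run, setReg_rmem, setReal_rmem, setReal_reg, ws'.eq 7 (by norm_num)]
        rw [Function.update_of_ne (by omega), Function.update_of_ne (by omega), wA i' hi' c' hc']
      · simp [w53]
      · simp [ws'.eq, h43]
      · simpa [ws'.eq] using h78
      · simpa [ws'.eq] using h7
      · simpa [ws'.eq] using h8
      · simp [ws'.eq, w54, w55, Function.update_of_ne h67, w0, wcj, wci]
      rintro X ⟨xs, xm, xo, xA, xfr⟩
      simp [ws'.eq] at xfr
      have xs' : Same 50 S.reg X := xs.trans (by simpa using ws') (by omega)
      have x52 : X.reg 52 = i := by rw [xs.eq _ (by omega)]; simp [w52]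
      have x53 : X.reg 53 = base + i * m := by rw [xs.eq _ (by omega)]; simp [w53]
      refine Trip.step <| Trip.instr ?_
      simp [xs', xs'.eq, xm, xo, wm, wo, um, uo, x52, x53, h5, h1]
      refine ⟨by omega, by rw [hi]; ring, xA, fun a h h' h'' => ?_⟩
      rw [xfr a h' h'', Function.update_of_ne h, wfr a h' h'', ufr a h h' h'']
    · omega
  · rintro T ⟨hs, -, -, h52, -⟩
    simp [hs.eq, h52, h41]
    omega
  · rintro T ⟨hs, hm, ho, -, -, h⟩
    exact ⟨hs, hm, ho, h⟩
  · rfl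

end RealRAM

namespace HyperplanePartitions

open Submodule

/-! ### Spans of rows under elimination -/

/-- Adding a multiple of another row is undone by subtracting it, so one inclusion, applied twice,
suffices. -/
theorem span_update_add_smul {A : ℕ → ℕ → ℝ} {s : Set ℕ} {i j : ℕ} (hi : i ∈ s) (hj : j ∈ s)
    (hij : i ≠ j) (q : ℝ) :
    span ℝ (Function.update A i (A i + q • A j) '' s) = span ℝ (A '' s) := by
  have hle : ∀ (B : ℕ → ℕ → ℝ) (q : ℝ),
      span ℝ (Function.update B i (B i + q • B j) '' s) ≤ span ℝ (B '' s) := by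
    intro B q
    rw [span_le]
    rintro _ ⟨t, ht, rfl⟩
    rcases eq_or_ne t i with rfl | hti
    · rw [Function.update_self]
      exact add_mem (subset_span ⟨t, hi, rfl⟩) (smul_mem _ _ (subset_span ⟨j, hj, rfl⟩))
    · rw [Function.update_of_ne hti]
      exact subset_span ⟨t, ht, rfl⟩
  refine le_antisymm (hle A q) ?_
  convert hle (Function.update A i (A i + q • A j)) (-q) using 3
  rw [Function.update_self, Function.update_of_ne hij.symm, Function.update_idem]
  simp

theorem elimStep_span {A : ℕ → ℕ → ℝ} {s : Set ℕ} {i j c : ℕ} (hi : i ∈ s) (hj : j ∈ s)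
    (hij : i ≠ j) : span ℝ (elimStep A j i c '' s) = span ℝ (A '' s) := by
  rw [elimStep, span_update_add_smul hi hj hij, span_update_add_smul hj hi hij.symm]

theorem elimStep_of_ne {A : ℕ → ℕ → ℝ} {i j c t : ℕ} (hi : t ≠ i) (hj : t ≠ j) :
    elimStep A j i c t = A t := by
  simp [elimStep, hi, hj]

theorem elimStep_self {A : ℕ → ℕ → ℝ} {i j c : ℕ} (hij : i ≠ j) : elimStep A j i c i c = 0 := by
  by_cases h : A j c = 0
  · by_cases h' : A i c = 0 <;> simp [elimStep, hij, h, h']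
  · simp [elimStep, hij, h]

theorem elimPass_of_lt {A : ℕ → ℕ → ℝ} {j c t i : ℕ} (h : i < j ∨ j + 1 + t ≤ i) :
    elimPass A j c t i = A i := by
  induction t with
  | zero => rfl
  | succ t ih => rw [elimPass, elimStep_of_ne (by omega) (by omega), ih (by omega)]

theorem elimPass_span {A : ℕ → ℕ → ℝ} {j c t R : ℕ} (h : j + 1 + t ≤ R) :
    span ℝ (elimPass A j c t '' Set.Ico j R) = span ℝ (A '' Set.Ico j R) := by
  induction t with
  | zero => rfl
  | succ t ih =>
    rw [elimPass, elimStep_span (by simp; omega) (by simp; omega) (by omega), ih (by omega)]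

/-- A cleared row stays cleared: later steps change only the row `j` and the row they clear. -/
theorem elimPass_apply {A : ℕ → ℕ → ℝ} {j c t i : ℕ} (hj : j < i) (hi : i < j + 1 + t) :
    elimPass A j c t i c = 0 := by
  induction t with
  | zero => omega
  | succ t ih =>
    rw [elimPass]
    rcases eq_or_ne i (j + 1 + t) with rfl | hne
    · exact elimStep_self (by omega)
    · rw [elimStep_of_ne hne (by omega), ih (by omega)]

theorem span_image_union_eq {A A' : ℕ → ℕ → ℝ} {s t : Set ℕ} (hs : ∀ i ∈ s, A' i = A i)
    (ht : span ℝ (A' '' t) = span ℝ (A '' t)) :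
    span ℝ (A' '' (s ∪ t)) = span ℝ (A '' (s ∪ t)) := by
  rw [Set.image_union, Set.image_union, span_union, span_union, ht, Set.image_congr hs]

theorem apply_eq_zero_of_mem_span {s : Set (ℕ → ℝ)} {c : ℕ} (h : ∀ v ∈ s, v c = 0) {v : ℕ → ℝ}
    (hv : v ∈ span ℝ s) : v c = 0 := by
  have : span ℝ s ≤ LinearMap.ker (LinearMap.proj (R := ℝ) (φ := fun _ : ℕ => ℝ) c) :=
    span_le.2 fun v hv => h v hv
  exact this hv

/-- `A` arises from `A₀` by row operations, and the first `r` rows of `A` complement the span of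
the remaining ones. -/
def Reduced (A₀ A : ℕ → ℕ → ℝ) (n r : ℕ) : Prop :=
  r ≤ n ∧ span ℝ (A '' Set.Iio n) = span ℝ (A₀ '' Set.Iio n) ∧
    Module.finrank ℝ (span ℝ (A '' Set.Ico r n)) + r = Module.finrank ℝ (span ℝ (A₀ '' Set.Iio n))

theorem Reduced.refl (A : ℕ → ℕ → ℝ) (n : ℕ) : Reduced A A n 0 := by
  refine ⟨n.zero_le, rfl, ?_⟩
  rw [add_zero, show Set.Ico 0 n = Set.Iio n by ext; simp]

/-- The row `r` is not in the span of the rows after it, because these vanish in the column `c` and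
it does not. -/
theorem finrank_span_Ico {A : ℕ → ℕ → ℝ} {r n c : ℕ} (hr : r < n) (h0 : A r c ≠ 0)
    (h : ∀ i, r < i → i < n → A i c = 0) :
    Module.finrank ℝ (span ℝ (A '' Set.Ico r n)) =
      Module.finrank ℝ (span ℝ (A '' Set.Ico (r + 1) n)) + 1 := by
  have hins : A '' Set.Ico r n = insert (A r) (A '' Set.Ico (r + 1) n) := by
    rw [← Set.image_insert_eq]
    congr 1
    ext i
    simp
    omega
  have hfin : FiniteDimensional ℝ (span ℝ (A '' Set.Ico (r + 1) n)) :=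
    FiniteDimensional.span_of_finite ℝ ((Set.finite_Ico _ _).image _)
  have hnot : A r ∉ span ℝ (A '' Set.Ico (r + 1) n) := fun hmem =>
    h0 (apply_eq_zero_of_mem_span (by
      rintro _ ⟨i, hi, rfl⟩
      exact h i hi.1 hi.2) hmem)
  have h0' : A r ≠ 0 := fun h => h0 (by rw [h]; rfl)
  have hinf : span ℝ {A r} ⊓ span ℝ (A '' Set.Ico (r + 1) n) = ⊥ := by
    rw [inf_comm]
    exact ((disjoint_span_singleton' h0').2 hnot).eq_bot
  have hdim := finrank_sup_add_finrank_inf_eq (span ℝ {A r}) (span ℝ (A '' Set.Ico (r + 1) n))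
  rw [hinf, finrank_bot, finrank_span_singleton h0'] at hdim
  rw [hins, span_insert]
  omega

/-- The pass preserves the span of the rows from `r` on and clears the column `c` below the row `r`.
If the row `r` vanished there too, the whole span would, contrary to `A i c ≠ 0`. So the pass
produces its own pivot. -/
theorem Reduced.step {A₀ A : ℕ → ℕ → ℝ} {n r c i : ℕ} (h : Reduced A₀ A n r) (hr : r ≤ i)
    (hi : i < n) (hA : A i c ≠ 0) : Reduced A₀ (elimPass A r c (n - (r + 1))) n (r + 1) := by
  obtain ⟨-, hspan, hrank⟩ := h
  set A' := elimPass A r c (n - (r + 1)) with hA'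
  have hs : span ℝ (A' '' Set.Ico r n) = span ℝ (A '' Set.Ico r n) := elimPass_span (by omega)
  have hv : ∀ i, r < i → i < n → A' i c = 0 := fun i h h' => elimPass_apply h (by omega)
  have h0 : A' r c ≠ 0 := fun h0 => by
    refine hA (apply_eq_zero_of_mem_span (s := A' '' Set.Ico r n) ?_ ?_)
    · rintro _ ⟨t, ht, rfl⟩
      rcases eq_or_lt_of_le ht.1 with rfl | hlt
      exacts [h0, hv t hlt ht.2]
    · rw [hs]
      exact subset_span ⟨i, ⟨hr, hi⟩, rfl⟩
  have hU : Set.Iio n = Set.Iio r ∪ Set.Ico r n := by ext; simp; omega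
  refine ⟨by omega, ?_, ?_⟩
  · rw [← hspan, hU]
    exact span_image_union_eq (fun i hi => elimPass_of_lt (.inl hi)) hs
  · have := finrank_span_Ico (by omega) h0 hv
    rw [hs] at this
    omega

theorem Reduced.rank_le {A₀ A : ℕ → ℕ → ℝ} {n r : ℕ} (h : Reduced A₀ A n r) :
    r ≤ Module.finrank ℝ (span ℝ (A₀ '' Set.Iio n)) := by
  have := h.2.2; omega

theorem Reduced.finish {A₀ A : ℕ → ℕ → ℝ} {n r m : ℕ} (h : Reduced A₀ A n r)
    (h₀ : ∀ i, ∀ c, m ≤ c → A₀ i c = 0) (h0 : ∀ i, r ≤ i → i < n → ∀ c < m, A i c = 0) :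
    r = Module.finrank ℝ (span ℝ (A₀ '' Set.Iio n)) ∧
      span ℝ (A '' Set.Iio r) = span ℝ (A₀ '' Set.Iio n) := by
  obtain ⟨hrn, hspan, hrank⟩ := h
  have hbot : span ℝ (A '' Set.Ico r n) = ⊥ := by
    rw [span_eq_bot]
    rintro _ ⟨i, hi, rfl⟩
    ext c
    -- Rows are infinite sequences. Beyond the column `m` they vanish because they are combinations
    -- of rows of `A₀`.
    by_cases hc : c < m
    · exact h0 i hi.1 hi.2 c hc
    · refine apply_eq_zero_of_mem_span (s := A₀ '' Set.Iio n) ?_ ?_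
      · rintro _ ⟨t, -, rfl⟩
        exact h₀ t c (by omega)
      · rw [← hspan]
        exact subset_span ⟨i, hi.2, rfl⟩
  have hU : Set.Iio n = Set.Iio r ∪ Set.Ico r n := by ext; simp; omega
  refine ⟨?_, ?_⟩
  · rw [hbot] at hrank
    simpa using hrank
  · rw [← hspan, hU, Set.image_union, span_union, hbot, sup_bot_eq]

end HyperplanePartitions

namespace RealRAM

open HyperplanePartitions

/-! ### Removing linear dependencies -/

/-- Looks for a column `reg 16` that does not vanish in all rows from the row `reg 11` (at the
address `reg 15`) on; `reg 16` is the number of columns if there is none. -/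
def scan : Prog :=
  .instr (.copy 16 1) ;; .instr (.copy 40 11) ;; .instr (.copy 41 15) ;;
  .while (.lt 40 0)
    (.instr (.const 42 0) ;;
      .while (.lt 42 1)
        (.ite (.rlt 41 6) (.instr (.copy 16 42))
            (.ite (.rlt 6 41) (.instr (.copy 16 42)) .skip) ;;
          .instr (.add 42 42 5) ;; .instr (.add 41 41 5)) ;;
      .instr (.add 40 40 5))

/-- There is no early exit: every nonzero entry overwrites the column found before, and any such
column will do. -/
theorem scan_spec {S : State} {n m r : ℕ} {A : ℕ → ℕ → ℝ} (h0 : S.reg 0 = n) (h1 : S.reg 1 = m)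
    (h5 : S.reg 5 = 1) (h11 : S.reg 11 = r) (h15 : S.reg 15 = r * m) (hr : r ≤ n)
    (hA : MatAt S.rmem 0 n m A) (hz : S.rmem (S.reg 6) = 0) :
    Trip scan S (n * (m * 6 + 5) + 4) fun T =>
      Same 16 S.reg T ∧ T.mem = S.mem ∧ T.out = S.out ∧ T.rmem = S.rmem ∧
      ((T.reg 16 < m ∧ ∃ i, r ≤ i ∧ i < n ∧ A i (T.reg 16) ≠ 0) ∨
        (T.reg 16 = m ∧ ∀ i, r ≤ i → i < n → ∀ c < m, A i c = 0)) := by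
  unfold scan
  refine Trip.le (Trip.step <| Trip.step <| Trip.step <| Trip.imp
    (Trip.while (fun t T => Same 16 S.reg T ∧ T.mem = S.mem ∧ T.out = S.out ∧ T.rmem = S.rmem ∧
      T.reg 40 = r + t ∧ T.reg 41 = (r + t) * m ∧
      ((T.reg 16 < m ∧ ∃ i, r ≤ i ∧ i < n ∧ A i (T.reg 16) ≠ 0) ∨
        (T.reg 16 = m ∧ ∀ i, r ≤ i → i < r + t → ∀ c < m, A i c = 0)))
      (n - r) (b := m * 6 + 4) ?_ ?_ ?_ ?_) ?_) (c := n * (m * 6 + 5) + 4) ?_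
  · simp [h11, h15, h1]
    intros; omega
  · rintro t ht T ⟨hs, -, -, -, h40, -⟩
    simp [hs.eq, h40, h0]
    omega
  · rintro t ht T ⟨hs, hm, ho, hrm, h40, h41, hf⟩
    have hi : r + t < n := by omega
    refine Trip.le (Trip.step <| Trip.bind
      (Trip.while (fun c T => Same 16 S.reg T ∧ T.mem = S.mem ∧ T.out = S.out ∧
        T.rmem = S.rmem ∧ T.reg 40 = r + t ∧ T.reg 41 = (r + t) * m + c ∧ T.reg 42 = c ∧
        ((T.reg 16 < m ∧ ∃ i, r ≤ i ∧ i < n ∧ A i (T.reg 16) ≠ 0) ∨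
          (T.reg 16 = m ∧ (∀ i, r ≤ i → i < r + t → ∀ c < m, A i c = 0) ∧
            ∀ c' < c, A (r + t) c' = 0)))
        m (b := 5) ?_ ?_ ?_ ?_) (c := 1) ?_) (by omega)
    · simpa [hs, hm, ho, hrm, h40, h41] using hf
    · rintro c hc T ⟨hs, -, -, -, -, -, h42, -⟩
      simp [hs.eq, h42, h1, hc]
    · rintro c hc T ⟨hs, hm, ho, hrm, h40, h41, h42, hf⟩
      have hAc : S.rmem ((r + t) * m + c) = A (r + t) c := by
        simpa using hA _ hi c hc
      refine Trip.bind (b := 3) (c := 2) (Q := fun T => Same 16 S.reg T ∧ T.mem = S.mem ∧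
        T.out = S.out ∧ T.rmem = S.rmem ∧ T.reg 40 = r + t ∧ T.reg 41 = (r + t) * m + c ∧
        T.reg 42 = c ∧
        ((T.reg 16 < m ∧ ∃ i, r ≤ i ∧ i < n ∧ A i (T.reg 16) ≠ 0) ∨
          (T.reg 16 = m ∧ (∀ i, r ≤ i → i < r + t → ∀ c < m, A i c = 0) ∧
            ∀ c' < c + 1, A (r + t) c' = 0))) ?_ ?_
      · refine Trip.ite (b := 2) (fun h => ?_) fun h => Trip.ite (fun h' => ?_) fun h' => ?_
        · simp [hs.eq, hrm, hz, h41, hAc] at h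
          refine Trip.le (Trip.instr ?_) (c := 2) (by omega)
          simp [hs, hm, ho, hrm, h40, h41, h42]
          exact .inl ⟨hc, r + t, by omega, hi, h.ne⟩
        · simp [hs.eq, hrm, hz, h41, hAc] at h'
          refine Trip.instr ?_
          simp [hs, hm, ho, hrm, h40, h41, h42]
          exact .inl ⟨hc, r + t, by omega, hi, h'.ne'⟩
        · simp [hs.eq, hrm, hz, h41, hAc] at h h'
          refine Trip.skip ?_
          refine ⟨hs, hm, ho, hrm, h40, h41, h42, hf.imp id ?_⟩
          rintro ⟨h16, hp, hp'⟩
          refine ⟨h16, hp, fun c' hc' => ?_⟩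
          rcases Nat.lt_succ_iff_lt_or_eq.1 hc' with hc' | rfl
          exacts [hp' c' hc', le_antisymm h' h]
      · rintro T ⟨hs, hm, ho, hrm, h40, h41, h42, hf⟩
        refine Trip.step <| Trip.instr ?_
        simp only [Instr.run]
        simp [hs, hs.eq, hm, ho, hrm, h40, h41, h42, h5, add_assoc]
        simpa using hf
    · rintro T ⟨hs, -, -, -, -, -, h42, -⟩
      simp [hs.eq, h42, h1]
    · rintro T ⟨hs, hm, ho, hrm, h40, h41, h42, hf⟩
      refine Trip.instr ?_
      simp [hs, hs.eq, hm, ho, hrm, h40, h41, h5, add_assoc]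
      refine ⟨by ring, hf.imp id ?_⟩
      rintro ⟨h16, hp, hp'⟩
      refine ⟨h16, fun i hi hi' => ?_⟩
      rcases Nat.lt_or_eq_of_le (show i ≤ r + t by omega) with h | rfl
      exacts [hp i hi h, hp']
  · rintro T ⟨hs, -, -, -, h40, -⟩
    simp [hs.eq, h40, h0]
    omega
  · rintro T ⟨hs, hm, ho, hrm, -, -, hf⟩
    rw [Nat.add_sub_cancel' hr] at hf
    exact ⟨hs, hm, ho, hrm, hf⟩
  · have := Nat.mul_le_mul_right (m * 6 + 4 + 1) (Nat.sub_le n r)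
    rw [show m * 6 + 5 = m * 6 + 4 + 1 from rfl]
    omega

/-- Row operations that leave linearly independent rows, followed by rows that vanish. The number
of the former is put into `reg 11`. -/
def removeDependencies : Prog :=
  .instr (.const 11 0) ;; .instr (.const 15 0) ;; scan ;;
  .while (.lt 16 1)
    (.instr (.const 40 0) ;; .instr (.copy 41 0) ;; .instr (.copy 42 11) ;; .instr (.copy 43 15) ;;
      .instr (.copy 44 16) ;; pass ;; .instr (.add 11 11 5) ;; .instr (.add 15 15 1) ;; scan)

/-- `Reduced.rank_le` bounds the number of rounds by the rank instead of `n`. One pass and one scan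
per round, after a first scan, give the term `(n + 1) * (m + 1) * (s + 1)`. -/
theorem removeDependencies_spec {S : State} {n m : ℕ} {A₀ : ℕ → ℕ → ℝ} (h0 : S.reg 0 = n)
    (h1 : S.reg 1 = m) (h5 : S.reg 5 = 1) (h6 : S.reg 6 = n * m) (h7 : S.reg 7 = n * m + 1)
    (h8 : S.reg 8 = n * m + 2) (hA : MatAt S.rmem 0 n m A₀) (hz : S.rmem (n * m) = 0)
    (h₀ : ∀ i, ∀ c, m ≤ c → A₀ i c = 0) :
    Trip removeDependencies S
      (n * (m * 6 + 5) + 7 +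
        Module.finrank ℝ (Submodule.span ℝ (A₀ '' Set.Iio n)) * (n * (m * 18 + 30) + 15))
      fun T => (Same 11 S.reg T ∧ T.reg 12 = S.reg 12 ∧ T.reg 14 = S.reg 14) ∧ T.mem = S.mem ∧ T.out = S.out ∧ T.rmem (n * m) = 0 ∧
        ∃ A r, T.reg 11 = r ∧ T.reg 15 = r * m ∧ r ≤ n ∧ MatAt T.rmem 0 n m A ∧
          r = Module.finrank ℝ (Submodule.span ℝ (A₀ '' Set.Iio n)) ∧
          Submodule.span ℝ (A '' Set.Iio r) = Submodule.span ℝ (A₀ '' Set.Iio n) := by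
  unfold removeDependencies
  set s := Module.finrank ℝ (Submodule.span ℝ (A₀ '' Set.Iio n)) with hsdef
  let I : ℕ → State → Prop := fun r T => (Same 11 S.reg T ∧ T.reg 12 = S.reg 12 ∧ T.reg 14 = S.reg 14) ∧
    T.mem = S.mem ∧ T.out = S.out ∧ T.rmem (n * m) = 0 ∧ T.reg 11 = r ∧ T.reg 15 = r * m ∧ r ≤ n ∧ ∃ A, MatAt T.rmem 0 n m A ∧
      Reduced A₀ A n r ∧ ((T.reg 16 < m ∧ ∃ i, r ≤ i ∧ i < n ∧ A i (T.reg 16) ≠ 0) ∨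
        (T.reg 16 = m ∧ ∀ i, r ≤ i → i < n → ∀ c < m, A i c = 0))
  have hI : ∀ (r : ℕ) (A : ℕ → ℕ → ℝ) (U : State), Same 11 S.reg U →
      U.reg 12 = S.reg 12 → U.reg 14 = S.reg 14 → U.mem = S.mem →
      U.out = S.out → U.rmem (n * m) = 0 → U.reg 11 = r → U.reg 15 = r * m →
      MatAt U.rmem 0 n m A → Reduced A₀ A n r → Trip scan U (n * (m * 6 + 5) + 4) (I r) := by
    intro r A U us u12 u14 um uo uz u11 u15 uA uR
    refine (scan_spec (n := n) (m := m) (r := r) (A := A) (by rw [us.eq _ (by omega), h0])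
      (by rw [us.eq _ (by omega), h1]) (by rw [us.eq _ (by omega), h5]) u11 u15 uR.1 uA
      (by rw [us.eq _ (by omega), h6, uz])).imp ?_
    rintro T ⟨hs, hm, ho, hrm, hf⟩
    exact ⟨⟨hs.trans us (by omega), by rw [hs.eq _ (by omega), u12],
      by rw [hs.eq _ (by omega), u14]⟩, by rw [hm, um], by rw [ho, uo], by rw [hrm, uz],
      by rw [hs.eq _ (by omega), u11], by rw [hs.eq _ (by omega), u15], uR.1, A,
      by rwa [hrm], uR, hf⟩
  refine Trip.le (Trip.step <| Trip.step <| Trip.bind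
    (hI 0 A₀ _ (by simp) (by simp) (by simp) (by simp) (by simp) (by simpa using hz) (by simp) (by simp)
      (by simpa using hA) (Reduced.refl A₀ n))
    fun T hT => Trip.imp (Trip.while_le I s (b := n * (m * 18 + 30) + 14) hT ?_) ?_) ?_
  · rintro r T ⟨⟨hs, h12, h14⟩, hm, ho, hrz, h11, h15, -, A, hA', hR, hf⟩ hc
    simp only [Test.Holds, hs.eq 1 (by omega), h1] at hc
    obtain ⟨-, i, hri, hin, hAi⟩ := hf.resolve_right (by omega)
    have hR' := hR.step hri hin hAi
    have hr := hR'.rank_le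
    refine ⟨by omega, ?_⟩
    refine Trip.le (Trip.step <| Trip.step <| Trip.step <| Trip.step <| Trip.step <|
      Trip.bind (pass_spec (m := m) (base := 0) (R := n) (j := r) (c := T.reg 16) (A := A)
        (by simp [hs.eq, h1]) (by simp [hs.eq, h5]) (by simpa using hA') (by omega) hc
        (by simp [hs.eq, h0]) (by simp [h11]) (by simp [h15]) (by simp)
        (by simp [hs.eq, h7, h8]) (by simp [hs.eq, h6, h7]) (by simp [hs.eq, h6, h8])
        (by simp [hs.eq, h6]) (by simp [hs.eq, h7]) (by simp [hs.eq, h8])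
        (by simpa [hs.eq, h6] using hrz)) (c := n * (m * 6 + 5) + 6) ?_) ?_
    · rintro U ⟨us, um, uo, uA, uf⟩
      simp only [Instr.run, setReg_mem, setReg_out, setReg_rmem] at um uo uf
      refine Trip.step <| Trip.step <| hI (r + 1) _ _ ?_ ?_ ?_ ?_ ?_ ?_ ?_ ?_ uA hR'
      · simpa using us.trans (f := S.reg) (lo := 11) (by simpa using hs) (by omega)
      · simp [us.eq, h12]
      · simp [us.eq, h14]
      · simp [um, hm]
      · simp [uo, ho]
      · simp [hs.eq, h7, h8] at uf
        simp [uf, hrz]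
      · simp [us.eq, hs.eq, h11, h5]
      · simp [us.eq, hs.eq, h15, h1, add_mul]
    · have h1 := Nat.mul_le_mul_right (m * 12 + 25) (Nat.sub_le n (r + 1))
      have h2 : n * (m * 18 + 30) = n * (m * 12 + 25) + n * (m * 6 + 5) := by ring
      omega
  · rintro T ⟨⟨r, hs, hm, ho, hrz, h11, h15, hr, A, hA', hR, hf⟩, hc⟩
    simp only [Test.Holds, hs.1.eq 1 (by omega), h1] at hc
    obtain ⟨-, hf⟩ := hf.resolve_left (fun h => hc h.1)
    obtain ⟨h1, h2⟩ := hR.finish h₀ hf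
    exact ⟨hs, hm, ho, hrz, A, r, h11, h15, hr, hA', h1, h2⟩
  · rw [show n * (m * 18 + 30) + 15 = n * (m * 18 + 30) + 14 + 1 from rfl]
    omega

end RealRAM

namespace HyperplanePartitions

/-! ### Mixed radix numbers -/

/-- The value of the digit at the position `p` for the bases `b`. -/
def placeValue (b : ℕ → ℕ) (p : ℕ) : ℕ := ∏ q ∈ Finset.range p, b q

/-- The digit of `x` at the position `p` for the bases `b`. -/
def digit (b : ℕ → ℕ) (x p : ℕ) : ℕ := x / placeValue b p % b p

theorem placeValue_succ (b : ℕ → ℕ) (p : ℕ) : placeValue b (p + 1) = placeValue b p * b p :=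
  Finset.prod_range_succ _ _

theorem placeValue_dvd (b : ℕ → ℕ) {p q : ℕ} (h : p ≤ q) : placeValue b p ∣ placeValue b q :=
  Finset.prod_dvd_prod_of_subset _ _ _ (by simpa using h)

theorem placeValue_pos {b : ℕ → ℕ} {p : ℕ} (hb : ∀ q < p, 0 < b q) : 0 < placeValue b p :=
  Finset.prod_pos fun q hq => hb q (Finset.mem_range.1 hq)

theorem digit_zero (b : ℕ → ℕ) (p : ℕ) : digit b 0 p = 0 := by simp [digit]

/-- The hypothesis `placeValue b p ∣ x + 1` expresses that the carry of `x + 1` reaches the position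
`p`; this is the invariant of the carry loop. -/
theorem digit_succ_of_lt {b : ℕ → ℕ} {x p q : ℕ} (hb : ∀ q < p, 0 < b q)
    (hp : placeValue b p ∣ x + 1) (hq : q < p) : digit b (x + 1) q = 0 := by
  obtain ⟨t, ht⟩ := (placeValue_dvd b (show q + 1 ≤ p from hq)).trans hp
  rw [digit, ht, placeValue_succ, mul_assoc,
    Nat.mul_div_cancel_left _ (placeValue_pos fun r hr => hb r (hr.trans hq)), Nat.mul_mod_right]

theorem placeValue_succ_dvd {b : ℕ → ℕ} {x p : ℕ} (hb : ∀ q ≤ p, 0 < b q)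
    (hp : placeValue b p ∣ x + 1) (h : b p ≤ digit b x p + 1) : placeValue b (p + 1) ∣ x + 1 := by
  have hW : 0 < placeValue b p := placeValue_pos fun q hq => hb q hq.le
  have hlt : digit b x p < b p := Nat.mod_lt _ (hb p le_rfl)
  have hy := Nat.succ_div_of_dvd hp
  have hdvd : b p ∣ x / placeValue b p + 1 := by
    rw [Nat.dvd_iff_mod_eq_zero, Nat.add_mod]
    change (digit b x p + 1 % b p) % b p = 0
    rw [Nat.add_mod_mod, show digit b x p + 1 = b p by omega, Nat.mod_self]
  rw [placeValue_succ, ← Nat.div_mul_cancel hp, mul_comm (placeValue b p)]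
  exact Nat.mul_dvd_mul_right (hy ▸ hdvd) _

theorem digit_succ_self {b : ℕ → ℕ} {x p : ℕ} (hp : placeValue b p ∣ x + 1)
    (h : digit b x p + 1 < b p) : digit b (x + 1) p = digit b x p + 1 := by
  rw [digit, Nat.succ_div_of_dvd hp, Nat.add_mod]
  change (digit b x p + 1 % b p) % b p = _
  rw [Nat.add_mod_mod, Nat.mod_eq_of_lt h]

theorem digit_succ_of_gt {b : ℕ → ℕ} {x p q : ℕ} (hp : placeValue b p ∣ x + 1)
    (h : digit b x p + 1 < b p) (hq : p < q) : digit b (x + 1) q = digit b x q := by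
  obtain ⟨t, ht⟩ := placeValue_dvd b (show p + 1 ≤ q from hq)
  have hnd : ¬ b p ∣ x / placeValue b p + 1 := by
    rw [Nat.dvd_iff_mod_eq_zero, Nat.add_mod]
    change ¬ (digit b x p + 1 % b p) % b p = 0
    rw [Nat.add_mod_mod, Nat.mod_eq_of_lt h]
    omega
  rw [digit, digit, ht, placeValue_succ, mul_assoc, ← Nat.div_div_eq_div_mul,
    ← Nat.div_div_eq_div_mul, ← Nat.div_div_eq_div_mul, ← Nat.div_div_eq_div_mul,
    Nat.succ_div_of_dvd hp, Nat.succ_div_of_not_dvd hnd]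

theorem digit_eq_zero {b : ℕ → ℕ} {x p : ℕ} (h : x < placeValue b p) : digit b x p = 0 := by
  rw [digit, Nat.div_eq_of_lt h, Nat.zero_mod]

theorem digit_placeValue {b : ℕ → ℕ} {p : ℕ} (hb : ∀ q < p, 0 < b q) (h : 1 < b p) :
    digit b (placeValue b p) p = 1 := by
  rw [digit, Nat.div_self (placeValue_pos hb), Nat.mod_eq_of_lt h]

theorem exists_digit_eq {b : ℕ → ℕ} {t : ℕ → ℕ} {N : ℕ} (ht : ∀ p < N, t p < b p) :
    ∃ x < placeValue b N, ∀ p < N, digit b x p = t p := by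
  induction N with
  | zero => exact ⟨0, by simp [placeValue], by simp⟩
  | succ N ih =>
    obtain ⟨x, hx, hd⟩ := ih fun p hp => ht p (hp.trans N.lt_succ_self)
    have hW : 0 < placeValue b N := by omega
    have htN := ht N N.lt_succ_self
    refine ⟨x + placeValue b N * t N, ?_, fun p hp => ?_⟩
    · rw [placeValue_succ]
      calc x + placeValue b N * t N < placeValue b N * (t N + 1) := by rw [mul_add, mul_one]; omega
        _ ≤ _ := Nat.mul_le_mul_left _ htN
    · rcases Nat.lt_succ_iff_lt_or_eq.1 hp with hp | rfl
      · rw [← hd p hp, digit, digit]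
        obtain ⟨u, hu⟩ := placeValue_dvd b (show p + 1 ≤ N from hp)
        have hWp : 0 < placeValue b p := Nat.pos_of_dvd_of_pos (placeValue_dvd b hp.le) hW
        rw [hu, placeValue_succ, mul_assoc, mul_assoc, Nat.add_mul_div_left _ _ hWp,
          Nat.add_mul_mod_self_left]
      · rw [digit, Nat.add_mul_div_left _ _ hW, Nat.div_eq_of_lt hx, zero_add, Nat.mod_eq_of_lt htN]

end HyperplanePartitions

/-! ### The counter for mixed radix numbers. -/

namespace RealRAM

open HyperplanePartitions

/-- Passes to the next number; the digits are at the addresses `3p`, the bases at `3p + 1`. -/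
def increment : Prog :=
  .instr (.const 40 0) ;; .instr (.load 41 40) ;; .instr (.add 41 41 5) ;;
  .instr (.add 42 41 5) ;; .instr (.add 44 40 5) ;; .instr (.load 43 44) ;;
  .while (.lt 43 42)
    (.instr (.store 40 10) ;; .instr (.add 40 40 14) ;; .instr (.load 41 40) ;;
      .instr (.add 41 41 5) ;; .instr (.add 42 41 5) ;; .instr (.add 44 40 5) ;;
      .instr (.load 43 44)) ;;
  .instr (.store 40 41)

/-- The index memory interleaves three arrays: digits at `3p`, bases at `3p + 1`, sides at `3p + 2`.
Residues modulo 3 therefore serve as frame conditions. The digit at the sentinel position `N` is `0`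
for `x < placeValue b N`; it stops the carry, and it becomes `1` exactly when the enumeration is
over. -/
theorem increment_spec {S : State} {b : ℕ → ℕ} {x N : ℕ} (h5 : S.reg 5 = 1) (h10 : S.reg 10 = 0)
    (h14 : S.reg 14 = 3) (hb : ∀ p ≤ N, 0 < b p) (hbN : b N = 2) (hx : x < placeValue b N)
    (hd : ∀ p ≤ N, S.mem (3 * p) = digit b x p) (hB : ∀ p ≤ N, S.mem (3 * p + 1) = b p) :
    Trip increment S (N * 8 + 8) fun T =>
      Same 40 S.reg T ∧ T.rmem = S.rmem ∧ T.out = S.out ∧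
      (∀ p ≤ N, T.mem (3 * p) = digit b (x + 1) p) ∧ ∀ a, a % 3 ≠ 0 → T.mem a = S.mem a := by
  unfold increment
  refine Trip.le (Trip.step <| Trip.step <| Trip.step <| Trip.step <| Trip.step <| Trip.step <|
    Trip.bind (c := 1) (Trip.while_le (b := 7) (fun p T => p ≤ N ∧ Same 40 S.reg T ∧
      T.rmem = S.rmem ∧ T.out = S.out ∧ T.reg 40 = 3 * p ∧ T.reg 41 = digit b x p + 1 ∧
      T.reg 42 = digit b x p + 2 ∧ T.reg 43 = b p ∧ placeValue b p ∣ x + 1 ∧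
      (∀ q < p, T.mem (3 * q) = 0) ∧ (∀ q, p ≤ q → q ≤ N → T.mem (3 * q) = digit b x q) ∧
      ∀ a, a % 3 ≠ 0 → T.mem a = S.mem a) N ?_ ?_) ?_) ?_
  · have h0 := hd 0 (by omega)
    have h0' := hB 0 (by omega)
    simp at h0 h0'
    simp [h5, h0, h0', placeValue]
    exact fun q hq => hd q hq
  · rintro p T ⟨hp, hs, hr, ho, h40, h41, h42, h43, hdvd, hlo, hhi, hfr⟩ hc
    simp only [Test.Holds, h42, h43] at hc
    have hpN : p < N := by
      refine lt_of_le_of_ne hp ?_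
      rintro rfl
      rw [digit_eq_zero hx] at hc
      omega
    refine ⟨hpN, ?_⟩
    have hd1 := hhi (p + 1) (by omega) (by omega)
    have hB1 : T.mem (3 * p + 3 + 1) = b (p + 1) := by
      rw [hfr _ (by omega), ← hB (p + 1) (by omega)]; rfl
    rw [mul_add, mul_one] at hd1
    refine Trip.step <| Trip.step <| Trip.step <| Trip.step <| Trip.step <| Trip.step <|
      Trip.instr ?_
    simp [hs, hs.eq, hr, ho, h40, h5, h10, h14, hd1, Function.update_of_ne]
    refine ⟨hpN, by omega, by rw [Function.update_of_ne (by omega), hB1], placeValue_succ_dvd (fun q hq => hb q (by omega)) hdvd (by omega),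
      fun q hq => ?_, fun q hq hq' => ?_, fun a ha => ?_⟩
    · rcases Nat.lt_or_eq_of_le hq with h | rfl
      · rw [Function.update_of_ne (by omega), hlo q h]
      · simp
    · rw [Function.update_of_ne (by omega), hhi q (by omega) hq']
    · rw [Function.update_of_ne (by omega), hfr a ha]
  · rintro T ⟨⟨p, hp, hs, hr, ho, h40, h41, h42, h43, hdvd, hlo, hhi, hfr⟩, hc⟩
    simp only [Test.Holds, h42, h43] at hc
    refine Trip.instr ?_
    simp [hs, hr, ho, h40, h41]
    refine ⟨fun q hq => ?_, fun a ha => ?_⟩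
    · rcases lt_trichotomy q p with h | rfl | h
      · rw [Function.update_of_ne (by omega), hlo q h,
          digit_succ_of_lt (fun q hq => hb q (by omega)) hdvd h]
      · rw [Function.update_self, digit_succ_self hdvd (by omega)]
      · rw [Function.update_of_ne (by omega), hhi q h.le hq, digit_succ_of_gt hdvd (by omega) h]
    · rw [Function.update_of_ne (by omega), hfr a ha]
  · omega

end RealRAM

/-! ### Digit bases and the memory layout. -/

namespace HyperplanePartitions

/-- The base of the digit at the position `p` (for rank `r`): a digit chooses a column and one of
three signs, and the last digit of each block of length `r` chooses only a sign. -/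
def digitBase (n m r p : ℕ) : ℕ :=
  if p % r + 1 < r then m + m + m else if r < n then 3 else 2

/-- The bases, with a sentinel at the position `N`. -/
def digitBase' (n m r N p : ℕ) : ℕ :=
  if p < N then digitBase n m r p else 2

end HyperplanePartitions

namespace RealRAM

open HyperplanePartitions

/-- The registers that are constant in the main loop. -/
structure Ctx (G : ℕ → ℕ) (n m k l flip r : ℕ) : Prop where
  g0 : G 0 = n
  g1 : G 1 = m
  g2 : G 2 = k
  g3 : G 3 = l
  g4 : G 4 = flip
  g5 : G 5 = 1
  -- Behind the matrix lie four cells: a constant zero, the factor of a row operation, a scratch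
  -- product, and the current sign. The working copy of the rows starts at `n * m + 4`.
  g6 : G 6 = n * m
  g7 : G 7 = n * m + 1
  g8 : G 8 = n * m + 2
  g9 : G 9 = n * m + 3
  g10 : G 10 = 0
  g11 : G 11 = r
  g12 : G 12 = k * l
  g14 : G 14 = 3
  g15 : G 15 = r * m
  g17 : G 17 = n * m + 4
  -- The address of the sentinel digit; the next register is the distance in memory between the
  -- sides of one column for consecutive hyperplanes.
  g18 : G 18 = 3 * (k * l * r)
  g19 : G 19 = m + m + m

/-- Computes the constants that do not depend on the rank. -/
def constants : Prog :=
  .instr (.const 5 1) ;; .instr (.const 10 0) ;; .instr (.const 14 3) ;; .instr (.const 6 0) ;;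
  .instr (.const 40 0) ;;
  .while (.lt 40 0) (.instr (.add 6 6 1) ;; .instr (.add 40 40 5)) ;;
  .instr (.add 7 6 5) ;; .instr (.add 8 7 5) ;; .instr (.add 9 8 5) ;; .instr (.rconst 6 0) ;;
  .instr (.const 12 0) ;; .instr (.const 40 0) ;;
  .while (.lt 40 2) (.instr (.add 12 12 3) ;; .instr (.add 40 40 5))

theorem constants_spec (S : State) :
    Trip constants S (S.reg 0 * 3 + S.reg 2 * 3 + 13) fun T =>
      T.mem = S.mem ∧ T.out = S.out ∧
      T.rmem = Function.update S.rmem (S.reg 0 * S.reg 1) 0 ∧ Same 5 S.reg T ∧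
      T.reg 5 = 1 ∧ T.reg 6 = S.reg 0 * S.reg 1 ∧ T.reg 7 = S.reg 0 * S.reg 1 + 1 ∧
      T.reg 8 = S.reg 0 * S.reg 1 + 2 ∧ T.reg 9 = S.reg 0 * S.reg 1 + 3 ∧ T.reg 10 = 0 ∧
      T.reg 12 = S.reg 2 * S.reg 3 ∧ T.reg 14 = 3 := by
  unfold constants
  refine Trip.le (Trip.step <| Trip.step <| Trip.step <| Trip.step <| Trip.step <|
    Trip.bind (c := S.reg 2 * 3 + 7) (Trip.while (b := 2) (fun t T => T.mem = S.mem ∧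
      T.out = S.out ∧ T.rmem = S.rmem ∧ Same 5 S.reg T ∧ T.reg 5 = 1 ∧ T.reg 6 = t * S.reg 1 ∧
      T.reg 10 = 0 ∧ T.reg 14 = 3 ∧ T.reg 40 = t) (S.reg 0) ?_ ?_ ?_ ?_) ?_) ?_
  · simp
  · rintro t ht T ⟨hm, ho, hr, hs, -, -, -, -, h40⟩
    simp [hs.eq, h40, ht]
  · rintro t ht T ⟨hm, ho, hr, hs, h5, h6, h10, h14, h40⟩
    refine Trip.step <| Trip.instr ?_
    simp [hm, ho, hr, hs, hs.eq, h5, h6, h10, h14, h40, add_mul]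
  · rintro T ⟨hm, ho, hr, hs, -, -, -, -, h40⟩
    simp [hs.eq, h40]
  · rintro T ⟨hm, ho, hr, hs, h5, h6, h10, h14, h40⟩
    refine Trip.le (Trip.step <| Trip.step <| Trip.step <| Trip.step <| Trip.step <| Trip.step <|
      Trip.imp (Trip.while (b := 2) (fun t T => T.mem = S.mem ∧ T.out = S.out ∧
      T.rmem = Function.update S.rmem (S.reg 0 * S.reg 1) 0 ∧ Same 5 S.reg T ∧
      T.reg 5 = 1 ∧ T.reg 6 = S.reg 0 * S.reg 1 ∧ T.reg 7 = S.reg 0 * S.reg 1 + 1 ∧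
      T.reg 8 = S.reg 0 * S.reg 1 + 2 ∧ T.reg 9 = S.reg 0 * S.reg 1 + 3 ∧ T.reg 10 = 0 ∧
      T.reg 12 = t * S.reg 3 ∧ T.reg 14 = 3 ∧ T.reg 40 = t) (S.reg 2) ?_ ?_ ?_ ?_) ?_) le_rfl
    · simp [hm, ho, hr, hs, h5, h6, h10, h14]
    · rintro t ht T ⟨-, -, -, hs, -, -, -, -, -, -, -, -, h40⟩
      simp [hs.eq, h40, ht]
    · rintro t ht T ⟨hm, ho, hr, hs, h5, h6, h7, h8, h9, h10, h12, h14, h40⟩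
      refine Trip.step <| Trip.instr ?_
      simp [hm, ho, hr, hs, hs.eq, h5, h6, h7, h8, h9, h10, h12, h14, h40, add_mul]
    · rintro T ⟨-, -, -, hs, -, -, -, -, -, -, -, -, h40⟩
      simp [hs.eq, h40]
    · rintro T ⟨hm, ho, hr, hs, h5, h6, h7, h8, h9, h10, h12, h14, h40⟩
      exact ⟨hm, ho, hr, hs, h5, h6, h7, h8, h9, h10, h12, h14⟩
  · omega

/-- Writes the bases of the digits. -/
def writeBases : Prog :=
  .instr (.add 17 9 5) ;; .instr (.add 19 1 1) ;; .instr (.add 19 19 1) ;;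
  .ite (.lt 11 0) (.instr (.const 13 3)) (.instr (.const 13 2)) ;;
  .instr (.const 18 0) ;; .instr (.const 40 0) ;;
  .while (.lt 40 12)
    (.instr (.const 41 0) ;;
      .while (.lt 41 11)
        (.instr (.add 42 41 5) ;; .instr (.add 43 18 5) ;;
          .ite (.lt 42 11) (.instr (.store 43 19)) (.instr (.store 43 13)) ;;
          .instr (.add 18 18 14) ;; .instr (.add 41 41 5)) ;;
      .instr (.add 40 40 5)) ;;
  .instr (.const 40 2) ;; .instr (.add 41 18 5) ;; .instr (.store 41 40)

theorem writeBases_spec {S : State} {n m K r : ℕ} (h0 : S.reg 0 = n) (h1 : S.reg 1 = m)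
    (h5 : S.reg 5 = 1) (h11 : S.reg 11 = r) (h12 : S.reg 12 = K) (h14 : S.reg 14 = 3) :
    Trip writeBases S (K * (r * 7 + 4) + 12) fun T =>
      T.rmem = S.rmem ∧ T.out = S.out ∧ Same 13 S.reg T ∧ T.reg 14 = 3 ∧ T.reg 15 = S.reg 15 ∧
      T.reg 17 = S.reg 9 + 1 ∧ T.reg 18 = 3 * (K * r) ∧ T.reg 19 = m + m + m ∧
      (∀ p ≤ K * r, T.mem (3 * p + 1) = digitBase' n m r (K * r) p) ∧
      ∀ a, a % 3 ≠ 1 → T.mem a = S.mem a := by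
  unfold writeBases
  let top := if r < n then 3 else 2
  let I : ℕ → State → Prop := fun p T => T.rmem = S.rmem ∧ T.out = S.out ∧ Same 13 S.reg T ∧
    T.reg 13 = top ∧ T.reg 14 = 3 ∧ T.reg 15 = S.reg 15 ∧ T.reg 17 = S.reg 9 + 1 ∧
    T.reg 18 = 3 * p ∧ T.reg 19 = m + m + m ∧
    (∀ p' < p, T.mem (3 * p' + 1) = digitBase n m r p') ∧ ∀ a, a % 3 ≠ 1 → T.mem a = S.mem a
  refine Trip.le (Trip.step <| Trip.step <| Trip.step <| Trip.bind (b := 2) (Q := fun T =>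
    T.mem = S.mem ∧ T.rmem = S.rmem ∧ T.out = S.out ∧ Same 13 S.reg T ∧
    T.reg 13 = top ∧ T.reg 14 = 3 ∧ T.reg 15 = S.reg 15 ∧ T.reg 17 = S.reg 9 + 1 ∧
    T.reg 19 = m + m + m) ?_ ?_ (c := K * (r * 7 + 4) + 7)) (by omega)
  · refine Trip.ite (fun h => Trip.instr ?_) fun h => Trip.instr ?_
    all_goals
      simp only [Test.Holds, run_add, setReg_reg] at h
      norm_num [h0, h11] at h
    · simp [top, h14, h5, h1, h]
    · simp [top, h14, h5, h1, h]
  · rintro T ⟨hm, hr, ho, hs, h13, h14, h15, h17, h19⟩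
    refine Trip.le (Trip.step <| Trip.step <| Trip.bind (c := 3)
      (Trip.while (b := r * 7 + 3) (fun q T => I (q * r) T ∧ T.reg 40 = q) K ?_ ?_ ?_ ?_) ?_) ?_
    · simp [I, hm, hr, ho, hs, h13, h14, h15, h17, h19]
    · rintro q hq T ⟨⟨-, -, hs, -⟩, h40⟩
      simp [hs.eq, h40, h12, hq]
    · rintro q hq T ⟨⟨hr, ho, hs, h13, h14, h15, h17, h18, h19, hB, hfr⟩, h40⟩
      refine Trip.le (Trip.step <| Trip.bind (c := 1) (Trip.while (b := 6)
        (fun j T => I (q * r + j) T ∧ T.reg 40 = q ∧ T.reg 41 = j) r ?_ ?_ ?_ ?_) ?_) ?_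
      · simp [I, hr, ho, hs, h13, h14, h15, h17, h18, h19, h40]
        exact ⟨hB, hfr⟩
      · rintro j hj T ⟨⟨-, -, hs, -⟩, -, h41⟩
        simp [hs.eq, h41, h11, hj]
      · rintro j hj T ⟨⟨hr, ho, hs, h13, h14, h15, h17, h18, h19, hB, hfr⟩, h40, h41⟩
        refine Trip.le (Trip.step <| Trip.step <| Trip.bind (b := 2) (c := 2) (Q := fun T =>
          T.rmem = S.rmem ∧ T.out = S.out ∧ Same 13 S.reg T ∧
          T.reg 13 = top ∧ T.reg 14 = 3 ∧ T.reg 15 = S.reg 15 ∧ T.reg 17 = S.reg 9 + 1 ∧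
          T.reg 18 = 3 * (q * r + j) ∧ T.reg 19 = m + m + m ∧
          (∀ p' < q * r + j + 1, T.mem (3 * p' + 1) = digitBase n m r p') ∧
          (∀ a, a % 3 ≠ 1 → T.mem a = S.mem a) ∧ T.reg 40 = q ∧ T.reg 41 = j) ?_ ?_) le_rfl
        · have hup : ∀ (μ : ℕ → ℕ) (v : ℕ), (∀ p' < q * r + j, μ (3 * p' + 1) = digitBase n m r p') →
              v = digitBase n m r (q * r + j) → ∀ p' < q * r + j + 1,
              Function.update μ (3 * (q * r + j) + 1) v (3 * p' + 1) = digitBase n m r p' := by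
            intro μ v hμ hv p' hp'
            rcases Nat.lt_succ_iff_lt_or_eq.1 hp' with h | rfl
            · rw [Function.update_of_ne (by omega), hμ p' h]
            · rw [Function.update_self, hv]
          have hup' : ∀ v a, a % 3 ≠ 1 →
              Function.update T.mem (3 * (q * r + j) + 1) v a = S.mem a := by
            intro v a ha
            rw [Function.update_of_ne (by omega), hfr a ha]
          have hmod : (q * r + j) % r = j := by rw [Nat.mul_add_mod', Nat.mod_eq_of_lt hj]
          refine Trip.ite (fun h => Trip.instr ?_) fun h => Trip.instr ?_
          · simp [hs.eq, h41, h5, h11] at h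
            simp only [run_add, run_store, setMem_rmem, setReg_rmem, setMem_out, setReg_out,
              setMem_reg, same_setMem, setMem_mem]
            norm_num [hr, ho, hs, hs.eq, h5, h13, h14, h15, h17, h18, h19, h40, h41]
            exact ⟨fun p hp => hup _ _ hB (by simp [digitBase, hmod, h]) p (by omega), hup' _⟩
          · simp [hs.eq, h41, h5, h11] at h
            simp only [run_add, run_store, setMem_rmem, setReg_rmem, setMem_out, setReg_out,
              setMem_reg, same_setMem, setMem_mem]
            norm_num [hr, ho, hs, hs.eq, h5, h13, h14, h15, h17, h18, h19, h40, h41]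
            exact ⟨fun p hp => hup _ _ hB (by simp [digitBase, hmod, top]; omega) p (by omega), hup' _⟩
        · rintro T ⟨hr, ho, hs, h13, h14, h15, h17, h18, h19, hB, hfr, h40, h41⟩
          refine Trip.step <| Trip.instr ?_
          simp only [I]
          simp [hr, ho, hs, hs.eq, h13, h14, h15, h17, h18, h19, h40, h41, h5]
          exact ⟨by omega, fun p hp => hB p (by omega), hfr⟩
      · rintro T ⟨⟨-, -, hs, -⟩, -, h41⟩
        simp [hs.eq, h41, h11]
      · rintro T ⟨⟨hr, ho, hs, h13, h14, h15, h17, h18, h19, hB, hfr⟩, h40, h41⟩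
        refine Trip.instr ?_
        simp only [I]
        simp [hr, ho, hs, hs.eq, h13, h14, h15, h17, h18, h19, h40, h5, add_mul]
        exact ⟨hB, hfr⟩
      · omega
    · rintro T ⟨⟨-, -, hs, -⟩, h40⟩
      simp [hs.eq, h40, h12]
    · rintro T ⟨⟨hr, ho, hs, h13, h14, h15, h17, h18, h19, hB, hfr⟩, h40⟩
      refine Trip.step <| Trip.step <| Trip.instr ?_
      simp [hr, ho, hs, hs.eq, h14, h15, h17, h18, h19, h5]
      refine ⟨fun p hp => ?_, fun a ha => ?_⟩
      · rcases Nat.lt_or_eq_of_le hp with h | rfl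
        · rw [Function.update_of_ne (by omega), hB p h, digitBase', if_pos h]
        · rw [Function.update_self, digitBase', if_neg (by omega)]
      · rw [Function.update_of_ne (by omega), hfr a ha]
    · rw [show r * 7 + 3 + 1 = r * 7 + 4 from rfl]
      omega

end RealRAM

namespace HyperplanePartitions

/-! ### Lexicographic signs -/

/-- Replaces the side `w` by the side of `y`, unless `y` vanishes. The nonnegative side is `1`, the
negative side is `0`. -/
noncomputable def lexStep (y : ℝ) (w : ℕ) : ℕ :=
  if 0 < y then 1 else if y < 0 then 0 else w

/-- The side given by the last nonzero entry of `y 0, …, y (j - 1)`. -/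
noncomputable def lexSide (y : ℕ → ℝ) : ℕ → ℕ
  | 0 => 1
  | j + 1 => lexStep (y j) (lexSide y j)

/-- The number of choices for the column at the position `j` of a block of length `r`. -/
def columnChoices (m r j : ℕ) : ℕ := if j + 1 < r then m else 1

/-- The column chosen by the digit `d`, for `u` columns. -/
def digitColumn (u d : ℕ) : ℕ := if d < u then d else if d - u < u then d - u else d - u - u

/-- The sign chosen by the digit `d`, for `u` columns. -/
noncomputable def digitSign (u d : ℕ) : ℝ := if d < u then 1 else if d - u < u then -1 else 0

/-- Elimination of the columns `c 0, …, c (j - 1)` from a matrix with `R` rows. -/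
noncomputable def reduceRows (A : ℕ → ℕ → ℝ) (R : ℕ) (c : ℕ → ℕ) : ℕ → ℕ → ℕ → ℝ
  | 0 => A
  | j + 1 => elimPass (reduceRows A R c j) j (c j) (R - (j + 1))

/-- The rows of the eliminated matrix. -/
noncomputable def reducedRow (A : ℕ → ℕ → ℝ) (R : ℕ) (c : ℕ → ℕ) (j : ℕ) : ℕ → ℝ :=
  reduceRows A R c (j + 1) j

/-- The sides of the columns that are described by the digits `d`. -/
noncomputable def blockSide (A : ℕ → ℕ → ℝ) (m r : ℕ) (d : ℕ → ℕ) (i : ℕ) : ℕ → ℕ :=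
  lexSide fun j => digitSign (columnChoices m r j) (d j) *
    reducedRow A r (fun j => digitColumn (columnChoices m r j) (d j)) j i

end HyperplanePartitions

/-! ### Computing the sides of the columns from the digits. -/

namespace RealRAM

open HyperplanePartitions

/-- Updates the sides at `reg 22` by the row at `reg 25`, multiplied by the real at `reg 9`. -/
def updateSides : Prog :=
  .instr (.copy 40 25) ;; .instr (.copy 41 22) ;; .instr (.const 42 0) ;;
  .while (.lt 42 1)
    (.instr (.rmul 8 9 40) ;;
      .ite (.rlt 6 8) (.instr (.store 41 5)) (.ite (.rlt 8 6) (.instr (.store 41 10)) .skip) ;;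
      .instr (.add 40 40 5) ;; .instr (.add 41 41 14) ;; .instr (.add 42 42 5))

/-- A nonzero value overwrites the side found so far, so after all rows the last nonzero value
decides, as in `lexSide`. -/
theorem updateSides_spec {S : State} {m E Z P : ℕ} {v : ℕ → ℝ} {w : ℕ → ℕ} {e : ℝ}
    (h1 : S.reg 1 = m) (h5 : S.reg 5 = 1) (h6 : S.reg 6 = Z) (h8 : S.reg 8 = Z + 2)
    (h9 : S.reg 9 = Z + 3) (h10 : S.reg 10 = 0) (h14 : S.reg 14 = 3) (h25 : S.reg 25 = E)
    (h22 : S.reg 22 = 3 * P + 2) (hE : Z + 4 ≤ E) (hv : ∀ i < m, S.rmem (E + i) = v i)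
    (hw : ∀ i < m, S.mem (3 * (P + i) + 2) = w i) (hz : S.rmem Z = 0)
    (he : S.rmem (Z + 3) = e) :
    Trip updateSides S (m * 8 + 4) fun T => Same 40 S.reg T ∧ T.out = S.out ∧
      (∀ i < m, T.mem (3 * (P + i) + 2) = lexStep (e * v i) (w i)) ∧
      (∀ a, (a % 3 = 2 → a < 3 * P ∨ 3 * (P + m) ≤ a) → T.mem a = S.mem a) ∧
      ∀ a, a ≠ Z + 2 → T.rmem a = S.rmem a := by
  unfold updateSides
  refine Trip.le (Trip.step <| Trip.step <| Trip.step <| Trip.imp (Trip.while (b := 7)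
    (fun t T => Same 40 S.reg T ∧ T.out = S.out ∧ T.reg 40 = E + t ∧
      T.reg 41 = 3 * (P + t) + 2 ∧ T.reg 42 = t ∧
      (∀ i < t, T.mem (3 * (P + i) + 2) = lexStep (e * v i) (w i)) ∧
      (∀ a, (a % 3 = 2 → a < 3 * P ∨ 3 * (P + t) ≤ a) → T.mem a = S.mem a) ∧
      ∀ a, a ≠ Z + 2 → T.rmem a = S.rmem a) m ?_ ?_ ?_ ?_) ?_) le_rfl
  · simp [h25, h22]
  · rintro t ht T ⟨hs, -, -, -, h42, -⟩
    simp [hs.eq, h1, h42, ht]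
  · rintro t ht T ⟨hs, ho, h40, h41, h42, hlo, hfr, hr⟩
    have hEt : T.rmem (E + t) = v t := by rw [hr _ (by omega), hv t ht]
    have hZe : T.rmem (Z + 3) = e := by rw [hr _ (by omega), he]
    have hZ0 : T.rmem Z = 0 := by rw [hr _ (by omega), hz]
    have hwt : T.mem (3 * (P + t) + 2) = w t := by
      rw [hfr _ (by omega), hw t ht]
    have hr' : ∀ x a, a ≠ Z + 2 → Function.update T.rmem (Z + 2) x a = S.rmem a := by
      intro x a ha
      rw [Function.update_of_ne ha, hr a ha]
    have hfr' : ∀ x a, (a % 3 = 2 → a < 3 * P ∨ 3 * (P + (t + 1)) ≤ a) →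
        Function.update T.mem (3 * (P + t) + 2) x a = S.mem a := by
      intro x a ha
      rw [Function.update_of_ne (by omega), hfr a (by omega)]
    have hlo' : ∀ x, x = lexStep (e * v t) (w t) → ∀ i < t + 1,
        Function.update T.mem (3 * (P + t) + 2) x (3 * (P + i) + 2) =
          lexStep (e * v i) (w i) := by
      intro x hx i hi
      rcases Nat.lt_succ_iff_lt_or_eq.1 hi with h | rfl
      · rw [Function.update_of_ne (by omega), hlo i h]
      · rw [Function.update_self, hx]
    refine Trip.le (Trip.step <| Trip.bind (b := 3) (c := 3) (Q := fun T => Same 40 S.reg T ∧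
      T.out = S.out ∧ T.reg 40 = E + t ∧ T.reg 41 = 3 * (P + t) + 2 ∧ T.reg 42 = t ∧
      (∀ i < t + 1, T.mem (3 * (P + i) + 2) = lexStep (e * v i) (w i)) ∧
      (∀ a, (a % 3 = 2 → a < 3 * P ∨ 3 * (P + (t + 1)) ≤ a) → T.mem a = S.mem a) ∧
      ∀ a, a ≠ Z + 2 → T.rmem a = S.rmem a) ?_ ?_) (by omega)
    · refine Trip.ite (b := 2) (fun h => ?_) fun h => Trip.ite (fun h' => ?_) fun h' => ?_
      · simp [hs.eq, h6, h8, h9, h40, hEt, hZe, hZ0] at h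
        refine Trip.le (Trip.instr ?_) (c := 2) (by omega)
        simp only [run_rmul, run_store]
        simp [hs, ho, hs.eq, h8, h9, h40, h41, h42, h5, hEt, hZe]
        exact ⟨fun i hi => hlo' 1 (by simp [lexStep, h]) i (by omega), hfr' 1, hr' _⟩
      · simp [hs.eq, h6, h8, h9, h40, hEt, hZe, hZ0] at h h'
        refine Trip.instr ?_
        simp only [run_rmul, run_store]
        simp [hs, ho, hs.eq, h8, h9, h40, h41, h42, h10, hEt, hZe]
        exact ⟨fun i hi => hlo' 0 (by simp [lexStep, h, h']) i (by omega), hfr' 0, hr' _⟩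
      · simp [hs.eq, h6, h8, h9, h40, hEt, hZe, hZ0] at h h'
        refine Trip.skip ?_
        simp only [run_rmul]
        simp [hs, ho, hs.eq, h8, h9, h40, h41, h42, hEt, hZe]
        refine ⟨fun i hi => ?_, fun a ha => hfr a (by omega), hr' _⟩
        rcases Nat.lt_or_eq_of_le hi with h | rfl
        · exact hlo i h
        · rw [hwt, lexStep, if_neg (by linarith), if_neg (by linarith)]
    · rintro T ⟨hs, ho, h40, h41, h42, hlo, hfr, hr⟩
      refine Trip.step <| Trip.step <| Trip.instr ?_
      simp only [run_add]
      simp [hs, ho, hs.eq, h40, h41, h42, h5, h14]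
      exact ⟨by omega, by omega, fun i hi => hlo i (by omega), hfr, hr⟩
  · rintro T ⟨hs, -, -, -, h42, -⟩
    simp [hs.eq, h1, h42]
  · rintro T ⟨hs, ho, -, -, -, h⟩
    exact ⟨hs, ho, h⟩

/-- Initializes the sides at `reg 22`, and copies the rows to the address `reg 17`. -/
def initBlock : Prog :=
  .instr (.copy 40 22) ;; .instr (.const 41 0) ;;
  .while (.lt 41 1) (.instr (.store 40 5) ;; .instr (.add 40 40 14) ;; .instr (.add 41 41 5)) ;;
  .instr (.const 40 0) ;; .instr (.copy 41 17) ;;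
  .while (.lt 40 15) (.instr (.rcopy 41 40) ;; .instr (.add 40 40 5) ;; .instr (.add 41 41 5))

theorem initBlock_spec {S : State} {m P N V : ℕ} (h1 : S.reg 1 = m) (h5 : S.reg 5 = 1)
    (h14 : S.reg 14 = 3) (h15 : S.reg 15 = N) (h17 : S.reg 17 = V) (h22 : S.reg 22 = 3 * P + 2)
    (hNV : N ≤ V) :
    Trip initBlock S (m * 4 + N * 4 + 6) fun T => Same 40 S.reg T ∧ T.out = S.out ∧
      (∀ i < m, T.mem (3 * (P + i) + 2) = 1) ∧
      (∀ a, (a % 3 = 2 → a < 3 * P ∨ 3 * (P + m) ≤ a) → T.mem a = S.mem a) ∧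
      (∀ a < N, T.rmem (V + a) = S.rmem a) ∧ ∀ a < V, T.rmem a = S.rmem a := by
  unfold initBlock
  refine Trip.le (Trip.step <| Trip.step <| Trip.bind (c := N * 4 + 3) (Trip.while (b := 3)
    (fun t T => Same 40 S.reg T ∧ T.out = S.out ∧ T.rmem = S.rmem ∧
      T.reg 40 = 3 * (P + t) + 2 ∧ T.reg 41 = t ∧
      (∀ i < t, T.mem (3 * (P + i) + 2) = 1) ∧
      (∀ a, (a % 3 = 2 → a < 3 * P ∨ 3 * (P + t) ≤ a) → T.mem a = S.mem a)) m ?_ ?_ ?_ ?_) ?_) ?_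
  · simp [h22]
  · rintro t ht T ⟨hs, -, -, -, h41, -⟩
    simp [hs.eq, h1, h41, ht]
  · rintro t ht T ⟨hs, ho, hr, h40, h41, hlo, hfr⟩
    refine Trip.step <| Trip.step <| Trip.instr ?_
    simp only [run_add, run_store]
    simp [hs, ho, hr, hs.eq, h40, h41, h5, h14]
    refine ⟨by omega, fun i hi => ?_, fun a ha => ?_⟩
    · rcases Nat.lt_or_eq_of_le hi with h | rfl
      · rw [Function.update_of_ne (by omega), hlo i h]
      · simp
    · rw [Function.update_of_ne (by omega), hfr a (by omega)]
  · rintro T ⟨hs, -, -, -, h41, -⟩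
    simp [hs.eq, h1, h41]
  · rintro T ⟨hs, ho, hr, -, -, hlo, hfr⟩
    refine Trip.le (Trip.step <| Trip.step <| Trip.imp (Trip.while (b := 3)
      (fun t T => Same 40 S.reg T ∧ T.out = S.out ∧ T.reg 40 = t ∧ T.reg 41 = V + t ∧
        (∀ i < m, T.mem (3 * (P + i) + 2) = 1) ∧
        (∀ a, (a % 3 = 2 → a < 3 * P ∨ 3 * (P + m) ≤ a) → T.mem a = S.mem a) ∧
        (∀ a < t, T.rmem (V + a) = S.rmem a) ∧ ∀ a < V, T.rmem a = S.rmem a) N ?_ ?_ ?_ ?_) ?_)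
      le_rfl
    · simp [hs, ho, hr, hs.eq, h17]
      exact ⟨hlo, hfr⟩
    · rintro t ht T ⟨hs, -, h40, -⟩
      simp [hs.eq, h15, h40, ht]
    · rintro t ht T ⟨hs, ho, h40, h41, hlo, hfr, hc, hr⟩
      refine Trip.step <| Trip.step <| Trip.instr ?_
      simp only [run_add, run_rcopy]
      simp [hs, ho, hs.eq, h40, h41, h5, add_assoc]
      refine ⟨hlo, hfr, fun a ha => ?_, fun a ha => ?_⟩
      · rcases Nat.lt_or_eq_of_le ha with h | rfl
        · rw [Function.update_of_ne (by omega), hc a h]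
        · rw [Function.update_self, hr a (by omega)]
      · rw [Function.update_of_ne (by omega), hr a ha]
    · rintro T ⟨hs, -, h40, -⟩
      simp [hs.eq, h15, h40]
    · rintro T ⟨hs, ho, -, -, h⟩
      exact ⟨hs, ho, h⟩
  · omega

/-- Splits the digit at `reg 21` into a column, `reg 26`, and a sign, the real at `reg 9`. -/
def decode : Prog :=
  .instr (.load 26 21) ;; .instr (.add 27 24 5) ;;
  .ite (.lt 27 11) (.instr (.copy 28 1)) (.instr (.const 28 1)) ;;
  .ite (.lt 26 28) (.instr (.rconst 9 1))
    (.instr (.sub 26 26 28) ;;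
      .ite (.lt 26 28) (.instr (.rconst 9 (-1))) (.instr (.sub 26 26 28) ;; .instr (.rconst 9 0)))

theorem decode_spec {S : State} {m r j Y d : ℕ} (h1 : S.reg 1 = m) (h5 : S.reg 5 = 1)
    (h9 : S.reg 9 = Y) (h11 : S.reg 11 = r) (h24 : S.reg 24 = j) (hd : S.mem (S.reg 21) = d) :
    Trip decode S 9 fun T => Same 26 S.reg T ∧ T.out = S.out ∧ T.mem = S.mem ∧
      T.reg 26 = digitColumn (columnChoices m r j) d ∧
      T.rmem = Function.update S.rmem Y (digitSign (columnChoices m r j) d) := by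
  unfold decode
  set u := columnChoices m r j with hu
  refine Trip.le (Trip.step <| Trip.step <| Trip.bind (b := 2) (c := 5) (Q := fun T =>
    Same 26 S.reg T ∧ T.out = S.out ∧ T.mem = S.mem ∧ T.rmem = S.rmem ∧ T.reg 26 = d ∧
    T.reg 28 = u) ?_ ?_) (by omega)
  · refine Trip.ite (fun h => Trip.instr ?_) fun h => Trip.instr ?_
    · simp [h24, h5, h11] at h
      simp [hd, h1, u, columnChoices, h]
    · simp [h24, h5, h11] at h
      simp [hd, u, columnChoices]
      omega
  · rintro T ⟨hs, ho, hm, hr, h26, h28⟩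
    refine Trip.ite (b := 4) (fun h => ?_) fun h => Trip.le (Trip.step <|
      Trip.ite (b := 2) (fun h' => ?_) fun h' => Trip.le (Trip.step <| Trip.instr ?_) ?_) ?_
    · simp [h26, h28] at h
      refine Trip.le (Trip.instr ?_) (c := 4) (by omega)
      simp [hs, ho, hm, hr, hs.eq, h9, h26, digitColumn, digitSign, h]
    · simp [h26, h28] at h h'
      refine Trip.le (Trip.instr ?_) (c := 2) (by omega)
      simp [hs, ho, hm, hr, hs.eq, h9, h26, h28, digitColumn, digitSign, h.not_gt, h']
    · simp [h26, h28] at h h'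
      simp [hs, ho, hm, hr, hs.eq, h9, h26, h28, digitColumn, digitSign, h.not_gt, h'.not_gt]
    · omega
    · omega

end RealRAM

namespace RealRAM

open HyperplanePartitions

/-- Computes the sides for the block of digits at `reg 21`, and puts them at `reg 22`. -/
def block : Prog :=
  initBlock ;; .instr (.const 24 0) ;; .instr (.copy 25 17) ;;
  .while (.lt 24 11)
    (decode ;; .instr (.copy 40 17) ;; .instr (.copy 41 11) ;; .instr (.copy 42 24) ;;
      .instr (.copy 43 25) ;; .instr (.copy 44 26) ;; pass ;; updateSides ;;
      .instr (.add 24 24 5) ;; .instr (.add 25 25 1) ;; .instr (.add 21 21 14)) ;;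
  .instr (.add 22 22 19)

/-- Elimination destroys the rows, so each block starts from a fresh copy. The cost is dominated by
`r` passes over at most `r` rows of length `m`. -/
theorem block_spec {S : State} {n m k l flip r p₀ P : ℕ} {A : ℕ → ℕ → ℝ} {d : ℕ → ℕ}
    (hG : Ctx S.reg n m k l flip r) (h21 : S.reg 21 = 3 * p₀) (h22 : S.reg 22 = 3 * P + 2)
    (hA : MatAt S.rmem 0 r m A) (hr : r ≤ n) (hz : S.rmem (n * m) = 0)
    (hd : ∀ j < r, S.mem (3 * (p₀ + j)) = d j)
    (hcol : ∀ j < r, digitColumn (columnChoices m r j) (d j) < m) :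
    Trip block S (r * (r * (m * 12 + 25) + m * 12 + 30) + m * 4 + 10) fun T =>
      Same 21 S.reg T ∧ T.out = S.out ∧ T.reg 21 = 3 * (p₀ + r) ∧ T.reg 22 = 3 * (P + m) + 2 ∧
      (∀ i < m, T.mem (3 * (P + i) + 2) = blockSide A m r d i r) ∧
      (∀ a, (a % 3 = 2 → a < 3 * P ∨ 3 * (P + m) ≤ a) → T.mem a = S.mem a) ∧
      ∀ a ≤ n * m, T.rmem a = S.rmem a := by
  unfold block
  set c : ℕ → ℕ := fun j => digitColumn (columnChoices m r j) (d j) with hc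
  have hrn : r * m ≤ n * m := Nat.mul_le_mul_right m hr
  refine Trip.le (Trip.bind (initBlock_spec (P := P) hG.g1 hG.g5 hG.g14 hG.g15 hG.g17 h22
    (by omega)) (c := r * (r * (m * 12 + 25) + m * 8 + 28) + 4) ?_) ?_
  · rintro S₁ ⟨hs₁, ho₁, hm₁, hf₁, hc₁, hr₁⟩
    refine Trip.le (Trip.step <| Trip.step <| Trip.bind (c := 1)
      (Trip.while (b := r * (m * 12 + 25) + m * 8 + 27) (fun j T => Same 21 S.reg T ∧
        T.out = S.out ∧ T.reg 21 = 3 * (p₀ + j) ∧ T.reg 22 = 3 * P + 2 ∧ T.reg 24 = j ∧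
        T.reg 25 = n * m + 4 + j * m ∧
        (∀ i < m, T.mem (3 * (P + i) + 2) = blockSide A m r d i j) ∧
        (∀ a, (a % 3 = 2 → a < 3 * P ∨ 3 * (P + m) ≤ a) → T.mem a = S.mem a) ∧
        MatAt T.rmem (n * m + 4) r m (reduceRows A r c j) ∧
        ∀ a ≤ n * m, T.rmem a = S.rmem a) r ?_ ?_ ?_ ?_) ?_) ?_
    · simp [hs₁.mono (show 21 ≤ 40 by omega), ho₁, hs₁.eq, h21, h22, hG.g17, blockSide, lexSide,
        reduceRows]
      refine ⟨hm₁, hf₁, fun i hi c hc => ?_, fun a ha => hr₁ a (by omega)⟩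
      have := row_le (m := m) hi
      rw [add_assoc, hc₁ _ (by omega)]
      simpa using hA i hi c hc
    · rintro j hj T ⟨hs, -, -, -, h24, -⟩
      simp [hs.eq, hG.g11, h24, hj]
    · rintro j hj T ⟨hs, ho, h21, h22, h24, h25, hm, hf, hM, hr⟩
      have hjr := row_le (m := m) hj
      have hdj : T.mem (T.reg 21) = d j := by
        rw [h21, hf _ (by omega), hd j hj]
      refine Trip.le (Trip.bind (decode_spec (m := m) (r := r) (j := j) (Y := n * m + 3) (d := d j)
        (by rw [hs.eq 1 (by omega), hG.g1]) (by rw [hs.eq 5 (by omega), hG.g5])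
        (by rw [hs.eq 9 (by omega), hG.g9]) (by rw [hs.eq 11 (by omega), hG.g11]) h24 hdj)
        (c := r * (m * 12 + 25) + m * 8 + 16) ?_) (by omega)
      rintro T₁ ⟨hs₁, ho₁, hm₁, h26₁, hr₁⟩
      have hS₁ : Same 21 S.reg T₁ := hs₁.trans hs (by omega)
      have hM₁ : MatAt T₁.rmem (n * m + 4) r m (reduceRows A r c j) := by
        intro i hi c' hc'
        rw [hr₁, Function.update_of_ne (by omega), hM i hi c' hc']
      refine Trip.le (Trip.step <| Trip.step <| Trip.step <| Trip.step <| Trip.step <|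
        Trip.bind (pass_spec (m := m) (base := n * m + 4) (R := r) (j := j) (c := c j)
          (A := reduceRows A r c j) ?_ ?_ ?_ hj (hcol j hj) ?_ ?_ ?_ ?_ ?_ ?_ ?_ ?_ ?_ ?_ ?_)
          (c := m * 8 + 7) ?_) ?_
      · simp [hS₁.eq, hG.g1]
      · simp [hS₁.eq, hG.g5]
      · simpa using hM₁
      · simp [hS₁.eq, hG.g11]
      · simp [hs₁.eq, h24]
      · simp [hs₁.eq, h25]
      · simp [h26₁, hc]
      · simp [hS₁.eq, hG.g7, hG.g8]
      · simp [hS₁.eq, hG.g6, hG.g7]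
      · simp [hS₁.eq, hG.g6, hG.g8]
      · simp [hS₁.eq, hG.g6]
      · simp [hS₁.eq, hG.g7]
      · simp [hS₁.eq, hG.g8]
      · simp [hS₁.eq, hG.g6, hr₁, Function.update_of_ne, hr, hz]
      · rintro T₂ ⟨hs₂, hm₂, ho₂, hM₂, hf₂⟩
        simp [hS₁.eq, hG.g7, hG.g8] at hf₂
        simp at hm₂ ho₂
        have hS₂ : Same 21 S.reg T₂ := hs₂.trans (f := S.reg) (by simpa using hS₁) (by omega)
        have e₂ : ∀ r, r < 26 → T₂.reg r = T.reg r := fun r hr => by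
          rw [hs₂.eq r (by omega)]
          simp [show r ≠ 40 by omega, show r ≠ 41 by omega, show r ≠ 42 by omega,
            show r ≠ 43 by omega, show r ≠ 44 by omega, hs₁.eq r hr]
        have hrow : ∀ i < m, T₂.rmem (n * m + 4 + j * m + i) = reducedRow A r c j i :=
          fun i hi => hM₂ j hj i hi
        have hr₂ : ∀ a ≤ n * m, T₂.rmem a = S.rmem a := fun a ha => by
          rw [hf₂ a (by omega) (by omega) (by omega), hr₁, Function.update_of_ne (by omega),
            hr a ha]
        refine Trip.le (Trip.bind (updateSides_spec (m := m) (E := n * m + 4 + j * m) (Z := n * m)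
          (P := P) (v := reducedRow A r c j) (w := fun i => blockSide A m r d i j)
          (e := digitSign (columnChoices m r j) (d j))
          (by rw [hS₂.eq 1 (by omega), hG.g1]) (by rw [hS₂.eq 5 (by omega), hG.g5])
          (by rw [hS₂.eq 6 (by omega), hG.g6]) (by rw [hS₂.eq 8 (by omega), hG.g8])
          (by rw [hS₂.eq 9 (by omega), hG.g9]) (by rw [hS₂.eq 10 (by omega), hG.g10])
          (by rw [hS₂.eq 14 (by omega), hG.g14]) (by rw [e₂ 25 (by omega), h25])
          (by rw [e₂ 22 (by omega), h22]) (by omega) hrow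
          (fun i hi => by rw [hm₂, hm₁, hm i hi]) (by rw [hr₂ _ le_rfl, hz]) ?_) (c := 3) ?_)
          (by omega)
        · rw [hf₂ _ (by omega) (by omega) (by omega), hr₁, Function.update_self]
        · rintro T₃ ⟨hs₃, ho₃, hm₃, hf₃, hr₃⟩
          have hS₃ : Same 21 S.reg T₃ := hs₃.trans hS₂ (by omega)
          refine Trip.step <| Trip.step <| Trip.instr ?_
          simp [hS₃, hS₃.eq, hs₃.eq, e₂, h21, h22, h24, h25, ho₃, ho₂, ho₁, ho, hG.g1, hG.g5,
            hG.g14]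
          refine ⟨by ring, by ring, hm₃, fun a ha => ?_, fun i hi c' hc' => ?_, fun a ha => ?_⟩
          · rw [hf₃ a ha, hm₂, hm₁, hf a ha]
          · rw [hr₃ _ (by omega)]
            exact hM₂ i hi c' hc'
          · rw [hr₃ a (by omega), hr₂ a ha]
      · have := Nat.mul_le_mul_right (m * 12 + 25) (Nat.sub_le r (j + 1))
        omega
    · rintro T ⟨hs, -, -, -, h24, -⟩
      simp [hs.eq, hG.g11, h24]
    · rintro T ⟨hs, ho, h21, h22, -, -, hm, hf, -, hr⟩
      refine Trip.instr ?_
      simp [hs, hs.eq, ho, h21, h22, hG.g19]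
      exact ⟨by omega, hm, hf, hr⟩
    · rw [show r * (m * 12 + 25) + m * 8 + 28 = r * (m * 12 + 25) + m * 8 + 27 + 1 from rfl]
  · have : r * (r * (m * 12 + 25) + m * 12 + 30) =
        r * (r * (m * 12 + 25) + m * 8 + 28) + r * m * 4 + r * 2 := by ring
    omega

/-- Computes the sides for all blocks. -/
def allBlocks : Prog :=
  .instr (.const 20 0) ;; .instr (.const 21 0) ;; .instr (.const 22 2) ;;
  .while (.lt 20 12) (block ;; .instr (.add 20 20 5))

theorem allBlocks_spec {S : State} {n m k l flip r : ℕ} {A : ℕ → ℕ → ℝ} {d : ℕ → ℕ}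
    (hG : Ctx S.reg n m k l flip r) (hA : MatAt S.rmem 0 r m A) (hr : r ≤ n)
    (hz : S.rmem (n * m) = 0) (hd : ∀ p < k * l * r, S.mem (3 * p) = d p)
    (hcol : ∀ q < k * l, ∀ j < r, digitColumn (columnChoices m r j) (d (q * r + j)) < m) :
    Trip allBlocks S
      (k * l * (r * (r * (m * 12 + 25) + m * 12 + 30) + m * 4 + 12) + 4) fun T =>
      Same 20 S.reg T ∧ T.out = S.out ∧
      (∀ q < k * l, ∀ i < m,
        T.mem (3 * (q * m + i) + 2) = blockSide A m r (fun j => d (q * r + j)) i r) ∧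
      (∀ a, a % 3 ≠ 2 → T.mem a = S.mem a) ∧ ∀ a ≤ n * m, T.rmem a = S.rmem a := by
  unfold allBlocks
  refine Trip.le (Trip.step <| Trip.step <| Trip.step <| Trip.imp (Trip.while
    (b := r * (r * (m * 12 + 25) + m * 12 + 30) + m * 4 + 11) (fun q T => Same 20 S.reg T ∧
      T.out = S.out ∧ T.reg 20 = q ∧ T.reg 21 = 3 * (q * r) ∧ T.reg 22 = 3 * (q * m) + 2 ∧
      (∀ q' < q, ∀ i < m,
        T.mem (3 * (q' * m + i) + 2) = blockSide A m r (fun j => d (q' * r + j)) i r) ∧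
      (∀ a, a % 3 ≠ 2 → T.mem a = S.mem a) ∧ ∀ a ≤ n * m, T.rmem a = S.rmem a)
      (k * l) ?_ ?_ ?_ ?_) ?_) le_rfl
  · simp
  · rintro q hq T ⟨hs, -, h20, -⟩
    simp [hs.eq, h20, hG.g12, hq]
  · rintro q hq T ⟨hs, ho, h20, h21, h22, hm, hf, hr'⟩
    have hG' : Ctx T.reg n m k l flip r := by
      constructor <;> rw [hs.eq _ (by omega)] <;> cases hG <;> assumption
    refine Trip.le (Trip.bind (block_spec (d := fun j => d (q * r + j)) (A := A) hG' h21 h22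
      (fun i hi c hc => ?_) hr (by rw [hr' _ le_rfl, hz]) (fun j hj => ?_) (hcol q hq))
      (c := 1) ?_) (by omega)
    · have h1 := row_le (m := m) hi
      have h2 := Nat.mul_le_mul_right m hr
      rw [hr' _ (by omega), hA i hi c hc]
    · have := row_le (m := r) hq
      rw [hf _ (by omega), hd _ (by omega)]
    · rintro T₁ ⟨hs₁, ho₁, h21₁, h22₁, hm₁, hf₁, hr₁⟩
      refine Trip.instr ?_
      simp [hs₁.trans hs, hs₁.eq, hs.eq, ho₁, ho, h20, h21₁, h22₁, hG.g5]
      refine ⟨by ring, by ring, fun q' hq' i hi => ?_, fun a ha => ?_, fun a ha => ?_⟩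
      · rcases Nat.lt_or_eq_of_le hq' with h | rfl
        · have := row_le (m := m) h
          rw [hf₁ _ (by omega), hm q' h i hi]
        · exact hm₁ i hi
      · rw [hf₁ a (by omega), hf a ha]
      · rw [hr₁ a ha, hr' a ha]
  · rintro T ⟨hs, -, h20, -⟩
    simp [hs.eq, h20, hG.g12]
  · rintro T ⟨hs, ho, -, -, -, h⟩
    exact ⟨hs, ho, h⟩

end RealRAM

/-! ### From sides to printed letters. -/

namespace HyperplanePartitions

/-- The part of a column, found from the last family to the first one, for the sides `w` of the
column; the family `t` has the sides `w (t * l), …, w (t * l + l - 1)`. -/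
def partLetter (k l : ℕ) (w : ℕ → ℕ) : ℕ → ℕ
  | 0 => k + 1
  | t + 1 => if ∀ b < l, w (t * l + b) ≠ 0 then k - t else partLetter k l w t

/-- The printed letter: `x`, or `c - x` if `c` is positive. -/
def flipLetter (c x : ℕ) : ℕ := if 0 < c then c - x else x

end HyperplanePartitions

namespace RealRAM

open HyperplanePartitions

/-- Computes the part `reg 42` of the column whose sides start at `reg 40`. -/
def findLetter : Prog :=
  .instr (.add 42 2 5) ;; .instr (.copy 43 2) ;; .instr (.copy 41 40) ;; .instr (.const 44 0) ;;
  .while (.lt 44 2)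
    (.instr (.const 45 1) ;; .instr (.const 46 0) ;;
      .while (.lt 46 3)
        (.instr (.load 48 41) ;; .ite (.lt 48 5) (.instr (.const 45 0)) .skip ;;
          .instr (.add 41 41 19) ;; .instr (.add 46 46 5)) ;;
      .ite (.lt 45 5) .skip (.instr (.copy 42 43)) ;;
      .instr (.sub 43 43 5) ;; .instr (.add 44 44 5))

/-- The family `t` in memory stands for the part `k - t`. Running through the families in memory
order and overwriting the answer leaves the smallest index of a family whose cell contains the
column. -/
theorem findLetter_spec {S : State} {n m k l flip r i : ℕ} {w : ℕ → ℕ}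
    (hG : Ctx S.reg n m k l flip r) (h40 : S.reg 40 = 3 * i + 2)
    (hw : ∀ q < k * l, S.mem (3 * (q * m + i) + 2) = w q) :
    Trip findLetter S (k * (l * 6 + 8) + 5) fun T =>
      Same 20 S.reg T ∧ T.out = S.out ∧ T.mem = S.mem ∧ T.rmem = S.rmem ∧
      T.reg 40 = S.reg 40 ∧ T.reg 47 = S.reg 47 ∧ T.reg 42 = partLetter k l w k := by
  unfold findLetter
  let I : State → Prop := fun T => Same 20 S.reg T ∧ T.out = S.out ∧ T.mem = S.mem ∧
    T.rmem = S.rmem ∧ T.reg 40 = S.reg 40 ∧ T.reg 47 = S.reg 47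
  refine Trip.le (Trip.step <| Trip.step <| Trip.step <| Trip.step <| Trip.imp (Trip.while
    (b := l * 6 + 7) (fun t T => I T ∧ T.reg 41 = 3 * (t * l * m + i) + 2 ∧ T.reg 43 = k - t ∧
      T.reg 44 = t ∧ T.reg 42 = partLetter k l w t) k ?_ ?_ ?_ ?_) ?_) le_rfl
  · simp [I, hG.g2, hG.g5, h40, partLetter]
  · rintro t ht T ⟨⟨hs, -⟩, -, -, h44, -⟩
    simp [hs.eq, hG.g2, h44, ht]
  · rintro t ht T ⟨⟨hs, ho, hm, hr, h40, h47⟩, h41, h43, h44, h42⟩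
    refine Trip.le (Trip.step <| Trip.step <| Trip.bind (Trip.while (b := 5) (fun b T => I T ∧
      T.reg 41 = 3 * ((t * l + b) * m + i) + 2 ∧ T.reg 43 = k - t ∧ T.reg 44 = t ∧
      T.reg 42 = partLetter k l w t ∧ T.reg 46 = b ∧
      T.reg 45 = if ∀ b' < b, w (t * l + b') ≠ 0 then 1 else 0) l ?_ ?_ ?_ ?_) (c := 4) ?_)
      (by omega)
    · simp [I, hs, ho, hm, hr, h40, h47, h41, h42, h43, h44]
    · rintro b hb T ⟨⟨hs, -⟩, -, -, -, -, h46, -⟩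
      simp [hs.eq, hG.g3, h46, hb]
    · rintro b hb T ⟨⟨hs, ho, hm, hr, h40, h47⟩, h41, h43, h44, h42, h46, h45⟩
      have hwb : T.mem (T.reg 41) = w (t * l + b) := by
        have := row_le (m := l) ht
        rw [hm, h41, hw _ (by omega)]
      refine Trip.le (Trip.step <| Trip.bind (b := 2) (c := 2) (Q := fun T => I T ∧
        T.reg 41 = 3 * ((t * l + b) * m + i) + 2 ∧ T.reg 43 = k - t ∧ T.reg 44 = t ∧
        T.reg 42 = partLetter k l w t ∧ T.reg 46 = b ∧
        T.reg 45 = if ∀ b' < b + 1, w (t * l + b') ≠ 0 then 1 else 0) ?_ ?_) (by omega)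
      · refine Trip.ite (fun h => Trip.instr ?_) fun h => Trip.skip ?_
        · simp [hs.eq, hG.g5, hwb] at h
          have hn : ¬ ∀ b' < b + 1, w (t * l + b') ≠ 0 := fun hall => hall b (by omega) h
          rw [if_neg hn]
          simp [I, hs, ho, hm, hr, h40, h47, h41, h42, h43, h44, h46]
        · simp [hs.eq, hG.g5, hwb] at h
          have hiff : (∀ b' < b + 1, w (t * l + b') ≠ 0) ↔ ∀ b' < b, w (t * l + b') ≠ 0 := by
            refine ⟨fun hall b' hb' => hall b' (by omega), fun hall b' hb' => ?_⟩
            rcases Nat.lt_succ_iff_lt_or_eq.1 hb' with hlt | rfl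
            exacts [hall b' hlt, h]
          simp only [hiff]
          simp [I, hs, ho, hm, hr, h40, h47, h41, h42, h43, h44, h46, h45]
      · rintro T ⟨⟨hs, ho, hm, hr, h40, h47⟩, h41, h43, h44, h42, h46, h45⟩
        refine Trip.step <| Trip.instr ?_
        simp only [run_add, I]
        simp [hs, hs.eq, ho, hm, hr, h40, h47, h41, h42, h43, h44, h46, hG.g5, hG.g19]
        exact ⟨by ring, by simpa using h45⟩
    · rintro T ⟨⟨hs, -⟩, -, -, -, -, h46, -⟩
      simp [hs.eq, hG.g3, h46]
    · rintro T ⟨⟨hs, ho, hm, hr, h40, h47⟩, h41, h43, h44, h42, h46, h45⟩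
      refine Trip.le (Trip.bind (b := 2) (c := 2) (Q := fun T => I T ∧
        T.reg 41 = 3 * ((t * l + l) * m + i) + 2 ∧ T.reg 43 = k - t ∧ T.reg 44 = t ∧
        T.reg 42 = partLetter k l w (t + 1)) ?_ ?_) (by omega)
      · refine Trip.ite (fun h => Trip.skip ?_) fun h => Trip.instr ?_
        · simp [hs.eq, hG.g5, h45] at h
          refine ⟨⟨hs, ho, hm, hr, h40, h47⟩, h41, h43, h44, ?_⟩
          rw [h42, partLetter, if_neg (by simpa using h)]
        · simp [hs.eq, hG.g5, h45] at h
          simp only [run_copy, I]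
          simp [hs, ho, hm, hr, h40, h47, h41, h43, h44]
          rw [partLetter, if_pos h]
      · rintro T ⟨⟨hs, ho, hm, hr, h40, h47⟩, h41, h43, h44, h42⟩
        refine Trip.step <| Trip.instr ?_
        simp only [run_sub, run_add, I]
        simp [hs, hs.eq, ho, hm, hr, h40, h47, h41, h43, h44, h42, hG.g5, add_mul]
        omega
  · rintro T ⟨⟨hs, -⟩, -, -, h44, -⟩
    simp [hs.eq, hG.g2, h44]
  · rintro T ⟨⟨hs, ho, hm, hr, h40, h47⟩, -, -, -, h42⟩
    exact ⟨hs, ho, hm, hr, h40, h47, h42⟩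

/-- Prints the word of the parts of all columns. -/
def printWord : Prog :=
  .instr (.const 40 2) ;; .instr (.const 47 0) ;;
  .while (.lt 47 1)
    (findLetter ;; .ite (.lt 10 4) (.instr (.sub 42 4 42)) .skip ;; .instr (.emit 42) ;;
      .instr (.add 40 40 14) ;; .instr (.add 47 47 5)) ;;
  .instr (.emit 10)

theorem printWord_spec {S : State} {n m k l flip r : ℕ} {w : ℕ → ℕ → ℕ}
    (hG : Ctx S.reg n m k l flip r)
    (hw : ∀ q < k * l, ∀ i < m, S.mem (3 * (q * m + i) + 2) = w q i) :
    Trip printWord S (m * (k * (l * 6 + 8) + 11) + 4) fun T =>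
      Same 20 S.reg T ∧ T.mem = S.mem ∧ T.rmem = S.rmem ∧
      T.out = S.out ++ ((List.range m).map fun i =>
        flipLetter flip (partLetter k l (fun q => w q i) k)) ++ [0] := by
  unfold printWord
  refine Trip.le (Trip.step <| Trip.step <| Trip.bind (Trip.while (b := k * (l * 6 + 8) + 10)
    (fun i T => Same 20 S.reg T ∧ T.mem = S.mem ∧ T.rmem = S.rmem ∧ T.reg 40 = 3 * i + 2 ∧
      T.reg 47 = i ∧ T.out = S.out ++ ((List.range i).map fun i =>
        flipLetter flip (partLetter k l (fun q => w q i) k))) m ?_ ?_ ?_ ?_) (c := 1) ?_) ?_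
  · simp
  · rintro i hi T ⟨hs, -, -, -, h47, -⟩
    simp [hs.eq, hG.g1, h47, hi]
  · rintro i hi T ⟨hs, hm, hr, h40, h47, ho⟩
    have hG' : Ctx T.reg n m k l flip r := by
      constructor <;> rw [hs.eq _ (by omega)] <;> cases hG <;> assumption
    refine Trip.le (Trip.bind (findLetter_spec (w := fun q => w q i) hG' h40
      fun q hq => by rw [hm, hw q hq i hi]) (c := 5) ?_) (by omega)
    rintro T₁ ⟨hs₁, ho₁, hm₁, hr₁, h40₁, h47₁, h42₁⟩
    have hs₁' := hs₁.trans hs le_rfl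
    refine Trip.le (Trip.bind (b := 2) (c := 3) (Q := fun T => Same 20 S.reg T ∧ T.mem = S.mem ∧
      T.rmem = S.rmem ∧ T.reg 40 = 3 * i + 2 ∧ T.reg 47 = i ∧ T.out = T₁.out ∧
      T.reg 42 = flipLetter flip (partLetter k l (fun q => w q i) k)) ?_ ?_) le_rfl
    · refine Trip.ite (fun h => Trip.instr ?_) fun h => Trip.skip ?_
      · simp [hs₁'.eq, hG.g10, hG.g4] at h
        simp [hs₁', hs₁'.eq, hm₁, hm, hr₁, hr, h40₁, h40, h47₁, h47, h42₁, hG.g4, flipLetter, h]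
      · simp [hs₁'.eq, hG.g10, hG.g4] at h
        simp [hs₁', hm₁, hm, hr₁, hr, h40₁, h40, h47₁, h47, h42₁, flipLetter, h]
    · rintro T₂ ⟨hs₂, hm₂, hr₂, h40₂, h47₂, ho₂, h42₂⟩
      refine Trip.step <| Trip.step <| Trip.instr ?_
      simp [hs₂, hs₂.eq, hm₂, hr₂, h40₂, h47₂, ho₂, h42₂, ho₁, ho, hG.g5, hG.g14,
        List.range_succ]
      omega
  · rintro T ⟨hs, -, -, -, h47, -⟩
    simp [hs.eq, hG.g1, h47]
  · rintro T ⟨hs, hm, hr, h40, h47, ho⟩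
    refine Trip.instr ?_
    simp [hs, hs.eq, hm, hr, ho, hG.g10]
  · rw [show k * (l * 6 + 8) + 11 = k * (l * 6 + 8) + 10 + 1 from rfl]

end RealRAM

/-! ### Counting the digit strings. -/

namespace HyperplanePartitions

/-- The last digit of a block names the dummy column `0`; `pass_spec` still asks for a column below
`m`, hence `0 < m`. -/
theorem digitColumn_lt {n m r N x q j : ℕ} (hj : j < r) (hm : 0 < m) (hp : q * r + j < N) :
    digitColumn (columnChoices m r j) (digit (digitBase' n m r N) x (q * r + j)) < m := by
  have hb : digitBase' n m r N (q * r + j) =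
      if j + 1 < r then m + m + m else if r < n then 3 else 2 := by
    rw [digitBase', if_pos hp, digitBase, Nat.mul_add_mod', Nat.mod_eq_of_lt hj]
  have hlt : digit (digitBase' n m r N) x (q * r + j) < digitBase' n m r N (q * r + j) := by
    refine Nat.mod_lt _ ?_
    rw [hb]
    split_ifs <;> omega
  rw [hb] at hlt
  generalize digit (digitBase' n m r N) x (q * r + j) = d at hlt
  unfold digitColumn columnChoices
  split_ifs at hlt ⊢ <;> omega

theorem digitBase'_pos {n m r N : ℕ} (hm : 0 < r → 0 < m) (hN : r = 0 → N = 0) (p : ℕ) :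
    0 < digitBase' n m r N p := by
  unfold digitBase' digitBase
  split_ifs <;> omega

/-- For `0 < r`, a block consists of `r - 1` digits with base `3 * m` and one digit with base at
most `3`. The missing factor `m` of the last digit is what leaves room for the cost of evaluating a
block. -/
theorem prod_digitBase_le (n m r K : ℕ) :
    ∏ p ∈ Finset.range (K * r), digitBase n m r p ≤ (3 ^ r * m ^ (r - 1)) ^ K := by
  induction K with
  | zero => simp
  | succ K ih =>
    rw [Nat.succ_mul, Finset.prod_range_add, pow_succ]
    refine Nat.mul_le_mul ih ?_
    have h : ∀ j < r, digitBase n m r (K * r + j) =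
        if j + 1 < r then m + m + m else if r < n then 3 else 2 := fun j hj => by
      rw [digitBase, Nat.mul_add_mod', Nat.mod_eq_of_lt hj]
    rw [Finset.prod_congr rfl fun j hj => h j (Finset.mem_range.1 hj)]
    rcases r with - | r
    · simp
    · rw [Finset.prod_range_succ, Finset.prod_congr rfl (g := fun _ => 3 * m) fun j hj => by
        rw [if_pos (by simpa using hj)]; ring]
      rw [Finset.prod_const, Finset.card_range, mul_pow, Nat.add_sub_cancel, pow_succ]
      have : (if r + 1 + 1 < r + 1 then m + m + m else if r + 1 < n then 3 else 2) ≤ 3 := by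
        split_ifs <;> omega
      calc _ ≤ 3 ^ r * m ^ r * 3 := Nat.mul_le_mul_left _ (by split_ifs <;> omega)
        _ = _ := by ring

theorem placeValue_digitBase'_le (n m r K : ℕ) :
    placeValue (digitBase' n m r (K * r)) (K * r) ≤ (3 ^ r * m ^ (r - 1)) ^ K := by
  refine le_trans (le_of_eq ?_) (prod_digitBase_le n m r K)
  exact Finset.prod_congr rfl fun p hp => if_pos (Finset.mem_range.1 hp)

/-- The word that is printed for the number `x`. -/
noncomputable def wordOf (A : ℕ → ℕ → ℝ) (n m k l flip r x : ℕ) : List ℕ :=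
  (List.range m).map fun i => flipLetter flip (partLetter k l
    (fun q => blockSide A m r (fun j => digit (digitBase' n m r (k * l * r)) x (q * r + j)) i r) k)

/-- The number of steps for one word. -/
def wordCost (m k l r : ℕ) : ℕ :=
  -- The summand `18` collects the constants `4 + 4 + 8` of the three subroutines, the reloading of
  -- the sentinel digit, and the loop test.
  k * l * (r * (r * (m * 12 + 25) + m * 12 + 30) + m * 4 + 12) + m * (k * (l * 6 + 8) + 11) +
    k * l * r * 8 + 18

end HyperplanePartitions

/-! ### The main loop. -/

namespace RealRAM

open HyperplanePartitions

/-- Prints the words for all choices of digits. -/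
def enumerate : Prog :=
  constants ;; removeDependencies ;; writeBases ;; .instr (.load 20 18) ;;
  .while (.lt 20 5) (allBlocks ;; printWord ;; increment ;; .instr (.load 20 18))

theorem mainLoop_spec {S : State} {n m k l flip r : ℕ} {A : ℕ → ℕ → ℝ}
    (hG : Ctx S.reg n m k l flip r) (hA : MatAt S.rmem 0 r m A) (hr : r ≤ n)
    (hz : S.rmem (n * m) = 0) (hm : 0 < r → 0 < m) (h20 : S.reg 20 = 0) (ho : S.out = [])
    (hd : ∀ p ≤ k * l * r, S.mem (3 * p) = 0)
    (hB : ∀ p ≤ k * l * r, S.mem (3 * p + 1) = digitBase' n m r (k * l * r) p) :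
    Trip (.while (.lt 20 5) (allBlocks ;; printWord ;; increment ;; .instr (.load 20 18))) S
      ((3 ^ r * m ^ (r - 1)) ^ (k * l) * wordCost m k l r + 1) fun T =>
      T.out = (List.range (placeValue (digitBase' n m r (k * l * r)) (k * l * r))).flatMap
        fun x => wordOf A n m k l flip r x ++ [0] := by
  set N := k * l * r with hN
  set b := digitBase' n m r N with hb
  have hbpos : ∀ p, 0 < b p := digitBase'_pos hm fun h => by rw [hN, h, mul_zero]
  have hbN : b N = 2 := if_neg (lt_irrefl _)
  refine Trip.le (Trip.imp (Trip.while (b := wordCost m k l r - 1) (fun x T =>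
    Same 20 S.reg T ∧ T.reg 20 = digit b x N ∧
    T.out = ((List.range x).flatMap fun x => wordOf A n m k l flip r x ++ [0]) ∧
    (∀ p ≤ N, T.mem (3 * p) = digit b x p) ∧ (∀ p ≤ N, T.mem (3 * p + 1) = b p) ∧
    ∀ a ≤ n * m, T.rmem a = S.rmem a) (placeValue b N) ?_ ?_ ?_ ?_) ?_) ?_
  · simp [h20, digit_zero, ho]
    exact ⟨hd, hB⟩
  · rintro x hx T ⟨hs, h20, -⟩
    simp [hs.eq, h20, hG.g5, digit_eq_zero hx]
  · rintro x hx T ⟨hs, h20, ho, hd, hB, hr'⟩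
    have hG₁ : Ctx T.reg n m k l flip r := by
      constructor <;> rw [hs.eq _ (by omega)] <;> cases hG <;> assumption
    refine Trip.le (Trip.bind (allBlocks_spec (A := A) (d := digit b x) hG₁ ?_ hr
      (by rw [hr' _ le_rfl, hz]) (fun p hp => hd p hp.le) (fun q hq j hj => ?_))
      (c := m * (k * (l * 6 + 8) + 11) + N * 8 + 13) ?_) ?_
    · intro i hi c hc
      have h1 := row_le (m := m) hi
      have h2 := Nat.mul_le_mul_right m hr
      rw [hr' _ (by omega), hA i hi c hc]
    · have := row_le (m := r) hq
      exact digitColumn_lt hj (hm (by omega)) (by omega)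
    · rintro T₁ ⟨hs₁, ho₁, hm₁, hf₁, hr₁⟩
      have hG₂ : Ctx T₁.reg n m k l flip r := by
        constructor <;> rw [hs₁.eq _ (by omega)] <;> cases hG₁ <;> assumption
      refine Trip.le (Trip.bind (printWord_spec hG₂ hm₁) (c := N * 8 + 9) ?_) (by omega)
      rintro T₂ ⟨hs₂, hm₂, hr₂, ho₂⟩
      have hS₂ : Same 20 S.reg T₂ := hs₂.trans (hs₁.trans hs le_rfl) le_rfl
      refine Trip.le (Trip.bind (increment_spec (b := b) (x := x) (N := N)
        (by rw [hS₂.eq _ (by omega), hG.g5]) (by rw [hS₂.eq _ (by omega), hG.g10])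
        (by rw [hS₂.eq _ (by omega), hG.g14]) (fun p _ => hbpos p) hbN hx
        (fun p hp => by rw [hm₂, hf₁ _ (by omega), hd p hp])
        (fun p hp => by rw [hm₂, hf₁ _ (by omega), hB p hp])) (c := 1) ?_) (by omega)
      rintro T₃ ⟨hs₃, hr₃, ho₃, hd₃, hf₃⟩
      have hS₃ : Same 20 S.reg T₃ := hs₃.trans hS₂ (by omega)
      refine Trip.instr ?_
      simp only [run_load, hS₃.eq 18 (by omega), hG.g18]
      simp [hS₃, ho₃, ho₂, ho₁, ho, hr₃, hr₂, List.range_succ]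
      refine ⟨hd₃ N le_rfl, ?_, hd₃, fun p hp => ?_, fun a ha => ?_⟩
      · simp only [wordOf, List.map_inj_left]
        exact fun _ _ => rfl
      · rw [hf₃ _ (by omega), hm₂, hf₁ _ (by omega), hB p hp]
      · rw [hr₁ a ha, hr' a ha]
    · rw [wordCost]
      omega
  · rintro T ⟨hs, h20, -⟩
    simp [hs.eq, h20, hG.g5, digit_placeValue (fun q _ => hbpos q) (show 1 < b N by omega)]
  · rintro T ⟨-, -, ho, -⟩
    exact ho
  · rw [Nat.sub_add_cancel (by rw [wordCost]; omega)]
    exact Nat.add_le_add_right (Nat.mul_le_mul_right _ (placeValue_digitBase'_le n m r (k * l))) 1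

theorem enumerate_spec {S : State} {n m k l flip : ℕ} {A₀ : ℕ → ℕ → ℝ} (h0 : S.reg 0 = n)
    (h1 : S.reg 1 = m) (h2 : S.reg 2 = k) (h3 : S.reg 3 = l) (h4 : S.reg 4 = flip)
    (hmem : S.mem = fun _ => 0) (ho : S.out = []) (hA : MatAt S.rmem 0 n m A₀)
    (h₀ : ∀ i, ∀ c, m ≤ c → A₀ i c = 0) {s : ℕ}
    (hs : s = Module.finrank ℝ (Submodule.span ℝ (A₀ '' Set.Iio n))) :
    Trip enumerate S (n * 3 + k * 3 + n * (m * 6 + 5) + s * (n * (m * 18 + 30) + 15) +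
      k * l * (s * 7 + 4) + (3 ^ s * m ^ (s - 1)) ^ (k * l) * wordCost m k l s + 34) fun T =>
      ∃ A, s ≤ n ∧ Submodule.span ℝ (A '' Set.Iio s) = Submodule.span ℝ (A₀ '' Set.Iio n) ∧
      T.out = (List.range (placeValue (digitBase' n m s (k * l * s)) (k * l * s))).flatMap
        fun x => wordOf A n m k l flip s x ++ [0] := by
  unfold enumerate
  have hm : 0 < s → 0 < m := by
    intro hpos
    by_contra! hm0
    have : Submodule.span ℝ (A₀ '' Set.Iio n) = ⊥ := by
      rw [Submodule.span_eq_bot]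
      rintro _ ⟨i, -, rfl⟩
      ext c
      exact h₀ i c (by omega)
    rw [this, finrank_bot] at hs
    omega
  refine Trip.le (Trip.bind (constants_spec S) (c := n * (m * 6 + 5) +
    s * (n * (m * 18 + 30) + 15) + k * l * (s * 7 + 4) +
    (3 ^ s * m ^ (s - 1)) ^ (k * l) * wordCost m k l s + 21) ?_) (by rw [h0, h2]; omega)
  simp only [h0, h1, h2, h3]
  rintro T ⟨tm, tout, tr, ts, t5, t6, t7, t8, t9, t10, t12, t14⟩
  refine Trip.le (Trip.bind (removeDependencies_spec (n := n) (m := m) (A₀ := A₀)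
    (by rw [ts.eq _ (by omega), h0]) (by rw [ts.eq _ (by omega), h1]) t5 t6 t7 t8
    (fun i hi c hc => ?_) (by simp [tr]) h₀)
    (c := k * l * (s * 7 + 4) + (3 ^ s * m ^ (s - 1)) ^ (k * l) * wordCost m k l s + 14) ?_)
    (by rw [← hs]; omega)
  · have := row_le (m := m) hi
    rw [tr, Function.update_of_ne (by omega), hA i hi c hc]
  rintro U ⟨⟨us, u12, u14⟩, um, uo, uz, A, r, u11, u15, hr, uA, hrs, hspan⟩
  obtain rfl : r = s := by rw [hrs, hs]
  have uS : Same 5 S.reg U := us.trans ts (by omega)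
  refine Trip.le (Trip.bind (writeBases_spec (n := n) (m := m) (K := k * l) (r := r)
    (by rw [uS.eq _ (by omega), h0]) (by rw [uS.eq _ (by omega), h1])
    (by rw [us.eq _ (by omega), t5]) u11 (by rw [u12, t12]) (by rw [u14, t14]))
    (c := (3 ^ r * m ^ (r - 1)) ^ (k * l) * wordCost m k l r + 2) ?_) (by omega)
  rintro V ⟨vr, vo, vs, v14, v15, v17, v18, v19, vB, vf⟩
  have vS : Same 5 S.reg V := vs.trans uS (by omega)
  have vT : Same 11 T.reg V := vs.trans us (by omega)
  have hG : Ctx V.reg n m k l flip r := {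
    g0 := by rw [vS.eq _ (by omega), h0]
    g1 := by rw [vS.eq _ (by omega), h1]
    g2 := by rw [vS.eq _ (by omega), h2]
    g3 := by rw [vS.eq _ (by omega), h3]
    g4 := by rw [vS.eq _ (by omega), h4]
    g5 := by rw [vT.eq _ (by omega), t5]
    g6 := by rw [vT.eq _ (by omega), t6]
    g7 := by rw [vT.eq _ (by omega), t7]
    g8 := by rw [vT.eq _ (by omega), t8]
    g9 := by rw [vT.eq _ (by omega), t9]
    g10 := by rw [vT.eq _ (by omega), t10]
    g11 := by rw [vs.eq _ (by omega), u11]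
    g12 := by rw [vs.eq _ (by omega), u12, t12]
    g14 := v14
    g15 := by rw [v15, u15]
    g17 := by rw [v17, us.eq _ (by omega), t9]
    g18 := v18
    g19 := v19 }
  have hV0 : ∀ p, V.mem (3 * p) = 0 := fun p => by
    rw [vf _ (by omega), um, tm, hmem]
  refine Trip.step <| Trip.imp (mainLoop_spec (n := n) (m := m) (k := k) (l := l) (flip := flip)
    (r := r) (A := A) ?_ (fun i hi c hc => ?_) hr (by simp [vr, uz]) hm (by simp [v18, hV0])
    (by simp [vo, uo, tout, ho]) (fun p _ => by simp [hV0]) fun p hp => by simp [vB p hp]) ?_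
  · constructor <;> simp <;> cases hG <;> assumption
  · simpa [vr] using uA i (by omega) c hc
  · intro W hW
    exact ⟨A, hr, hspan, hW⟩

end RealRAM

namespace HyperplanePartitions

open Submodule Module

/-! ### Signs of functionals on finitely many vectors -/

section Flags

variable {E ι : Type*} [AddCommGroup E] [Module ℝ E]

/-- The functional `g` does not vanish on all the vectors of `Z`, and where it does not vanish, it
has the side that is given by `f`. -/
def Refines (v : ι → E) (Z : Set ι) (f g : Dual ℝ E) : Prop :=
  (∃ i ∈ Z, g (v i) ≠ 0) ∧ ∀ i ∈ Z, g (v i) ≠ 0 → (0 < g (v i) ↔ 0 ≤ f (v i))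

/-- The indices in `Z` of the vectors on which `g` vanishes. -/
def zeroSet (v : ι → E) (Z : Set ι) (g : Dual ℝ E) : Set ι :=
  {i ∈ Z | g (v i) = 0}

theorem zeroSet_subset (v : ι → E) (Z : Set ι) (g : Dual ℝ E) : zeroSet v Z g ⊆ Z :=
  fun _ hi => hi.1

theorem apply_eq_zero_of_mem_span_zeroSet {v : ι → E} {Z : Set ι} {g : Dual ℝ E} {x : E}
    (hx : x ∈ span ℝ (v '' zeroSet v Z g)) : g x = 0 := by
  have : span ℝ (v '' zeroSet v Z g) ≤ LinearMap.ker g := by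
    rw [span_le]
    rintro _ ⟨i, hi, rfl⟩
    exact hi.2
  exact this hx

theorem finrank_zeroSet_lt [FiniteDimensional ℝ E] {v : ι → E} {Z : Set ι} {g : Dual ℝ E} (h : ∃ i ∈ Z, g (v i) ≠ 0) :
    finrank ℝ (span ℝ (v '' zeroSet v Z g)) < finrank ℝ (span ℝ (v '' Z)) := by
  obtain ⟨i, hi, hgi⟩ := h
  have hle : span ℝ (v '' zeroSet v Z g) ≤ span ℝ (v '' Z) :=
    span_mono (Set.image_mono (zeroSet_subset v Z g))
  refine finrank_lt_finrank_of_lt (lt_of_le_of_ne hle fun heq => hgi ?_)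
  refine apply_eq_zero_of_mem_span_zeroSet (v := v) (Z := Z) ?_
  rw [heq]
  exact subset_span (Set.mem_image_of_mem v hi)

theorem exists_dual_of_notMem {U : Submodule ℝ E} {x : E} (hx : x ∉ U) :
    ∃ w : Dual ℝ E, w x ≠ 0 ∧ ∀ u ∈ U, w u = 0 := by
  obtain ⟨w, hw, hU⟩ := U.exists_dual_map_eq_bot_of_notMem hx inferInstance
  refine ⟨w, hw, fun u hu => ?_⟩
  have : w u ∈ U.map w := ⟨u, hu, rfl⟩
  rwa [hU, mem_bot] at this

/-- Rotate `g` about the vectors on its hyperplane: add a multiple of a direction `w` that vanishes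
on them, and stop at the first vector that is hit. No vector changes strictly from one side to the
other, and the new vector enlarges the span. -/
theorem Refines.improve [FiniteDimensional ℝ E] {v : ι → E} {Z : Set ι} (hZ : Z.Finite) {f g : Dual ℝ E}
    (h : Refines v Z f g)
    (hlt : finrank ℝ (span ℝ (v '' zeroSet v Z g)) + 1 < finrank ℝ (span ℝ (v '' Z))) :
    ∃ g', Refines v Z f g' ∧
      finrank ℝ (span ℝ (v '' zeroSet v Z g)) < finrank ℝ (span ℝ (v '' zeroSet v Z g')) := by
  obtain ⟨⟨i₀, hi₀, hg₀⟩, hc⟩ := h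
  set U := span ℝ (v '' zeroSet v Z g)
  have hU' : finrank ℝ (U ⊔ span ℝ {v i₀} : Submodule ℝ E) ≤ finrank ℝ U + 1 := by
    refine (finrank_add_le_finrank_add_finrank _ _).trans (Nat.add_le_add_left ?_ _)
    exact (finrank_span_le_card _).trans (by simp)
  obtain ⟨i₁, hi₁, hn₁⟩ : ∃ i ∈ Z, v i ∉ U ⊔ span ℝ {v i₀} := by
    by_contra! hall
    have : span ℝ (v '' Z) ≤ U ⊔ span ℝ {v i₀} := by
      rw [span_le]
      rintro _ ⟨i, hi, rfl⟩
      exact hall i hi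
    have := finrank_mono this
    omega
  -- Codimension at least two leaves room for `w` to vanish at `v i₀` as well; this keeps the
  -- rotated functional nonzero on `Z`.
  obtain ⟨w, hw₁, hw⟩ := exists_dual_of_notMem hn₁
  have hwU : ∀ i ∈ Z, g (v i) = 0 → w (v i) = 0 := fun i hi h0 =>
    hw _ (mem_sup_left (subset_span ⟨i, ⟨hi, h0⟩, rfl⟩))
  have hw₀ : w (v i₀) = 0 := hw _ (mem_sup_right (mem_span_singleton_self _))
  -- The vector that is hit first; minimality of the absolute value means that `t * w` nowhere
  -- exceeds `g` on `Z`.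
  obtain ⟨j, ⟨hj, hwj⟩, hmin⟩ := Set.exists_min_image {i ∈ Z | w (v i) ≠ 0}
    (fun i => |g (v i) / w (v i)|) (hZ.subset fun _ hi => hi.1) ⟨i₁, hi₁, hw₁⟩
  set t := -(g (v j) / w (v j)) with ht
  have hle : ∀ i ∈ Z, |t * w (v i)| ≤ |g (v i)| := by
    intro i hi
    by_cases hwi : w (v i) = 0
    · simp [hwi]
    · have := hmin i ⟨hi, hwi⟩
      rw [abs_mul, ht, abs_neg]
      calc _ ≤ |g (v i) / w (v i)| * |w (v i)| := by gcongr
        _ = _ := by rw [← abs_mul, div_mul_cancel₀ _ hwi]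
  have hj0 : (g + t • w) (v j) = 0 := by
    simp [ht, div_mul_cancel₀ _ hwj]
  refine ⟨g + t • w, ⟨⟨i₀, hi₀, by simpa [hw₀] using hg₀⟩, fun i hi hne => ?_⟩, ?_⟩
  · simp only [LinearMap.add_apply, LinearMap.smul_apply, smul_eq_mul] at hne ⊢
    have hgi : g (v i) ≠ 0 := fun h0 => hne (by rw [h0, hwU i hi h0]; simp)
    rw [← hc i hi hgi]
    have h1 := hle i hi
    have h2 := abs_le.1 h1
    rcases lt_or_gt_of_ne hgi with hneg | hpos
    · rw [abs_of_neg hneg] at h2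
      constructor <;> intro <;> linarith
    · rw [abs_of_pos hpos] at h2
      refine ⟨fun _ => hpos, fun _ => lt_of_le_of_ne (by linarith) (Ne.symm hne)⟩
  · refine finrank_lt_finrank_of_lt (lt_of_le_of_ne (span_mono (Set.image_mono ?_)) ?_)
    · rintro i ⟨hi, h0⟩
      refine ⟨hi, ?_⟩
      simp [h0, hwU i hi h0]
    -- The span has grown: `w` vanishes on `U` but not at `v j`.
    · intro heq
      refine hwj (hw _ (mem_sup_left ?_))
      rw [heq]
      exact subset_span ⟨j, ⟨hj, hj0⟩, rfl⟩

/-- Among the functionals that refine `f` there is one that vanishes on vectors that span a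
subspace of codimension one. -/
theorem exists_refines [FiniteDimensional ℝ E] {v : ι → E} {Z : Set ι} (hZ : Z.Finite) {f : Dual ℝ E}
    (hf : ∃ i ∈ Z, f (v i) ≠ 0) :
    ∃ g, Refines v Z f g ∧
      finrank ℝ (span ℝ (v '' zeroSet v Z g)) + 1 = finrank ℝ (span ℝ (v '' Z)) := by
  suffices H : ∀ N g, Refines v Z f g →
      finrank ℝ (span ℝ (v '' Z)) ≤ finrank ℝ (span ℝ (v '' zeroSet v Z g)) + 1 + N →
      ∃ g, Refines v Z f g ∧
        finrank ℝ (span ℝ (v '' zeroSet v Z g)) + 1 = finrank ℝ (span ℝ (v '' Z)) from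
    H _ f ⟨hf, fun i _ h => ⟨le_of_lt, fun h' => lt_of_le_of_ne h' h.symm⟩⟩ (Nat.le_add_left _ _)
  intro N
  induction N with
  | zero =>
    intro g hg hle
    have := finrank_zeroSet_lt hg.1
    exact ⟨g, hg, by omega⟩
  | succ N ih =>
    intro g hg hle
    by_cases hlt : finrank ℝ (span ℝ (v '' zeroSet v Z g)) + 1 < finrank ℝ (span ℝ (v '' Z))
    · obtain ⟨g', hg', hlt'⟩ := hg.improve hZ hlt
      exact ih g' hg' (by omega)
    · have := finrank_zeroSet_lt hg.1
      exact ⟨g, hg, by omega⟩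

theorem exists_basis_subset (v : ι → E) {Z : Set ι} (hZ : Z.Finite) :
    ∃ b : Finset ι, ↑b ⊆ Z ∧ span ℝ (v '' b) = span ℝ (v '' Z) ∧ LinearIndepOn ℝ v (b : Set ι) ∧
      b.card = finrank ℝ (span ℝ (v '' Z)) := by
  obtain ⟨b, hb, -, hspan, hli⟩ :=
    exists_linearIndepOn_extension (linearIndepOn_empty ℝ v) (Set.empty_subset Z)
  lift b to Finset ι using hZ.subset hb
  have heq : span ℝ (v '' b) = span ℝ (v '' Z) :=
    le_antisymm (span_mono (Set.image_mono hb)) (span_le.2 hspan)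
  refine ⟨b, hb, heq, hli, ?_⟩
  have := finrank_span_eq_card hli
  rw [← heq, Set.image_eq_range, this]
  simp

theorem exists_spanning_sequence [Nonempty ι] (v : ι → E) {Z : Set ι} (hZ : Z.Finite) :
    ∃ c : ℕ → ι, (∀ j < finrank ℝ (span ℝ (v '' Z)), c j ∈ Z) ∧
      span ℝ ((fun j => v (c j)) '' Set.Iio (finrank ℝ (span ℝ (v '' Z)))) =
        span ℝ (v '' Z) := by
  obtain ⟨b, hb, hspan, -, hcard⟩ := exists_basis_subset v hZ
  rw [← hcard]
  let e := b.equivFin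
  refine ⟨fun j => if h : j < b.card then e.symm ⟨j, h⟩ else Classical.arbitrary ι,
    fun j hj => ?_, ?_⟩
  · simp only [dif_pos hj]
    exact hb (e.symm ⟨j, hj⟩).2
  · rw [← hspan]
    congr 1
    ext x
    constructor
    · rintro ⟨j, hj, rfl⟩
      simp only [Set.mem_Iio] at hj
      simp only [dif_pos hj]
      exact ⟨_, (e.symm ⟨j, hj⟩).2, rfl⟩
    · rintro ⟨i, hi, rfl⟩
      refine ⟨e ⟨i, hi⟩, (e ⟨i, hi⟩).2, ?_⟩
      simp

theorem lexSide_congr {y y' : ℕ → ℝ} {d : ℕ} (h : ∀ j < d, y j = y' j) :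
    lexSide y d = lexSide y' d := by
  induction d with
  | zero => rfl
  | succ d ih =>
    rw [lexSide, lexSide, ih fun j hj => h j (by omega), h d (by omega)]

theorem lexSide_of_zero {y : ℕ → ℝ} {d : ℕ} (h : ∀ j < d, y j = 0) : lexSide y d = 1 := by
  induction d with
  | zero => rfl
  | succ d ih => simp [lexSide, lexStep, h d (by omega), ih fun j hj => h j (by omega)]

theorem lexSide_of_last {y : ℕ → ℝ} {d j : ℕ} (hj : j < d) (h0 : y j ≠ 0)
    (h : ∀ j' < d, j < j' → y j' = 0) : lexSide y d = if 0 < y j then 1 else 0 := by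
  induction d with
  | zero => omega
  | succ d ih =>
    rcases Nat.lt_succ_iff_lt_or_eq.1 hj with hlt | rfl
    · simp [lexSide, lexStep, h d (by omega) hlt, ih hlt fun j' hj' => h j' (by omega)]
    · rw [lexSide, lexStep]
      split_ifs with h1 h2
      · rfl
      · rfl
      · exact absurd (le_antisymm (not_lt.1 h1) (not_lt.1 h2)) h0

/-- The sides of the vectors in `Z` that are given by `f` can be read off from functionals that
form a triangular system with a suitable basis `v (c 0), v (c 1), …`. -/
theorem exists_flag [FiniteDimensional ℝ E] [Nonempty ι] (v : ι → E) (f : Dual ℝ E) (d : ℕ) :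
    ∀ Z : Set ι, Z.Finite → finrank ℝ (span ℝ (v '' Z)) = d →
      ∃ (c : ℕ → ι) (a : ℕ), a ≤ d ∧ (a < d ↔ ∃ i ∈ Z, f (v i) ≠ 0) ∧ (∀ j < d, c j ∈ Z) ∧
        span ℝ ((fun j => v (c j)) '' Set.Iio d) = span ℝ (v '' Z) ∧
        ∀ G : ℕ → Dual ℝ E,
          (∀ i, a ≤ i → i < d → (∀ j < i, G i (v (c j)) = 0) ∧ G i (v (c i)) ≠ 0) →
          ∃ e : ℕ → ℝ, (∀ j, e j = 0 ∨ e j = 1 ∨ e j = -1) ∧ (∀ j < d, e j ≠ 0 ↔ a ≤ j) ∧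
            ∀ i ∈ Z, lexSide (fun j => e j * G j (v i)) d = if 0 ≤ f (v i) then 1 else 0 := by
  induction d with
  | zero =>
    intro Z hZ hd
    obtain ⟨c, hc, hspan⟩ := exists_spanning_sequence v hZ
    have hv : ∀ i ∈ Z, v i = 0 := fun i hi => by
      have : v i ∈ span ℝ (v '' Z) := subset_span ⟨i, hi, rfl⟩
      rwa [finrank_eq_zero.1 hd, mem_bot] at this
    rw [hd] at hc hspan
    refine ⟨c, 0, le_rfl, ⟨by omega, ?_⟩, hc, hspan, fun G _ => ⟨0, by simp, by simp, ?_⟩⟩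
    · rintro ⟨i, hi, h⟩
      exact absurd (by rw [hv i hi, map_zero]) h
    · intro i hi
      simp [hv i hi, lexSide]
  | succ d ih =>
    intro Z hZ hd
    by_cases hf : ∃ i ∈ Z, f (v i) ≠ 0
    · obtain ⟨g, ⟨⟨i₀, hi₀, hg₀⟩, hcomp⟩, hrank⟩ := exists_refines hZ hf
      set Z' := zeroSet v Z g with hZ'
      obtain ⟨c, a, had, -, hc, hspan, hG⟩ :=
        ih Z' (hZ.subset (zeroSet_subset v Z g)) (by omega)
      have hspan' : span ℝ (v '' Z') ⊔ span ℝ {v i₀} = span ℝ (v '' Z) := by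
        refine eq_of_le_of_finrank_le (sup_le (span_mono (Set.image_mono (zeroSet_subset v Z g)))
          (span_le.2 (Set.singleton_subset_iff.2
            (subset_span (Set.mem_image_of_mem v hi₀))))) ?_
        rw [hd, Nat.succ_le_iff, ← (show finrank ℝ (span ℝ (v '' Z')) = d by omega)]
        refine finrank_lt_finrank_of_lt (lt_of_le_of_ne le_sup_left fun heq => hg₀ ?_)
        refine apply_eq_zero_of_mem_span_zeroSet (Z := Z) (v := v) ?_
        change v i₀ ∈ span ℝ (v '' Z')
        rw [heq]
        exact mem_sup_right (mem_span_singleton_self _)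
      -- The flag of the hyperplane of `g` is completed by one vector off it; the level `a` is
      -- inherited.
      refine ⟨Function.update c d i₀, a, by omega, ⟨fun _ => hf, fun _ => by omega⟩,
        fun j hj => ?_, ?_, fun G hG' => ?_⟩
      · rcases Nat.lt_succ_iff_lt_or_eq.1 hj with h | rfl
        · rw [Function.update_of_ne h.ne]
          exact (hc j h).1
        · rwa [Function.update_self]
      · rw [← hspan', ← hspan, show Set.Iio (d + 1) = insert d (Set.Iio d) by ext; simp,
          Set.image_insert_eq, span_insert, Function.update_self, sup_comm]
        congr 2
        refine Set.image_congr fun j hj => ?_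
        rw [Function.update_of_ne (ne_of_lt hj)]
      · have hcj : ∀ j < d, Function.update c d i₀ j = c j := fun j hj =>
          Function.update_of_ne hj.ne _ _
        obtain ⟨e, he, hea, hes⟩ := hG G fun i hai hid => by
          obtain ⟨h1, h2⟩ := hG' i hai (by omega)
          rw [hcj i hid] at h2
          exact ⟨fun j hj => by simpa [hcj j (hj.trans hid)] using h1 j hj, h2⟩
        obtain ⟨hGd, hGd'⟩ := hG' d had (by omega)
        rw [Function.update_self] at hGd'
        have hG0 : ∀ x ∈ span ℝ (v '' Z'), G d x = 0 := by
          rw [← hspan]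
          intro x hx
          have : span ℝ ((fun j => v (c j)) '' Set.Iio d) ≤ LinearMap.ker (G d) := by
            rw [span_le]
            rintro _ ⟨j, hj, rfl⟩
            simpa [hcj j hj] using hGd j hj
          exact this hx
        -- `G d` and `g` both vanish on the span of `Z'`, which has codimension one, so they are
        -- proportional on the span of `Z`; `ε` is the sign of the factor.
        set ε : ℝ := if 0 < G d (v i₀) * g (v i₀) then 1 else -1 with hε
        have hεpos : 0 < ε * (G d (v i₀) * g (v i₀)) := by
          rw [hε]
          split_ifs with h
          · linarith
          · have : G d (v i₀) * g (v i₀) ≠ 0 := mul_ne_zero hGd' hg₀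
            have := lt_of_le_of_ne (not_lt.1 h) this
            linarith
        have hε0 : ε ≠ 0 := fun h => by simp [h] at hεpos
        refine ⟨Function.update e d ε, fun j => ?_, fun j hj => ?_, fun i hi => ?_⟩
        · rcases eq_or_ne j d with rfl | h
          · rw [Function.update_self, hε]
            split_ifs <;> simp
          · rw [Function.update_of_ne h]
            exact he j
        · rcases Nat.lt_succ_iff_lt_or_eq.1 hj with h | rfl
          · rw [Function.update_of_ne h.ne]
            exact hea j h
          · rw [Function.update_self]
            exact ⟨fun _ => had, fun _ => hε0⟩
        · rw [lexSide, Function.update_self,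
            lexSide_congr (y' := fun j => e j * G j (v i)) fun j hj => by
              rw [Function.update_of_ne hj.ne]]
          by_cases hgi : g (v i) = 0
          · have hGi : G d (v i) = 0 := hG0 _ (subset_span ⟨i, ⟨hi, hgi⟩, rfl⟩)
            rw [hGi, mul_zero, lexStep, if_neg (lt_irrefl _), if_neg (lt_irrefl _)]
            exact hes i ⟨hi, hgi⟩
          · have hmem : v i ∈ span ℝ (v '' Z') ⊔ span ℝ {v i₀} := by
              rw [hspan']
              exact subset_span ⟨i, hi, rfl⟩
            obtain ⟨u, hu, x, hx, hux⟩ := mem_sup.1 hmem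
            obtain ⟨α, rfl⟩ := mem_span_singleton.1 hx
            have hg1 : g (v i) = α * g (v i₀) := by
              rw [← hux, map_add, map_smul, apply_eq_zero_of_mem_span_zeroSet hu, zero_add,
                smul_eq_mul]
            have hG1 : G d (v i) = α * G d (v i₀) := by
              rw [← hux, map_add, map_smul, hG0 u hu, zero_add, smul_eq_mul]
            have hpos : 0 < (ε * G d (v i)) * g (v i) := by
              have hα : α ≠ 0 := fun h => hgi (by rw [hg1, h, zero_mul])
              rw [hg1, hG1]
              have := mul_pos (mul_self_pos.2 hα) hεpos
              linarith
            have hiff := hcomp i hi hgi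
            rcases lt_or_gt_of_ne hgi with hneg | hpos'
            · have h1 : ε * G d (v i) < 0 := by
                by_contra! h
                nlinarith
              rw [lexStep, if_neg h1.not_gt, if_pos h1, if_neg fun h => hneg.not_gt (hiff.2 h)]
            · have h1 : 0 < ε * G d (v i) := pos_of_mul_pos_left hpos hpos'.le
              rw [lexStep, if_pos h1, if_pos (hiff.1 hpos')]
    -- `f` vanishes on all of `Z`: any basis will do, all signs are `0`, and the level `d + 1` means
    -- that no functional is consulted.
    · push Not at hf
      obtain ⟨c, hc, hspan⟩ := exists_spanning_sequence v hZ
      rw [hd] at hc hspan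
      refine ⟨c, d + 1, le_rfl, ⟨fun h => absurd h (lt_irrefl _), ?_⟩, hc, hspan,
        fun G _ => ⟨0, by simp, ?_, ?_⟩⟩
      · rintro ⟨i, hi, h⟩
        exact absurd (hf i hi) h
      · intro j hj
        simp
        omega
      · intro i hi
        rw [hf i hi, if_pos le_rfl]
        exact lexSide_of_zero fun j _ => by simp

end Flags

end HyperplanePartitions

namespace HyperplanePartitions

open Submodule Module

/-! ### The rows after elimination -/

theorem reduceRows_Ico_span {A : ℕ → ℕ → ℝ} {R j : ℕ} (c : ℕ → ℕ) (hj : j < R) :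
    span ℝ (reduceRows A R c (j + 1) '' Set.Ico j R) =
      span ℝ (reduceRows A R c j '' Set.Ico j R) :=
  elimPass_span (by omega)

theorem reduceRows_span {A : ℕ → ℕ → ℝ} {R j : ℕ} (c : ℕ → ℕ) (hj : j ≤ R) :
    span ℝ (reduceRows A R c j '' Set.Iio R) = span ℝ (A '' Set.Iio R) := by
  induction j with
  | zero => rfl
  | succ j ih =>
    rw [← ih (by omega), show Set.Iio R = Set.Iio j ∪ Set.Ico j R by ext; simp; omega]
    exact span_image_union_eq (fun i hi => elimPass_of_lt (.inl hi)) (reduceRows_Ico_span c hj)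

/-- Zeros in earlier columns persist, because a pass only combines rows from `j` on, and all of
these vanish there already. -/
theorem reduceRows_apply {A : ℕ → ℕ → ℝ} {R j : ℕ} (c : ℕ → ℕ) (hj : j ≤ R) :
    ∀ j' < j, ∀ i, j ≤ i → i < R → reduceRows A R c j i (c j') = 0 := by
  induction j with
  | zero => intro j' h; omega
  | succ j ih =>
    intro j' hj' i hi hiR
    rcases Nat.lt_succ_iff_lt_or_eq.1 hj' with h | rfl
    · refine apply_eq_zero_of_mem_span (s := reduceRows A R c j '' Set.Ico j R) ?_ ?_
      · rintro _ ⟨t, ht, rfl⟩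
        exact ih (by omega) j' h t ht.1 ht.2
      · rw [← reduceRows_Ico_span c hj]
        exact subset_span (Set.mem_image_of_mem _ ⟨by omega, hiR⟩)
    · exact elimPass_apply (by omega) (by omega)

/-- The row `i` may change during its own pass, but only by adding rows below it, which vanish in
the earlier columns too. -/
theorem reducedRow_apply {A : ℕ → ℕ → ℝ} {R i j : ℕ} (c : ℕ → ℕ) (hj : j < i) (hi : i < R) :
    reducedRow A R c i (c j) = 0 := by
  refine apply_eq_zero_of_mem_span (s := reduceRows A R c i '' Set.Ico i R) ?_ ?_
  · rintro _ ⟨t, ht, rfl⟩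
    exact reduceRows_apply c hi.le j hj t ht.1 ht.2
  · rw [← reduceRows_Ico_span c hi]
    exact subset_span (Set.mem_image_of_mem _ ⟨le_rfl, hi⟩)

theorem reduceRows_eq_reducedRow {A : ℕ → ℕ → ℝ} {R i j : ℕ} (c : ℕ → ℕ) (hij : i < j) :
    reduceRows A R c j i = reducedRow A R c i := by
  induction j with
  | zero => omega
  | succ j ih =>
    rcases Nat.lt_succ_iff_lt_or_eq.1 hij with h | rfl
    · rw [reduceRows, elimPass_of_lt (.inl h), ih h]
    · rfl

theorem reducedRow_span (A : ℕ → ℕ → ℝ) (R : ℕ) (c : ℕ → ℕ) :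
    span ℝ (reducedRow A R c '' Set.Iio R) = span ℝ (A '' Set.Iio R) := by
  have h : reducedRow A R c '' Set.Iio R = reduceRows A R c R '' Set.Iio R :=
    Set.image_congr fun i hi => (reduceRows_eq_reducedRow c hi).symm
  rw [h]
  exact reduceRows_span c le_rfl

/-! ### Rows and columns of a matrix, extended by zero -/

section Extend

variable {n m : ℕ} (M : Matrix (Fin n) (Fin m) ℝ)

/-- The rows of `M`, extended by zero. -/
def extRows : ℕ → ℕ → ℝ :=
  fun a i => if h : a < n ∧ i < m then M ⟨a, h.1⟩ ⟨i, h.2⟩ else 0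

/-- The columns of `M`, extended by zero. -/
def extCol (i : ℕ) : Fin n → ℝ := fun a => extRows M a i

theorem extCol_val (i : Fin m) : extCol M i = M.col i := by
  ext a
  simp [extCol, extRows, Matrix.col]

theorem extRows_of_le {a c : ℕ} (h : m ≤ c) : extRows M a c = 0 := by
  rw [extRows, dif_neg]
  omega

theorem extRows_image : extRows M '' Set.Iio n = Set.range fun a : Fin n => extRows M a := by
  ext x
  constructor
  · rintro ⟨a, ha, rfl⟩
    exact ⟨⟨a, ha⟩, rfl⟩
  · rintro ⟨a, rfl⟩
    exact ⟨a, a.2, rfl⟩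

theorem extCol_image : extCol M '' Set.Iio m = Set.range M.col := by
  ext x
  constructor
  · rintro ⟨i, hi, rfl⟩
    exact ⟨⟨i, hi⟩, (extCol_val M ⟨i, hi⟩).symm⟩
  · rintro ⟨i, rfl⟩
    exact ⟨i, i.2, extCol_val M i⟩

theorem mem_span_extRows {x : ℕ → ℝ} : x ∈ span ℝ (extRows M '' Set.Iio n) ↔
    ∃ h : Fin n → ℝ, ∀ i, x i = h ⬝ᵥ extCol M i := by
  rw [extRows_image, mem_span_range_iff_exists_fun]
  refine exists_congr fun h => ?_
  rw [eq_comm, funext_iff]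
  simp [dotProduct, extCol]

theorem finrank_span_extRows :
    finrank ℝ (span ℝ (extRows M '' Set.Iio n)) = M.rank := by
  have hinj : Function.Injective (Function.ExtendByZero.linearMap ℝ (Fin.val : Fin m → ℕ)) := by
    intro x y hxy
    ext i
    have := congrFun hxy i
    simpa [Function.ExtendByZero.linearMap_apply, Fin.val_injective.extend_apply] using this
  have himg : extRows M '' Set.Iio n =
      Function.ExtendByZero.linearMap ℝ (Fin.val : Fin m → ℕ) '' Set.range M.row := by
    rw [extRows_image, ← Set.range_comp]
    congr 1
    ext a i
    by_cases hi : i < m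
    · have := Fin.val_injective.extend_apply (M.row a) 0 ⟨i, hi⟩
      simp [extRows, hi, Function.ExtendByZero.linearMap] at this ⊢
      exact this.symm
    · rw [extRows_of_le M (by omega)]
      simp only [Function.comp, Function.ExtendByZero.linearMap_apply]
      rw [Function.extend_apply' _ _ _ (by rintro ⟨a, rfl⟩; exact hi a.2)]
      rfl
  rw [himg, ← map_span, M.rank_eq_finrank_span_row]
  exact (equivMapOfInjective _ hinj _).finrank_eq.symm

theorem finrank_span_extCol : finrank ℝ (span ℝ (extCol M '' Set.Iio m)) = M.rank := by
  rw [extCol_image, M.rank_eq_finrank_span_cols]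

theorem image_Iio_eq_range {α : Type*} (x : ℕ → α) (r : ℕ) :
    x '' Set.Iio r = Set.range fun j : Fin r => x j := by
  ext y
  constructor
  · rintro ⟨j, hj, rfl⟩
    exact ⟨⟨j, hj⟩, rfl⟩
  · rintro ⟨j, rfl⟩
    exact ⟨j, j.2, rfl⟩

theorem linearIndependent_of_finrank {E : Type*} [AddCommGroup E] [Module ℝ E] {x : ℕ → E} {r : ℕ}
    (h : finrank ℝ (span ℝ (x '' Set.Iio r)) = r) : LinearIndependent ℝ fun j : Fin r => x j := by
  rw [linearIndependent_iff_card_eq_finrank_span, Set.finrank, ← image_Iio_eq_range, h,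
    Fintype.card_fin]

variable {M}

/-- The matrix of the entries `G i (c j)` is triangular, and it is invertible: if it annihilates
`x`, then all rows of `M` annihilate the combination of the independent columns `c j` with
coefficients `x`, so this combination is zero. -/
theorem diagonal_ne_zero {G : ℕ → ℕ → ℝ} {c : ℕ → ℕ} {r : ℕ} (hr : M.rank = r)
    (hG : span ℝ (G '' Set.Iio r) = span ℝ (extRows M '' Set.Iio n))
    (hc : span ℝ ((fun j => extCol M (c j)) '' Set.Iio r) = span ℝ (extCol M '' Set.Iio m))
    (h0 : ∀ i < r, ∀ j < i, G i (c j) = 0) {i : ℕ} (hi : i < r) : G i (c i) ≠ 0 := by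
  have hli : LinearIndependent ℝ fun j : Fin r => extCol M (c j) :=
    linearIndependent_of_finrank (x := fun j => extCol M (c j))
      (by rw [hc, finrank_span_extCol, hr])
  let T : Matrix (Fin r) (Fin r) ℝ := Matrix.of fun i j => G i (c j)
  have hT : T.det ≠ 0 := by
    rw [Ne, ← Matrix.exists_mulVec_eq_zero_iff]
    rintro ⟨x, hx, hTx⟩
    let φ : (ℕ → ℝ) →ₗ[ℝ] ℝ := ∑ j : Fin r, x j • LinearMap.proj (c j)
    have hφ : ∀ y, φ y = ∑ j : Fin r, x j * y (c j) := fun y => by simp [φ]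
    have hφG : span ℝ (G '' Set.Iio r) ≤ LinearMap.ker φ := by
      rw [span_le]
      rintro _ ⟨i, hi, rfl⟩
      have := congrFun hTx ⟨i, hi⟩
      simp only [Matrix.mulVec, dotProduct, T, Matrix.of_apply, Pi.zero_apply] at this
      simp only [SetLike.mem_coe, LinearMap.mem_ker, hφ]
      simpa only [mul_comm] using this
    refine hx (funext (Fintype.linearIndependent_iff.1 hli x ?_))
    ext a
    have : extRows M a ∈ span ℝ (extRows M '' Set.Iio n) :=
      subset_span (Set.mem_image_of_mem _ a.2)
    rw [← hG] at this
    have := hφG this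
    rw [LinearMap.mem_ker, hφ] at this
    simpa [extCol] using this
  have htri : T.IsUpperTriangular := fun i j hij => h0 i i.2 j hij
  rw [Matrix.det_of_isUpperTriangular htri, Finset.prod_ne_zero_iff] at hT
  exact hT ⟨i, hi⟩ (Finset.mem_univ _)

/-- The digit for the column `c` and the sign `e`, for `u` columns. -/
noncomputable def encodeDigit (u c : ℕ) (e : ℝ) : ℕ :=
  c + (if e = 1 then 0 else if e = -1 then u else u + u)

theorem digitColumn_encodeDigit {u c : ℕ} (hc : c < u) (e : ℝ) :
    digitColumn u (encodeDigit u c e) = c := by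
  unfold digitColumn encodeDigit
  split_ifs <;> omega

theorem digitSign_encodeDigit {u c : ℕ} (hc : c < u) {e : ℝ} (he : e = 0 ∨ e = 1 ∨ e = -1) :
    digitSign u (encodeDigit u c e) = e := by
  rcases he with rfl | rfl | rfl
  · rw [encodeDigit, if_neg (by norm_num), if_neg (by norm_num), digitSign, if_neg (by omega),
      if_neg (by omega)]
  · rw [encodeDigit, if_pos rfl, digitSign, if_pos (by omega)]
  · rw [encodeDigit, if_neg (by norm_num), if_pos rfl, digitSign, if_neg (by omega),
      if_pos (by omega)]

theorem exists_dotProduct_ne_zero {h : Fin n → ℝ} (hh : h ≠ 0) (hr : M.rank = n) :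
    ∃ i ∈ Set.Iio m, h ⬝ᵥ extCol M i ≠ 0 := by
  by_contra! hall
  have hli : LinearIndependent ℝ M.row := by
    rw [linearIndependent_iff_card_eq_finrank_span, Set.finrank, ← M.rank_eq_finrank_span_row, hr,
      Fintype.card_fin]
  refine hh (funext (Fintype.linearIndependent_iff.1 hli h ?_))
  ext i
  have := hall i i.2
  rw [extCol_val] at this
  simpa [dotProduct, Matrix.col] using this

theorem exists_ne_zero_of_rank_lt (hr : M.rank < n) :
    ∃ h : Fin n → ℝ, h ≠ 0 ∧ ∀ i, h ⬝ᵥ M.col i = 0 := by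
  have hli : ¬ LinearIndependent ℝ M.row := by
    rw [linearIndependent_iff_card_eq_finrank_span, Set.finrank, ← M.rank_eq_finrank_span_row,
      Fintype.card_fin]
    omega
  rw [Fintype.linearIndependent_iff] at hli
  push Not at hli
  obtain ⟨h, h0, a, ha⟩ := hli
  refine ⟨h, fun hh => ha (by rw [hh]; rfl), fun i => ?_⟩
  have := congrFun h0 i
  simpa [dotProduct, Matrix.col] using this

/-- The sides of all columns for every hyperplane are described by digits. -/
theorem exists_digits {A : ℕ → ℕ → ℝ} {r : ℕ} (hr : M.rank = r) (hrn : r ≤ n)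
    (hA : span ℝ (A '' Set.Iio r) = span ℝ (extRows M '' Set.Iio n)) {h : Fin n → ℝ}
    (hh : h ≠ 0) :
    ∃ d : ℕ → ℕ, (∀ j < r, d j < digitBase n m r j) ∧
      ∀ i : Fin m, blockSide A m r d i r = if 0 ≤ h ⬝ᵥ M.col i then 1 else 0 := by
  obtain ⟨c, a, har, haf, hcm, hcspan, hflag⟩ := exists_flag (extCol M)
    (dotProductEquiv ℝ (Fin n) h) r (Set.Iio m) (Set.finite_Iio m)
    (by rw [finrank_span_extCol, hr])
  -- The last column is replaced by a dummy. This is harmless: each row depends only on earlier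
  -- columns for its zeros, and the last pass has no rows to clear.
  let c' : ℕ → ℕ := fun j => if j + 1 < r then c j else 0
  have hc' : ∀ j, j + 1 < r → c' j = c j := fun j hj => if_pos hj
  have hGspan := (reducedRow_span A r c').trans hA
  have hG0 : ∀ i < r, ∀ j < i, reducedRow A r c' i (c j) = 0 := fun i hi j hj => by
    rw [← hc' j (by omega)]
    exact reducedRow_apply c' hj hi
  have hGd : ∀ i < r, reducedRow A r c' i (c i) ≠ 0 := fun i hi =>
    diagonal_ne_zero hr hGspan hcspan hG0 hi
  have hex : ∀ j, ∃ g : Fin n → ℝ, j < r → ∀ i, reducedRow A r c' j i = g ⬝ᵥ extCol M i := by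
    intro j
    by_cases hj : j < r
    · obtain ⟨g, hg⟩ := (mem_span_extRows M).1
        (hGspan ▸ subset_span (Set.mem_image_of_mem (reducedRow A r c') (Set.mem_Iio.2 hj)))
      exact ⟨g, fun _ => hg⟩
    · exact ⟨0, fun h => absurd h hj⟩
  choose g hg using hex
  obtain ⟨e, he, hea, hes⟩ := hflag (fun j => dotProductEquiv ℝ (Fin n) (g j)) fun i _ hi =>
    ⟨fun j hj => by simpa [← hg i hi] using hG0 i hi j hj,
      by simpa [← hg i hi] using hGd i hi⟩
  have hcu : ∀ j, c' j < columnChoices m r j := by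
    intro j
    simp only [c', columnChoices]
    split_ifs with hj
    · exact hcm j (by omega)
    · omega
  refine ⟨fun j => encodeDigit (columnChoices m r j) (c' j) (e j), fun j hj => ?_, fun i => ?_⟩
  · have hlt := hcu j
    rw [digitBase, Nat.mod_eq_of_lt hj]
    unfold columnChoices at hlt ⊢
    unfold encodeDigit
    by_cases hj' : j + 1 < r
    · simp only [if_pos hj'] at hlt ⊢
      split_ifs <;> omega
    · simp only [if_neg hj'] at hlt ⊢
      by_cases hrn' : r < n
      · rw [if_pos hrn']
        split_ifs <;> omega
      -- For `r = n` a nonzero `h` cannot vanish on all columns, so the last sign is nonzero and the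
      -- base `2` suffices.
      · have hne : e j ≠ 0 := by
          have : a < r := haf.2 (by
            simpa using exists_dotProduct_ne_zero hh (by rw [hr]; omega))
          exact (hea j hj).2 (by omega)
        have := (he j).resolve_left hne
        rw [if_neg hrn']
        split_ifs <;> first | omega | (exfalso; tauto)
  · have := hes i i.2
    simp only [dotProductEquiv_apply_apply, extCol_val] at this
    rw [← this, blockSide]
    refine lexSide_congr fun j hj => ?_
    rw [digitSign_encodeDigit (hcu j) (he j), ← extCol_val, ← hg j hj,
      funext fun j => digitColumn_encodeDigit (hcu j) (e j)]

end Extend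

end HyperplanePartitions

/-! ### From lexicographic signs back to a single hyperplane. -/

namespace HyperplanePartitions

open Submodule Module

/-- Scale the combination for the first `d` functions by a small `δ > 0` and add the next one: where
the latter is nonzero it wins, elsewhere the scaled sign survives. Finitely many columns allow one
`δ`. The normalization of the last weight is needed later to see that the normal vector is nonzero.
-/
theorem exists_lexSide_coeffs (m d : ℕ) (y : ℕ → ℕ → ℝ) :
    ∃ t : ℕ → ℝ, (∀ j, j + 1 = d → t j = 1) ∧ ∀ i < m,
      lexSide (fun j => y j i) d = if 0 ≤ ∑ j ∈ Finset.range d, t j * y j i then 1 else 0 := by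
  induction d with
  | zero => exact ⟨0, by simp, by simp [lexSide]⟩
  | succ d ih =>
    obtain ⟨t, -, ht⟩ := ih
    set z : ℕ → ℝ := fun i => ∑ j ∈ Finset.range d, t j * y j i with hz
    obtain ⟨δ, hδ, hδ0⟩ : ∃ δ : ℝ, (∀ i ∈ Finset.range m, y d i ≠ 0 → |δ * z i| < |y d i|) ∧
        0 < δ := by
      refine ((((Finset.range m).eventually_all).2 fun i _ => ?_).and
        (self_mem_nhdsWithin (a := (0 : ℝ)) (s := Set.Ioi 0))).exists
      by_cases hy : y d i = 0
      · exact Filter.Eventually.of_forall fun _ h => absurd hy h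
      · have hc : Filter.Tendsto (fun δ : ℝ => |δ * z i|) (nhdsWithin 0 (Set.Ioi 0)) (nhds 0) := by
          have : Continuous fun δ : ℝ => |δ * z i| := by fun_prop
          simpa using (this.tendsto 0).mono_left nhdsWithin_le_nhds
        exact (hc.eventually (gt_mem_nhds (abs_pos.2 hy))).mono fun _ h _ => h
    refine ⟨fun j => if j = d then 1 else δ * t j, fun j hj => if_pos (by omega),
      fun i hi => ?_⟩
    have hsum : ∑ j ∈ Finset.range (d + 1), (if j = d then 1 else δ * t j) * y j i =
        δ * z i + y d i := by
      rw [Finset.sum_range_succ, if_pos rfl, one_mul, hz, Finset.mul_sum]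
      congr 1
      refine Finset.sum_congr rfl fun j hj => ?_
      rw [if_neg (Finset.mem_range.1 hj).ne, mul_assoc]
    rw [hsum, lexSide, lexStep, ht i hi]
    have hδi := hδ i (Finset.mem_range.2 hi)
    rcases lt_trichotomy (y d i) 0 with hneg | h0 | hpos
    · have := abs_lt.1 (hδi hneg.ne)
      rw [abs_of_neg hneg] at this
      rw [if_neg hneg.not_gt, if_pos hneg, if_neg (by linarith)]
    · rw [h0, if_neg (lt_irrefl _), if_neg (lt_irrefl _), add_zero]
      simp only [mul_nonneg_iff_of_pos_left hδ0]
      rfl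
    · have := abs_lt.1 (hδi hpos.ne')
      rw [abs_of_pos hpos] at this
      rw [if_pos hpos, if_pos (by linarith)]

variable {n m : ℕ} {M : Matrix (Fin n) (Fin m) ℝ}

/-- The sides that are described by digits are the sides for some hyperplane. -/
theorem exists_hyperplane_of_digits {A : ℕ → ℕ → ℝ} {r : ℕ} (hr : M.rank = r) (hrn : r ≤ n)
    (hn : 0 < n) (hA : span ℝ (A '' Set.Iio r) = span ℝ (extRows M '' Set.Iio n)) {d : ℕ → ℕ}
    (hd : ∀ j < r, d j < digitBase n m r j) :
    ∃ h : Fin n → ℝ, h ≠ 0 ∧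
      ∀ i : Fin m, blockSide A m r d i r = if 0 ≤ h ⬝ᵥ M.col i then 1 else 0 := by
  set c : ℕ → ℕ := fun j => digitColumn (columnChoices m r j) (d j)
  set e : ℕ → ℝ := fun j => digitSign (columnChoices m r j) (d j) with he
  have hGspan := (reducedRow_span A r c).trans hA
  obtain ⟨t, ht1, ht⟩ := exists_lexSide_coeffs m r fun j i => e j * reducedRow A r c j i
  set x : ℕ → ℝ := ∑ j ∈ Finset.range r, (t j * e j) • reducedRow A r c j with hx
  have hxi : ∀ i, x i = ∑ j ∈ Finset.range r, t j * (e j * reducedRow A r c j i) := fun i => by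
    simp [hx, Finset.sum_apply, mul_assoc]
  have hxmem : x ∈ span ℝ (extRows M '' Set.Iio n) := by
    rw [← hGspan]
    exact sum_mem fun j hj => smul_mem _ _
      (subset_span (Set.mem_image_of_mem _ (Finset.mem_range.1 hj)))
  obtain ⟨h, hh⟩ := (mem_span_extRows M).1 hxmem
  have hside : ∀ i : Fin m, blockSide A m r d i r = if 0 ≤ h ⬝ᵥ M.col i then 1 else 0 := by
    intro i
    rw [blockSide, ht i i.2, ← hxi, hh, extCol_val]
  -- The combination may be zero. For rank below `n` a vector orthogonal to all columns replaces it;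
  -- for rank `n` this does not happen.
  by_cases h0 : h = 0
  · rcases hrn.lt_or_eq with hlt | rfl
    · obtain ⟨g, hg, hg0⟩ := exists_ne_zero_of_rank_lt (M := M) (by omega)
      refine ⟨g, hg, fun i => ?_⟩
      rw [hside, h0, hg0, zero_dotProduct]
    · exfalso
      have hli : LinearIndependent ℝ fun j : Fin r => reducedRow A r c j :=
        linearIndependent_of_finrank (by rw [hGspan, finrank_span_extRows, hr])
      have hsum : ∑ j : Fin r, (t j * e j) • reducedRow A r c j = 0 := by
        rw [Fin.sum_univ_eq_sum_range (fun j => (t j * e j) • reducedRow A r c j) r]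
        change x = 0
        ext i
        rw [hh, h0, zero_dotProduct]
        rfl
      -- Independent rows force the last coefficient to vanish, but its weight is `1` and its sign
      -- is `1` or `-1`, since the base of the last digit is `2`.
      have := Fintype.linearIndependent_iff.1 hli (fun j => t j * e j) hsum ⟨r - 1, by omega⟩
      have hd1 := hd (r - 1) (by omega)
      rw [digitBase, Nat.mod_eq_of_lt (by omega), if_neg (by omega), if_neg (by omega)] at hd1
      simp only [ht1 (r - 1) (by omega), one_mul, he, columnChoices,
        if_neg (show ¬ r - 1 + 1 < r by omega), digitSign] at this
      split_ifs at this with h1 h2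
      · norm_num at this
      · norm_num at this
      · omega
  · exact ⟨h, h0, hside⟩

/-! ### Parts one and two -/

theorem dotProductEquiv_extCol (h : Fin n → ℝ) (i : Fin m) :
    dotProductEquiv ℝ (Fin n) h (extCol M i) = h ⬝ᵥ M.col i := by
  rw [dotProductEquiv_apply_apply, extCol_val]

/-- If `h` contains all columns, it serves as `g` itself, as its separation is zero. Otherwise the
rotated functional of `exists_refines` is `g`. -/
theorem exists_hyperplane_through {s : ℕ} (hs : M.rank = s) {h : Fin n → ℝ} (hh : h ≠ 0) :
    ∃ g : Fin n → ℝ, g ≠ 0 ∧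
      (∃ T : Finset (Fin m), s ≤ T.card + 1 ∧ LinearIndependent ℝ (fun i : T => M.col i) ∧
        ContainsColumns M g T) ∧
      (¬ ContainsColumns M h Finset.univ → ¬ ContainsColumns M g Finset.univ) ∧
      IsExtension M h g := by
  have hspan : finrank ℝ (span ℝ (M.col '' Set.univ)) = s := by
    rw [Set.image_univ, ← M.rank_eq_finrank_span_cols, hs]
  by_cases hc : ContainsColumns M h Finset.univ
  · obtain ⟨T, -, -, hli, hcard⟩ := exists_basis_subset M.col (Set.finite_univ (α := Fin m))
    refine ⟨h, hh, ⟨T, by omega, hli, fun i _ => hc i (Finset.mem_univ i)⟩, fun h => absurd hc h,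
      fun i hi => absurd ?_ hi⟩
    rw [separation, hc i (Finset.mem_univ i), sign_zero]
  · have hf : ∃ i ∈ Set.univ, dotProductEquiv ℝ (Fin n) h (M.col i) ≠ 0 := by
      simpa [ContainsColumns] using hc
    obtain ⟨g', ⟨⟨i, -, hi⟩, hcomp⟩, hrank⟩ := exists_refines Set.finite_univ hf
    obtain ⟨g, rfl⟩ := (dotProductEquiv ℝ (Fin n)).surjective g'
    simp only [dotProductEquiv_apply_apply] at hi hcomp
    obtain ⟨T, hT, -, hli, hcard⟩ := exists_basis_subset M.col
      ((Set.finite_univ (α := Fin m)).subset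
        (zeroSet_subset M.col Set.univ (dotProductEquiv ℝ (Fin n) g)))
    refine ⟨g, fun h0 => hi (by rw [h0, zero_dotProduct]), ⟨T, by omega, hli, fun i hi => ?_⟩,
      fun _ hg => hi (hg i (Finset.mem_univ i)), fun i hi => ?_⟩
    · simpa using (hT hi).2
    · have hi' : g ⬝ᵥ M.col i ≠ 0 := fun h0 => hi (by rw [separation, h0, sign_zero])
      have := hcomp i (Set.mem_univ i) hi'
      rw [separation, partition]
      rcases lt_or_gt_of_ne hi' with hneg | hpos
      · rw [sign_neg hneg, if_neg fun h => hneg.not_gt (this.2 h)]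
      · rw [sign_pos hpos, if_pos (this.1 hpos)]

/-- The nested sets are initial segments of the basis from `exists_flag`, below the set of all
columns. Fitting them says precisely that the functionals are triangular in this basis, which is all
that the flag requires; hence any fitting hyperplanes work up to sign. -/
theorem exists_nested {s : ℕ} (hs : M.rank = s) (h : Fin n → ℝ) :
    ∃ (k : ℕ) (S : Fin (k + 1) → Finset (Fin m)),
      k ≤ s ∧ S 0 = Finset.univ ∧ StrictAnti S ∧ (∀ j : Fin k, (S j.succ).card ≤ s) ∧
      (∃ g : Fin k → Fin n → ℝ, Fits M S g) ∧
      ∀ g : Fin k → Fin n → ℝ, Fits M S g →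
        ∃ g' : Fin k → Fin n → ℝ, (∀ j, g' j = g j ∨ g' j = - g j) ∧ IsFirstNonzero M h g' := by
  obtain ⟨c, a, has, haf, hcm, hcspan, hflag⟩ := exists_flag (extCol M)
    (dotProductEquiv ℝ (Fin n) h) s (Set.Iio m) (Set.finite_Iio m)
    (by rw [finrank_span_extCol, hs])
  have hli : LinearIndependent ℝ fun j : Fin s => extCol M (c j) :=
    linearIndependent_of_finrank (x := fun j => extCol M (c j))
      (by rw [hcspan, finrank_span_extCol, hs])
  have hcinj : ∀ j < s, ∀ j' < s, c j = c j' → j = j' := fun j hj j' hj' he =>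
    Fin.mk.inj_iff.1 (hli.injective (a₁ := ⟨j, hj⟩) (a₂ := ⟨j', hj'⟩) (by simp [he]))
  -- the columns `c 0, …, c (t - 1)`
  let B : ℕ → Finset (Fin m) := fun t => Finset.univ.filter fun i => ∃ j < t, c j = i
  have hB : ∀ t i, i ∈ B t ↔ ∃ j < t, c j = i := fun t i => by simp [B]
  have hBcard : ∀ t ≤ s, (B t).card ≤ t := fun t ht => by
    have : (B t).map Fin.valEmbedding ⊆ (Finset.range t).image c := by
      intro x hx
      obtain ⟨i, hi, rfl⟩ := Finset.mem_map.1 hx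
      obtain ⟨j, hj, hji⟩ := (hB t i).1 hi
      exact Finset.mem_image.2 ⟨j, Finset.mem_range.2 hj, hji⟩
    calc _ = ((B t).map Fin.valEmbedding).card := (Finset.card_map _).symm
      _ ≤ _ := Finset.card_le_card this
      _ ≤ t := Finset.card_image_le.trans (by simp)
  -- The sequence descends while the basis of the flag ascends, so `j` corresponds to `s - j`. It
  -- stops at the level `a`, below which `h` vanishes.
  let S : Fin (s - a + 1) → Finset (Fin m) := fun j => if j.1 = 0 then Finset.univ else B (s - j)
  have hS0 : ∀ j, B (s - j.1) ⊆ S j := fun j => by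
    by_cases hj : j.1 = 0
    · rw [show S j = Finset.univ from if_pos hj]
      exact Finset.subset_univ _
    · rw [show S j = B (s - j) from if_neg hj]
  have hSsucc : ∀ j : Fin (s - a), S j.succ = B (s - (j + 1)) := fun j => by simp [S]
  have hlast : ∀ j : Fin (s - a), (⟨c (s - (j + 1)), hcm _ (by omega)⟩ : Fin m) ∈ S j.castSucc ∧
      (⟨c (s - (j + 1)), hcm _ (by omega)⟩ : Fin m) ∉ S j.succ := by
    intro j
    refine ⟨hS0 _ ((hB _ _).2 ⟨s - (j + 1), ?_, rfl⟩), ?_⟩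
    · simp
      omega
    · rw [hSsucc, hB]
      rintro ⟨j', hj', he⟩
      have := hcinj j' (by omega) (s - (j + 1)) (by omega) he
      omega
  refine ⟨s - a, S, by omega, by simp [S], ?_, fun j => ?_, ?_, fun g hg => ?_⟩
  · rw [Fin.strictAnti_iff_succ_lt]
    intro j
    refine Finset.ssubset_iff_subset_ne.2 ⟨?_, fun heq => (hlast j).2 (heq ▸ (hlast j).1)⟩
    refine subset_trans ?_ (hS0 _)
    rw [hSsucc]
    intro i hi
    obtain ⟨j', hj', he⟩ := (hB _ _).1 hi
    exact (hB _ _).2 ⟨j', by simp; omega, he⟩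
  · rw [hSsucc]
    exact (hBcard _ (by omega)).trans (by omega)
  · have hex : ∀ j : Fin (s - a), ∃ g : Fin n → ℝ,
        ContainsColumns M g (S j.succ) ∧ ¬ ContainsColumns M g (S j.castSucc) := by
      intro j
      have hnot := hli.notMem_span_image (s := {i | i.1 < s - (j + 1)})
        (x := ⟨s - (j + 1), by omega⟩) (by simp)
      obtain ⟨w, hw, hw0⟩ := exists_dual_of_notMem hnot
      obtain ⟨g, rfl⟩ := (dotProductEquiv ℝ (Fin n)).surjective w
      refine ⟨g, fun i hi => ?_, fun hg => hw ?_⟩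
      · rw [hSsucc, hB] at hi
        obtain ⟨j', hj', he⟩ := hi
        rw [← extCol_val, ← he, ← dotProductEquiv_apply_apply]
        exact hw0 _ (subset_span ⟨⟨j', by omega⟩, hj', rfl⟩)
      · have := hg _ (hlast j).1
        rw [← extCol_val] at this
        simpa using this
    choose g hg using hex
    exact ⟨g, hg⟩
  -- The hyperplanes `g j`, renumbered to the ascending order of the flag; values below the level
  -- `a` are not used.
  · let idx : ℕ → Fin n → ℝ := fun i => if hi : s - (i + 1) < s - a then g ⟨s - (i + 1), hi⟩ else 0
    have hidx : ∀ j : Fin (s - a), idx (s - (j + 1)) = g j := fun j => by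
      have : s - (s - (j.1 + 1) + 1) = j := by omega
      simp [idx, this]
    have hvan : ∀ j : Fin (s - a), ∀ j' < s - (j + 1), g j ⬝ᵥ extCol M (c j') = 0 := by
      intro j j' hj'
      have := (hg j).1 ⟨c j', hcm j' (by omega)⟩ (by rw [hSsucc]; exact (hB _ _).2 ⟨j', hj', rfl⟩)
      rwa [← extCol_val] at this
    have hne : ∀ j : Fin (s - a), g j ⬝ᵥ extCol M (c (s - (j + 1))) ≠ 0 := by
      intro j h0
      have hall : ∀ j' < s - j, g j ⬝ᵥ extCol M (c j') = 0 := fun j' hj' => by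
        rcases Nat.lt_or_eq_of_le (show j' ≤ s - (j + 1) by omega) with hlt | rfl
        exacts [hvan j j' hlt, h0]
      refine (hg j).2 fun i hi => ?_
      rw [← extCol_val]
      -- The set at index `0` holds all columns instead of basis columns only; vanishing on the
      -- basis extends to it by linearity.
      by_cases hj : j.1 = 0
      · have hmem : extCol M i ∈ span ℝ ((fun j => extCol M (c j)) '' Set.Iio s) := by
          rw [hcspan]
          exact subset_span (Set.mem_image_of_mem _ i.2)
        have hker : span ℝ ((fun j => extCol M (c j)) '' Set.Iio s) ≤
            LinearMap.ker (dotProductEquiv ℝ (Fin n) (g j)) := by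
          rw [span_le]
          rintro _ ⟨j', hj', rfl⟩
          simpa using hall j' (by simpa [hj] using hj')
        simpa using hker hmem
      · have hi' : i ∈ B (s - j) := by rwa [← show S j.castSucc = B (s - j) from if_neg hj]
        obtain ⟨j', hj', he⟩ := (hB _ _).1 hi'
        rw [← he]
        exact hall j' hj'
    obtain ⟨e, he, hea, hes⟩ := hflag (fun i => dotProductEquiv ℝ (Fin n) (idx i)) fun i hai hi => by
      have hi' : idx i = g ⟨s - (i + 1), by omega⟩ := by
        rw [← hidx]
        congr 1
        simp
        omega
      have hii : s - (s - (i + 1) + 1) = i := by omega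
      have h1 := hvan ⟨s - (i + 1), by omega⟩
      have h2 := hne ⟨s - (i + 1), by omega⟩
      simp only [hii, ← hi'] at h1 h2
      exact ⟨by simpa using h1, by simpa using h2⟩
    refine ⟨fun j => e (s - (j + 1)) • g j, fun j => ?_, fun i => ?_⟩
    · rcases (he (s - (j + 1))).resolve_left ((hea _ (by omega)).2 (by omega)) with h | h
      · simp [h]
      · simp [h]
    · have hy : ∀ j : Fin (s - a),
          e (s - (j + 1)) * dotProductEquiv ℝ (Fin n) (idx (s - (j + 1))) (extCol M i) =
            (e (s - (j + 1)) • g j) ⬝ᵥ M.col i := fun j => by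
        rw [hidx, dotProductEquiv_extCol, smul_dotProduct, smul_eq_mul]
      have hi := hes i i.2
      rw [dotProductEquiv_extCol] at hi
      have hzero : ∀ i' < s, i' < a → e i' = 0 := fun i' hi' hia => by
        by_contra h0
        have := (hea i' hi').1 h0
        omega
      have hexj : ∀ i' < s, a ≤ i' → ∃ j : Fin (s - a), i' = s - (j + 1) := fun i' hi' hia =>
        ⟨⟨s - (i' + 1), by omega⟩, by simp; omega⟩
      simp only [separation, partition]
      refine ⟨fun j hj hj' => ?_, fun hall => ?_⟩
      · have hj0 : (e (s - (j + 1)) • g j) ⬝ᵥ M.col i ≠ 0 := fun h0 => hj (by rw [h0, sign_zero])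
        rw [lexSide_of_last (j := s - (j + 1)) (by omega) (by rwa [hy]), hy] at hi
        · rcases lt_or_gt_of_ne hj0 with hneg | hpos
          · rw [if_neg hneg.not_gt] at hi
            rw [sign_neg hneg]
            exact if_neg fun hp => by simp [if_pos hp] at hi
          · rw [if_pos hpos] at hi
            rw [sign_pos hpos]
            exact if_pos (by_contra fun hp => by simp [if_neg hp] at hi)
        · intro i' hi' hlt
          obtain ⟨j₂, rfl⟩ := hexj i' hi' (by omega)
          rw [hy]
          exact sign_eq_zero_iff.1 (hj' j₂ (by rw [Fin.lt_def]; omega))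
      · rw [lexSide_of_zero] at hi
        · exact if_pos (by_contra fun hp => by simp [if_neg hp] at hi)
        · intro i' hi'
          by_cases hia : i' < a
          · rw [hzero i' hi' hia, zero_mul]
          · obtain ⟨j, rfl⟩ := hexj i' hi' (by omega)
            rw [hy]
            exact sign_eq_zero_iff.1 (hall j)

end HyperplanePartitions

namespace HyperplanePartitions

open Submodule

/-! ### Blocks of digits -/

theorem reduceRows_congr {A : ℕ → ℕ → ℝ} {R j : ℕ} {c c' : ℕ → ℕ} (h : ∀ j' < j, c j' = c' j') :
    reduceRows A R c j = reduceRows A R c' j := by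
  induction j with
  | zero => rfl
  | succ j ih =>
    rw [reduceRows, reduceRows, ih fun j' hj' => h j' (by omega), h j (by omega)]

theorem blockSide_congr {A : ℕ → ℕ → ℝ} {m r i : ℕ} {d d' : ℕ → ℕ} (h : ∀ j < r, d j = d' j) :
    blockSide A m r d i r = blockSide A m r d' i r := by
  refine lexSide_congr fun j hj => ?_
  rw [h j hj, reducedRow, reducedRow, reduceRows_congr fun j' hj' => by rw [h j' (by omega)]]

theorem digitBase'_block {n m r K q j : ℕ} (hq : q < K) (hj : j < r) :
    digitBase' n m r (K * r) (q * r + j) = digitBase n m r j := by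
  have := RealRAM.row_le (m := r) hq
  rw [digitBase', if_pos (by omega), digitBase, digitBase, Nat.mul_add_mod', Nat.mod_eq_of_lt hj]

theorem digit_block_lt {n m r K q j : ℕ} (x : ℕ) (hm : 0 < r → 0 < m) (hq : q < K) (hj : j < r) :
    digit (digitBase' n m r (K * r)) x (q * r + j) < digitBase n m r j := by
  rw [← digitBase'_block hq hj]
  exact Nat.mod_lt _ (digitBase'_pos hm (by simp +contextual) _)

theorem exists_digit_block_eq {n m r K : ℕ} {d : ℕ → ℕ → ℕ}
    (hd : ∀ q < K, ∀ j < r, d q j < digitBase n m r j) :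
    ∃ x < placeValue (digitBase' n m r (K * r)) (K * r), ∀ q < K, ∀ j < r,
      digit (digitBase' n m r (K * r)) x (q * r + j) = d q j := by
  obtain ⟨x, hx, hxd⟩ := exists_digit_eq (b := digitBase' n m r (K * r))
    (t := fun p => d (p / r) (p % r)) (N := K * r) fun p hp => by
      have hr : 0 < r := Nat.pos_of_mul_pos_left (by omega : 0 < K * r)
      have hq : p / r < K := Nat.div_lt_of_lt_mul (by rwa [mul_comm])
      have hb := digitBase'_block (n := n) (m := m) hq (Nat.mod_lt p hr)
      rw [Nat.div_add_mod'] at hb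
      rw [hb]
      exact hd _ hq _ (Nat.mod_lt p hr)
  refine ⟨x, hx, fun q hq j hj => ?_⟩
  have := RealRAM.row_le (m := r) hq
  rw [hxd _ (by omega), Nat.mul_add_mod', Nat.mod_eq_of_lt hj, mul_comm q,
    Nat.mul_add_div (by omega), Nat.div_eq_of_lt hj, add_zero]

theorem map_range_eq_ofFn {α : Type*} (m : ℕ) (f : ℕ → α) :
    (List.range m).map f = List.ofFn fun i : Fin m => f i := by
  refine List.ext_getElem (by simp) fun i h₁ h₂ => by simp

/-! ### Parts of a simplicial partition -/

theorem one_le_partLetter {k l : ℕ} {w : ℕ → ℕ} {t : ℕ} (ht : t ≤ k) :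
    1 ≤ partLetter k l w t ∧ partLetter k l w t ≤ k + 1 := by
  induction t with
  | zero => simp [partLetter]
  | succ t ih =>
    rw [partLetter]
    split_ifs
    · omega
    · exact ih (by omega)

/-- Parts count from the front and families in memory from the back. For `p < k`, `hle` says that
the family of the part `p + 1` is among the `t` families seen; `p = k` is the remaining part. -/
theorem partLetter_eq {k l : ℕ} {w : ℕ → ℕ} {p t : ℕ} (ht : t ≤ k) (hp : p ≤ k)
    (hle : k ≤ p + t) (hw : p < k → ∀ b < l, w ((k - 1 - p) * l + b) ≠ 0)
    (hlt : ∀ p' < p, k ≤ p' + t → ¬ ∀ b < l, w ((k - 1 - p') * l + b) ≠ 0) :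
    partLetter k l w t = p + 1 := by
  induction t with
  | zero =>
    rw [partLetter]
    omega
  | succ t ih =>
    rw [partLetter]
    by_cases hpt : p + (t + 1) = k
    · have := hw (by omega)
      rw [show k - 1 - p = t by omega] at this
      rw [if_pos this]
      omega
    · have := hlt (k - (t + 1)) (by omega) (by omega)
      rw [show k - 1 - (k - (t + 1)) = t by omega] at this
      rw [if_neg this]
      exact ih (by omega) (by omega) fun p' hp' h => hlt p' hp' (by omega)

/-! ### Bounds -/

/-- Induction from `3` on, because `3 * (s + 2) ^ 2 ≤ (s + 3) * (s + 1) ^ 2` fails at `s = 2`. The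
factor `6` is what `s = 2` needs, where the inequality is `81 ≤ 96`. -/
theorem three_pow_mul_sq_le (s : ℕ) : 3 ^ s * (s + 1) ^ 2 ≤ 6 * (s + 2) ^ s := by
  rcases Nat.lt_or_ge s 3 with h | h
  · interval_cases s <;> norm_num
  · induction s, h using Nat.le_induction with
    | base => norm_num
    | succ s hs ih =>
      have h1 : (s + 2) ^ s ≤ (s + 3) ^ s := Nat.pow_le_pow_left (by omega) s
      have h2 : 3 * (s + 2) ^ 2 ≤ (s + 3) * (s + 1) ^ 2 := by nlinarith
      calc 3 ^ (s + 1) * (s + 1 + 1) ^ 2 = 3 ^ s * (3 * (s + 2) ^ 2) := by ring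
        _ ≤ 3 ^ s * ((s + 3) * (s + 1) ^ 2) := Nat.mul_le_mul_left _ h2
        _ = (s + 3) * (3 ^ s * (s + 1) ^ 2) := by ring
        _ ≤ (s + 3) * (6 * (s + 3) ^ s) :=
          Nat.mul_le_mul_left _ (ih.trans (Nat.mul_le_mul_left _ h1))
        _ = 6 * (s + 1 + 2) ^ (s + 1) := by ring

theorem wordCost_one_one_le (m s : ℕ) : wordCost m 1 1 s ≤ 30 * ((s + 1) ^ 2 * (m + 1)) := by
  rw [wordCost]
  have : 0 ≤ s * s * m := Nat.zero_le _
  nlinarith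

theorem wordCost_le {m k l r s : ℕ} (hr : r ≤ s) : wordCost m k l r ≤ wordCost 1 k l s * (m + 1) := by
  have h : wordCost m k l r ≤ wordCost m k l s := by
    unfold wordCost
    gcongr
  refine h.trans ?_
  unfold wordCost
  have h1 : k * l * (s * (s * (m * 12 + 25) + m * 12 + 30) + m * 4 + 12) ≤
      k * l * (s * (s * (1 * 12 + 25) + 1 * 12 + 30) + 1 * 4 + 12) * (m + 1) := by
    rw [mul_assoc (k * l)]
    refine Nat.mul_le_mul_left _ ?_
    nlinarith [Nat.zero_le (s * s * m), Nat.zero_le (s * m), Nat.zero_le (s * s)]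
  nlinarith [Nat.zero_le (k * l * s * m), Nat.zero_le (k * (l * 6 + 8))]

/-- The cost factor `m` of a word is absorbed by the exponent, as `(r - 1) * K + 1 ≤ K * s`, unless
the exponent is zero; then reading the matrix pays for it. -/
theorem pow_mul_succ_le {n m r s K : ℕ} (hm : 0 < r → 0 < m) (hr : r ≤ s) :
    m ^ ((r - 1) * K) * (m + 1) ≤ 2 * ((n + 1) * (m + 1) + m ^ (K * s)) := by
  have h1 : m + 1 ≤ (n + 1) * (m + 1) := Nat.le_mul_of_pos_left _ (by omega)
  rcases Nat.eq_zero_or_pos ((r - 1) * K) with h | h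
  · rw [h, pow_zero]
    omega
  · have hK : 0 < K := Nat.pos_of_mul_pos_left h
    have hr1 : 0 < r - 1 := Nat.pos_of_mul_pos_right h
    have hm' := hm (by omega)
    have he : (r - 1) * K + 1 ≤ K * s := by
      have := Nat.mul_le_mul_left K (show r - 1 + 1 ≤ s by omega)
      rw [mul_comm (r - 1)]
      rw [mul_add] at this
      omega
    calc m ^ ((r - 1) * K) * (m + 1) ≤ m ^ ((r - 1) * K) * (2 * m) :=
          Nat.mul_le_mul_left _ (by omega)
      _ = 2 * m ^ ((r - 1) * K + 1) := by ring
      _ ≤ 2 * m ^ (K * s) := Nat.mul_le_mul_left _ (Nat.pow_le_pow_right hm' he)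
      _ ≤ _ := by omega

end HyperplanePartitions

/-! ### Input, output, and the program for hyperplane partitions. -/

namespace RealRAM

open HyperplanePartitions

theorem input_matAt {n m : ℕ} (params : List ℕ) (M : Matrix (Fin n) (Fin m) ℝ) :
    MatAt (input params M).rmem 0 n m (extRows M) := by
  intro i hi c hc
  have := row_le (m := m) hi
  have h : (0 + i * m + c) < n * m := by omega
  have he : finProdFinEquiv.symm ⟨0 + i * m + c, h⟩ = ((⟨i, hi⟩, ⟨c, hc⟩) : Fin n × Fin m) := by
    rw [Equiv.symm_apply_eq]
    ext
    simp [finProdFinEquiv]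
    ring
  simp only [input, dif_pos h, he, extRows, dif_pos (And.intro hi hc)]

theorem Trip.exists_prints {P : Prog} {params : List ℕ} {n m b : ℕ} {M : Matrix (Fin n) (Fin m) ℝ}
    {Q : List ℕ → Prop} (h : Trip P (input params M) b fun T => Q T.out)
    {α : Type*} {f : α → List ℕ} {R : List α → Prop}
    (hQ : ∀ o, Q o → ∃ L, R L ∧ o = (L.map f).flatMap (· ++ [0])) :
    ∃ L t, Prints P params M (L.map f) t ∧ R L ∧ t ≤ b := by
  obtain ⟨t, T, he, ht, hT⟩ := h
  obtain ⟨L, hL, ho⟩ := hQ _ hT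
  exact ⟨L, t, ⟨T, he, ho⟩, hL, ht⟩

/-- Prints all hyperplane partitions of the columns of a matrix. -/
def hyperplanePartitions : Prog :=
  -- Register 5 still holds its initial `0`, so the test is `0 < n`. For `n = 0` there is no nonzero
  -- normal vector, and nothing may be printed.
  .ite (.lt 5 0) (.instr (.const 2 1) ;; .instr (.const 3 1) ;; .instr (.const 4 3) ;; enumerate)
    .skip

end RealRAM

/-! ### The printed words are the partitions. -/

namespace HyperplanePartitions

open Submodule

variable {n m : ℕ} {M : Matrix (Fin n) (Fin m) ℝ}

theorem exists_hyperplanePartitions {A : ℕ → ℕ → ℝ} {s : ℕ} (hs : M.rank = s) (hn : 0 < n)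
    (hsn : s ≤ n) (hA : span ℝ (A '' Set.Iio s) = span ℝ (extRows M '' Set.Iio n)) :
    ∃ L : List (Fin m → SignType), (∀ σ, σ ∈ L ↔ IsHyperplanePartition M σ) ∧
      ((List.range (placeValue (digitBase' n m s (1 * 1 * s)) (1 * 1 * s))).flatMap
        fun x => wordOf A n m 1 1 3 s x ++ [0]) = (L.map signWord).flatMap (· ++ [0]) := by
  have hm : 0 < s → 0 < m := fun h => by
    have := M.rank_le_width
    omega
  let d : ℕ → ℕ → ℕ := fun x j => digit (digitBase' n m s (1 * 1 * s)) x (0 * s + j)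
  let f : ℕ → Fin m → SignType := fun x i => if blockSide A m s (d x) i s = 0 then -1 else 1
  refine ⟨(List.range (placeValue (digitBase' n m s (1 * 1 * s)) (1 * 1 * s))).map f,
    fun σ => ?_, ?_⟩
  · have hf : ∀ x (h : Fin n → ℝ), (∀ i : Fin m, blockSide A m s (d x) i s =
        if 0 ≤ h ⬝ᵥ M.col i then 1 else 0) → f x = partition M h := fun x h hx => by
      ext i
      simp only [f, hx, partition]
      by_cases h0 : 0 ≤ h ⬝ᵥ M.col i <;> simp [h0]
    rw [List.mem_map]
    constructor
    · rintro ⟨x, -, rfl⟩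
      obtain ⟨h, h0, hx⟩ := exists_hyperplane_of_digits hs hsn hn hA (d := d x)
        fun j hj => digit_block_lt x hm (by omega) hj
      exact ⟨h, h0, hf x h hx⟩
    · rintro ⟨h, h0, rfl⟩
      obtain ⟨e, he, hh⟩ := exists_digits hs hsn hA h0
      obtain ⟨x, hx, hxd⟩ := exists_digit_block_eq (K := 1 * 1) (d := fun _ => e)
        fun q _ j hj => he j hj
      refine ⟨x, List.mem_range.2 hx, hf x h fun i => ?_⟩
      rw [← hh i]
      exact blockSide_congr fun j hj => hxd 0 (by omega) j hj
  · rw [List.map_map, List.flatMap_map]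
    congr 1
    funext x
    congr 1
    rw [wordOf, map_range_eq_ofFn, Function.comp, signWord]
    congr 1
    funext i
    -- A single family of one hyperplane: the nonnegative side is part 1 and the negative side is
    -- part 2. Subtracting from 3 gives the codes 2 and 1.
    change flipLetter 3 (if ∀ b < 1, blockSide A m s
      (fun j => digit (digitBase' n m s (1 * 1 * s)) x ((0 * 1 + b) * s + j)) i s ≠ 0 then 1 - 0
        else 1 + 1) = signCode (if blockSide A m s (d x) i s = 0 then -1 else 1)
    have h : (∀ b < 1, blockSide A m s
        (fun j => digit (digitBase' n m s (1 * 1 * s)) x ((0 * 1 + b) * s + j)) i s ≠ 0) ↔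
        blockSide A m s (d x) i s ≠ 0 := by
      simp [d]
    simp only [h]
    by_cases h0 : blockSide A m s (d x) i s = 0
    · rw [if_neg (not_not.2 h0), if_pos h0]
      rfl
    · rw [if_pos h0, if_neg h0]
      rfl

/-- Only one inclusion is claimed: for `n = 0` a word is printed although there are no hyperplanes.
-/
theorem exists_simplicialPartitions {A : ℕ → ℕ → ℝ} {k s r : ℕ} (hr : M.rank = r)
    (hrn : r ≤ n) (hA : span ℝ (A '' Set.Iio r) = span ℝ (extRows M '' Set.Iio n)) :
    ∃ L : List (Fin m → Fin (k + 1)), (∀ σ, IsSimplicialPartition M k s σ → σ ∈ L) ∧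
      ((List.range (placeValue (digitBase' n m r (k * s * r)) (k * s * r))).flatMap
        fun x => wordOf A n m k s 0 r x ++ [0]) = (L.map partWord).flatMap (· ++ [0]) := by
  let w : ℕ → ℕ → ℕ → ℕ := fun x i q =>
    blockSide A m r (fun j => digit (digitBase' n m r (k * s * r)) x (q * r + j)) i r
  let f : ℕ → Fin m → Fin (k + 1) := fun x i => ⟨partLetter k s (w x i) k - 1, by
    have := one_le_partLetter (l := s) (w := w x i) (le_refl k)
    omega⟩
  refine ⟨(List.range (placeValue (digitBase' n m r (k * s * r)) (k * s * r))).map f, ?_, ?_⟩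
  · rintro σ ⟨H, hH, hσ⟩
    -- The family `j` occupies the blocks of the memory family `k - 1 - j`. Indices `q` outside all
    -- families get arbitrary digits.
    have hex : ∀ q, ∃ d : ℕ → ℕ, ∀ (j : Fin k) (l : Fin s), q = (k - 1 - j) * s + l →
        (∀ p < r, d p < digitBase n m r p) ∧
        ∀ i : Fin m, blockSide A m r d i r = if 0 ≤ H j l ⬝ᵥ M.col i then 1 else 0 := by
      intro q
      by_cases hq : q < k * s
      · have hs : 0 < s := Nat.pos_of_mul_pos_left (by omega : 0 < k * s)
        have hqk : k - 1 - q / s < k := by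
          have : q / s < k := Nat.div_lt_of_lt_mul (by rwa [mul_comm])
          generalize q / s = a at this ⊢
          omega
        obtain ⟨d, hd⟩ := exists_digits hr hrn hA
          (hH ⟨k - 1 - q / s, hqk⟩ ⟨q % s, Nat.mod_lt q hs⟩)
        refine ⟨d, fun j l hjl => ?_⟩
        have h1 : q / s = k - 1 - j := by
          rw [hjl, mul_comm, Nat.mul_add_div hs, Nat.div_eq_of_lt l.2, add_zero]
        have h2 : q % s = l := by rw [hjl, Nat.mul_add_mod', Nat.mod_eq_of_lt l.2]
        have hj : j = ⟨k - 1 - q / s, hqk⟩ := Fin.ext (by simp only [h1]; omega)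
        have hl : l = ⟨q % s, Nat.mod_lt q hs⟩ := Fin.ext h2.symm
        rwa [hj, hl]
      · refine ⟨fun _ => 0, fun j l hjl => ?_⟩
        have := RealRAM.row_le (m := s) (show k - 1 - j < k by omega)
        omega
    choose d hd using hex
    have hblock : ∀ q < k * s, ∃ (j : Fin k) (l : Fin s), q = (k - 1 - j) * s + l := by
      intro q hq
      have hs : 0 < s := Nat.pos_of_mul_pos_left (by omega : 0 < k * s)
      obtain ⟨p, hp⟩ : ∃ p, p = q / s := ⟨_, rfl⟩
      have hpk : p < k := hp ▸ Nat.div_lt_of_lt_mul (by rwa [mul_comm])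
      refine ⟨⟨k - 1 - p, by omega⟩, ⟨q % s, Nat.mod_lt q hs⟩, ?_⟩
      rw [show k - 1 - (k - 1 - p) = p by omega, hp, Nat.div_add_mod']
    obtain ⟨x, hx, hxd⟩ := exists_digit_block_eq (n := n) (m := m) (r := r) (K := k * s) (d := d)
      fun q hq p hp => by
        obtain ⟨j, l, hjl⟩ := hblock q hq
        exact (hd q j l hjl).1 p hp
    have hw : ∀ (i : Fin m) (j : Fin k),
        (∀ b < s, w x i ((k - 1 - j) * s + b) ≠ 0) ↔ i ∈ cell M H j := by
      intro i j
      have hwb : ∀ b : Fin s, w x i ((k - 1 - j) * s + b) =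
          if 0 ≤ H j b ⬝ᵥ M.col i then 1 else 0 := fun b => by
        have := RealRAM.row_le (m := s) (show k - 1 - j < k by omega)
        rw [← (hd _ j b rfl).2 i]
        exact blockSide_congr fun p hp => hxd _ (by omega) p hp
      constructor
      · intro h l
        by_contra h0
        exact h l l.2 (by rw [hwb, if_neg h0])
      · intro h b hb
        rw [hwb ⟨b, hb⟩, if_pos (h ⟨b, hb⟩)]
        exact one_ne_zero
    refine List.mem_map.2 ⟨x, List.mem_range.2 hx, funext fun i => Fin.ext ?_⟩
    have hlt : ∀ (p : ℕ) (hp : p < k), p < σ i → i ∉ cell M H ⟨p, hp⟩ := by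
      intro p hp hpσ hcell
      have h := (hσ i ⟨p, hp⟩).2 ⟨hcell, fun j' hj' he => by
        rw [he, Fin.val_castSucc] at hpσ
        exact absurd (Fin.lt_def.1 hj') hpσ.not_gt⟩
      rw [h, Fin.val_castSucc] at hpσ
      exact lt_irrefl _ hpσ
    have := partLetter_eq (k := k) (l := s) (w := w x i) (p := σ i) (t := k) le_rfl (by omega)
      (by omega) (fun hp => (hw i ⟨σ i, hp⟩).2 ((hσ i ⟨σ i, hp⟩).1 rfl).1)
      fun p hp _ h => hlt p (by omega) hp ((hw i ⟨p, by omega⟩).1 h)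
    simp only [f, this, Nat.add_sub_cancel]
  · rw [List.map_map, List.flatMap_map]
    congr 1
    funext x
    congr 1
    rw [wordOf, map_range_eq_ofFn, Function.comp, partWord]
    congr 1
    funext i
    have := one_le_partLetter (l := s) (w := w x i) (le_refl k)
    simp only [f, flipLetter, if_neg (lt_irrefl 0)]
    exact (Nat.sub_add_cancel this.1).symm

end HyperplanePartitions

/-! ### Time bounds and the final theorem. -/

namespace RealRAM

open HyperplanePartitions

theorem enumerate_bound (n m k l r s : ℕ) (hm : 0 < r → 0 < m) (hr : r ≤ s) :
    n * 3 + k * 3 + n * (m * 6 + 5) + r * (n * (m * 18 + 30) + 15) + k * l * (r * 7 + 4) +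
      (3 ^ r * m ^ (r - 1)) ^ (k * l) * wordCost m k l r + 34 ≤
    (2 * 3 ^ (s * (k * l)) * wordCost 1 k l s + (k * 3 + s * 45 + k * l * (s * 7 + 4) + 45)) *
      ((n + 1) * (m + 1) + m ^ (k * l * s)) := by
  have h1 : (3 ^ r * m ^ (r - 1)) ^ (k * l) * wordCost m k l r ≤
      2 * 3 ^ (s * (k * l)) * wordCost 1 k l s * ((n + 1) * (m + 1) + m ^ (k * l * s)) := by
    calc (3 ^ r * m ^ (r - 1)) ^ (k * l) * wordCost m k l r
        = 3 ^ (r * (k * l)) * m ^ ((r - 1) * (k * l)) * wordCost m k l r := by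
          rw [mul_pow, ← pow_mul, ← pow_mul]
      _ ≤ 3 ^ (s * (k * l)) * m ^ ((r - 1) * (k * l)) * (wordCost 1 k l s * (m + 1)) := by
          gcongr
          · norm_num
          · exact wordCost_le hr
      _ = 3 ^ (s * (k * l)) * wordCost 1 k l s * (m ^ ((r - 1) * (k * l)) * (m + 1)) := by ring
      _ ≤ 3 ^ (s * (k * l)) * wordCost 1 k l s * (2 * ((n + 1) * (m + 1) + m ^ (k * l * s))) :=
          Nat.mul_le_mul_left _ (pow_mul_succ_le hm hr)
      _ = _ := by ring
  have h2 : n * 3 + k * 3 + n * (m * 6 + 5) + r * (n * (m * 18 + 30) + 15) +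
      k * l * (r * 7 + 4) + 34 ≤
      (k * 3 + s * 45 + k * l * (s * 7 + 4) + 45) * ((n + 1) * (m + 1)) := by
    have ha : r * (n * (m * 18 + 30) + 15) ≤ s * 45 * ((n + 1) * (m + 1)) := by
      rw [mul_assoc]
      refine Nat.mul_le_mul hr ?_
      nlinarith [Nat.zero_le (n * m)]
    have hb : k * l * (r * 7 + 4) ≤ k * l * (s * 7 + 4) * ((n + 1) * (m + 1)) :=
      (Nat.mul_le_mul_left _ (by omega)).trans (Nat.le_mul_of_pos_right _ (by positivity))
    have hc : k * 3 ≤ k * 3 * ((n + 1) * (m + 1)) := Nat.le_mul_of_pos_right _ (by positivity)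
    have hd : n * 3 + n * (m * 6 + 5) + 34 ≤ 45 * ((n + 1) * (m + 1)) := by
      nlinarith [Nat.zero_le (n * m)]
    linarith
  have h3 : (k * 3 + s * 45 + k * l * (s * 7 + 4) + 45) * ((n + 1) * (m + 1)) ≤
      (k * 3 + s * 45 + k * l * (s * 7 + 4) + 45) * ((n + 1) * (m + 1) + m ^ (k * l * s)) :=
    Nat.mul_le_mul_left _ (Nat.le_add_right _ _)
  linarith

/-- The constant `38` is the `34` of `enumerate_spec` plus the test for `n` and three constant
assignments. -/
theorem hyperplanePartitions_bound (n m s : ℕ) (hm : 0 < s → 0 < m) :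
    n * 3 + 1 * 3 + n * (m * 6 + 5) + s * (n * (m * 18 + 30) + 15) + 1 * 1 * (s * 7 + 4) +
      (3 ^ s * m ^ (s - 1)) ^ (1 * 1) * wordCost m 1 1 s + 38 ≤
    500 * ((n + 1) * (m + 1) * (s + 1) + m ^ s * (s + 2) ^ s) := by
  have h1 : (3 ^ s * m ^ (s - 1)) ^ (1 * 1) * wordCost m 1 1 s ≤
      360 * ((m + 1) + m ^ s * (s + 2) ^ s) := by
    -- For `s = 0` the truncated exponent yields no spare factor `m`; then `m + 1` is charged to the
    -- reading of the matrix.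
    have h : m ^ (s - 1) * (m + 1) ≤ if s = 0 then m + 1 else 2 * m ^ s := by
      split_ifs with hs
      · simp [hs]
      · have := hm (by omega)
        obtain ⟨s, rfl⟩ := Nat.exists_eq_succ_of_ne_zero hs
        rw [Nat.succ_sub_one, pow_succ]
        nlinarith [Nat.mul_le_mul_left (m ^ s) (show m + 1 ≤ 2 * m by omega)]
    calc (3 ^ s * m ^ (s - 1)) ^ (1 * 1) * wordCost m 1 1 s
        ≤ 3 ^ s * m ^ (s - 1) * (30 * ((s + 1) ^ 2 * (m + 1))) := by
          rw [one_mul, pow_one]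
          exact Nat.mul_le_mul_left _ (wordCost_one_one_le m s)
      _ = 30 * (3 ^ s * (s + 1) ^ 2) * (m ^ (s - 1) * (m + 1)) := by ring
      _ ≤ 30 * (6 * (s + 2) ^ s) * if s = 0 then m + 1 else 2 * m ^ s :=
          Nat.mul_le_mul (Nat.mul_le_mul_left _ (three_pow_mul_sq_le s)) h
      _ ≤ _ := by
          split_ifs with hs
          · subst hs
            simp
            omega
          · linarith
  have ha : s * (n * (m * 18 + 30) + 15) ≤ 45 * ((n + 1) * (m + 1) * s) := by
    have : n * (m * 18 + 30) + 15 ≤ 45 * ((n + 1) * (m + 1)) := by nlinarith [Nat.zero_le (n * m)]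
    nlinarith [Nat.mul_le_mul_left s this]
  have hb : n * 3 + n * (m * 6 + 5) + 45 ≤ 50 * ((n + 1) * (m + 1)) := by
    nlinarith [Nat.zero_le (n * m)]
  have hc : s ≤ (n + 1) * (m + 1) * s := Nat.le_mul_of_pos_left _ (by positivity)
  have hd : m + 1 ≤ (n + 1) * (m + 1) := Nat.le_mul_of_pos_left _ (by omega)
  linarith [Nat.zero_le (m ^ s * (s + 2) ^ s)]

theorem hyperplanePartitions_spec {n m s : ℕ} {M : Matrix (Fin n) (Fin m) ℝ} (hs : M.rank = s) :
    ∃ (L : List (Fin m → SignType)) (t : ℕ),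
      Prints hyperplanePartitions [n, m] M (L.map signWord) t ∧
      (∀ σ, σ ∈ L ↔ IsHyperplanePartition M σ) ∧
      t ≤ 500 * ((n + 1) * (m + 1) * (s + 1) + m ^ s * (s + 2) ^ s) := by
  have hm : 0 < s → 0 < m := fun h => by
    have := M.rank_le_width
    omega
  refine Trip.exists_prints (Q := fun o => (n = 0 ∧ o = []) ∨ (0 < n ∧ ∃ A, s ≤ n ∧
    Submodule.span ℝ (A '' Set.Iio s) = Submodule.span ℝ (extRows M '' Set.Iio n) ∧
    o = (List.range (placeValue (digitBase' n m s (1 * 1 * s)) (1 * 1 * s))).flatMap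
      fun x => wordOf A n m 1 1 3 s x ++ [0])) (Trip.le (Trip.ite (fun h => ?_) fun h => ?_)
    (hyperplanePartitions_bound n m s hm)) ?_
  · refine Trip.step <| Trip.step <| Trip.step <| Trip.imp (enumerate_spec (n := n) (m := m)
      (S := (Instr.const 4 3).run ((Instr.const 3 1).run ((Instr.const 2 1).run
        (input [n, m] M)))) (k := 1) (l := 1) (flip := 3) (s := s) (A₀ := extRows M) rfl rfl rfl rfl rfl rfl rfl
      (input_matAt [n, m] M) (fun i c h => extRows_of_le M h)
      (by rw [finrank_span_extRows, hs])) fun T hT => .inr ⟨h, hT⟩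
  · exact Trip.le (Trip.skip (.inl ⟨Nat.eq_zero_of_not_pos h, rfl⟩)) (by omega)
  · rintro o (⟨rfl, rfl⟩ | ⟨hn, A, hsn, hA, rfl⟩)
    · refine ⟨[], fun σ => ?_, rfl⟩
      simp only [List.not_mem_nil, false_iff]
      rintro ⟨h, h0, -⟩
      exact h0 (Subsingleton.elim _ _)
    · exact exists_hyperplanePartitions hs hn hsn hA

theorem enumerate_prints {n m k s : ℕ} {M : Matrix (Fin n) (Fin m) ℝ} (hs : M.rank ≤ s) :
    ∃ (L : List (Fin m → Fin (k + 1))) (t : ℕ),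
      Prints enumerate [n, m, k, s] M (L.map partWord) t ∧
      (∀ σ, IsSimplicialPartition M k s σ → σ ∈ L) ∧
      t ≤ (2 * 3 ^ (s * (k * s)) * wordCost 1 k s s + (k * 3 + s * 45 + k * s * (s * 7 + 4) + 45)) *
        ((n + 1) * (m + 1) + m ^ (k * s ^ 2)) := by
  obtain ⟨r, hr⟩ : ∃ r, M.rank = r := ⟨_, rfl⟩
  have hm : 0 < r → 0 < m := fun h => by
    have := M.rank_le_width
    omega
  have hb := enumerate_bound n m k s r s hm (hr ▸ hs)
  rw [mul_assoc k s s, ← sq] at hb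
  refine Trip.exists_prints (Q := fun o => ∃ A, r ≤ n ∧
    Submodule.span ℝ (A '' Set.Iio r) = Submodule.span ℝ (extRows M '' Set.Iio n) ∧
    o = (List.range (placeValue (digitBase' n m r (k * s * r)) (k * s * r))).flatMap
      fun x => wordOf A n m k s 0 r x ++ [0]) (Trip.le (enumerate_spec (n := n) (m := m) (k := k)
    (l := s) (flip := 0) (s := r) (A₀ := extRows M) rfl rfl rfl rfl rfl rfl rfl
    (input_matAt [n, m, k, s] M) (fun i c h => extRows_of_le M h) (by rw [finrank_span_extRows, hr])) hb) ?_
  rintro o ⟨A, hrn, hA, rfl⟩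
  exact exists_simplicialPartitions hr hrn hA

end RealRAM

theorem mainTheorem10 :
    (∀ (n m s : ℕ) (M : Matrix (Fin n) (Fin m) ℝ), M.rank = s →
      ∀ h : Fin n → ℝ, h ≠ 0 →
        ∃ g : Fin n → ℝ, g ≠ 0 ∧
          (∃ T : Finset (Fin m), s ≤ T.card + 1 ∧
            LinearIndependent ℝ (fun i : T => M.col i) ∧
            HyperplanePartitions.ContainsColumns M g T) ∧
          (¬ HyperplanePartitions.ContainsColumns M h Finset.univ →
            ¬ HyperplanePartitions.ContainsColumns M g Finset.univ) ∧
          HyperplanePartitions.IsExtension M h g) ∧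
    (∀ (n m s : ℕ) (M : Matrix (Fin n) (Fin m) ℝ), M.rank = s →
      ∀ h : Fin n → ℝ, h ≠ 0 →
        ∃ (k : ℕ) (S : Fin (k + 1) → Finset (Fin m)),
          k ≤ s ∧ S 0 = Finset.univ ∧ StrictAnti S ∧ (∀ j : Fin k, (S j.succ).card ≤ s) ∧
          (∃ g : Fin k → Fin n → ℝ, HyperplanePartitions.Fits M S g) ∧
          ∀ g : Fin k → Fin n → ℝ, HyperplanePartitions.Fits M S g →
            ∃ g' : Fin k → Fin n → ℝ, (∀ j, g' j = g j ∨ g' j = - g j) ∧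
              HyperplanePartitions.IsFirstNonzero M h g') ∧
    (∃ (P : RealRAM.Prog) (C : ℕ),
      ∀ (n m s : ℕ) (M : Matrix (Fin n) (Fin m) ℝ), M.rank = s →
        ∃ (L : List (Fin m → SignType)) (t : ℕ),
          RealRAM.Prints P [n, m] M (L.map HyperplanePartitions.signWord) t ∧
          (∀ σ, σ ∈ L ↔ HyperplanePartitions.IsHyperplanePartition M σ) ∧
          t ≤ C * ((n + 1) * (m + 1) * (s + 1) + m ^ s * (s + 2) ^ s)) ∧
    (∃ (P : RealRAM.Prog) (C : ℕ → ℕ → ℕ),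
      ∀ (n m k s : ℕ) (M : Matrix (Fin n) (Fin m) ℝ), M.rank ≤ s →
        ∃ (L : List (Fin m → Fin (k + 1))) (t : ℕ),
          RealRAM.Prints P [n, m, k, s] M (L.map HyperplanePartitions.partWord) t ∧
          (∀ σ, HyperplanePartitions.IsSimplicialPartition M k s σ → σ ∈ L) ∧
          t ≤ C k s * ((n + 1) * (m + 1) + m ^ (k * s ^ 2))) := by
  refine ⟨fun n m s M hs h hh => HyperplanePartitions.exists_hyperplane_through hs hh,
    fun n m s M hs h _ => HyperplanePartitions.exists_nested hs h,
    ⟨RealRAM.hyperplanePartitions, 500, fun n m s M hs => RealRAM.hyperplanePartitions_spec hs⟩,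
    ⟨RealRAM.enumerate, fun k s => 2 * 3 ^ (s * (k * s)) * HyperplanePartitions.wordCost 1 k s s +
      (k * 3 + s * 45 + k * s * (s * 7 + 4) + 45),
      fun n m k s M hs => RealRAM.enumerate_prints hs⟩⟩
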